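/- Let $N>1$ and let $a_{i,j}\in\mathbb C$ ($1\le i\le N$, $1\le j\le 2i-1$) be arbitrary. Define the elementary Schur polynomials by $\sum_{k\ge0}S_k(\mathbf x)\epsilon^k=\exp\big(\sum_{n\ge1}x_n\epsilon^n\big)$, put $x_k^+=\frac{1}{k!}x+\frac{2^k}{k!}\,\mathrm i y-\frac{4\cdot3^k}{k!}t$, and define the real numbers $s_j$ by $\sum_{j\ge1}s_j\alpha^j=\ln\big[\frac2\alpha\tanh\frac\alpha2\big]$. With $\mathbf a_i=(a_{i,1},a_{i,2},\dots)$ and $n_i=2i-1$, i.e. $\Lambda=(1,3,\dots,2N-1)$, let $$u_\Lambda=2\,\partial_x^2\ln\sigma,\qquad \sigma=\det_{1\le i,j\le N}(m_{ij}),\qquad m_{ij}=\sum_{\nu=0}^{\min(n_i,n_j)}4^{-\nu}\,S_{n_i-\nu}(\mathbf x^++\nu\mathbf s+\mathbf a_i)\,S_{n_j-\nu}\big((\mathbf x^+)^*+\nu\mathbf s^*+\mathbf a_j^*\big)$$ be the corresponding higher-order lump of the KP-I equation $(u_t+6uu_x+u_{xxx})_x-3u_{yy}=0$, and let $$u_1(x,y,t)=\frac{16\,[1-4(x-12t)^2+16y^2]}{[1+4(x-12t)^2+16y^2]^2}$$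 be the fundamental lump. Let $D=\mathrm{diag}(a_{1,1},\dots,a_{N,1})$, let $F$ be the lower triangular $N\times N$ matrix with entries $1/(i-j)!$ for $i\ge j$, let $G=F^{-1}DF$, let $M_r$ be the minor of $G$ on its last $r$ rows and first $r$ columns ($M_0=1$), and let $\beta_{r,r}=(-1)^{r-1}M_r/M_{r-1}$ for $1\le r\le[N/2]$. Assume that $M_r\ne0$ for $1\le r\le[N/2]-1$, and that $\beta_{[N/2],[N/2]}\ne0$ if $N$ is odd, $\beta_{[N/2],[N/2]}\neq-\frac43$ if $N$ is even. For $1\le r\le[N/2]$ put $m_r=2N-1-4(r-1)$ and $p_r=N-1-2(r-1)$, and let $Z_r$ be the set of all complex solutions $z_0$ of $$z^{m_r}=(-1)^N\,\tilde\beta_r\;m_r!!\,(m_r-2)!!,$$ where $\tilde\beta_r=\beta_{r,r}$, except that $\tilde\beta_{[N/2]}=\beta_{[N/2],[N/2]}+\frac43$ if $N$ is even. Then each $Z_r$ consists of exactly $m_r$ nonzero numbers, and these together with one further lump when $N$ is odd make up $N(N+1)/2$ fundamental lumps, into which $u_\Lambda$ splits as $|t|\to\infty$. That is, there are positions $(x_0,y_0)=(x_0(t),y_0(t))$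 relative to $(12t,0)$, one for each $z_0\in Z_r$, $1\le r\le[N/2]$, and one for the central lump when $N$ is odd, such that: 1. for $z_0\in Z_r$, with the real branch of the odd root, $$x_0+2\mathrm i y_0=z_0\,(-12t)^{p_r/m_r}\big(1+O(|t|^{-1/m_r})\big);$$ thus the lumps lie asymptotically on $[N/2]$ concentric rings centred at $(12t,0)$, the $r$-th of which carries $m_r$ lumps; 2. for odd $N$ the position of the central lump relative to $(12t,0)$ is bounded; 3. the distance between any two of the lumps tends to infinity; 4. near each lump with $z_0\in Z_r$, uniformly for $(x,y)$ at bounded distance from $(12t+x_0,y_0)$, $$u_\Lambda(x,y,t)=u_1(x-x_0,y-y_0,t)+O\big(|t|^{-1/m_r}\big);$$ 5. uniformly on the whole $(x,y)$ plane, $u_\Lambda(x,y,t)-\sum u_1(x-x_0,y-y_0,t)\to0$, where the sum runs over all $N(N+1)/2$ lumps. All limits and $O$-terms are for $|t|\to\infty$, i.e. both for $t\to+\infty$ and for $t\to-\infty$. -/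

import Mathlib

open scoped Nat ComplexConjugate

noncomputable section

namespace KPLump

/-- The elementary Schur polynomial `S_k(x)`, `x = (x₁, x₂, …)` (the entry `x 0` is ignored):
the coefficient of `ε ^ k` in `exp (∑_{n ≥ 1} x_n ε ^ n)`. -/
def schur (k : ℕ) (x : ℕ → ℂ) : ℂ :=
  PowerSeries.coeff k
    ((PowerSeries.exp ℂ).subst (PowerSeries.mk fun n => if n = 0 then 0 else x n))

/-- `x_k⁺ = x / k! + (2 ^ k / k!) i y + (3 ^ k / k!) (-4) t`. -/
def xPlus (x y t : ℝ) (k : ℕ) : ℂ :=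
  (x : ℂ) / (k ! : ℂ) + (2 : ℂ) ^ k / (k ! : ℂ) * Complex.I * (y : ℂ)
    + (3 : ℂ) ^ k / (k ! : ℂ) * (-4) * (t : ℂ)

/-- The function `α ↦ ln ((2 / α) tanh (α / 2))` with its removable singularity at `0` removed. -/
def logTanh (α : ℝ) : ℝ :=
  if α = 0 then 0 else Real.log (2 / α * Real.tanh (α / 2))

/-- The Taylor coefficients `s_j` of `ln ((2 / α) tanh (α / 2)) = ∑_{j ≥ 1} s_j α ^ j`. -/
def sCoeff (j : ℕ) : ℂ :=
  ((iteratedDeriv j logTanh 0 / (j ! : ℝ) : ℝ) : ℂ)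

/-- The matrix entry `m_{ij}` for the index vector `n` and the internal parameters `a`;
`a i k` is the `k`-th component (`k ≥ 1`) of the parameter vector of row `i`.
Only the components `1 ≤ k ≤ n i` are used. -/
def mEntry {N : ℕ} (n : Fin N → ℕ) (a : Fin N → ℕ → ℂ) (x y t : ℝ) (i j : Fin N) : ℂ :=
  ∑ ν ∈ Finset.range (min (n i) (n j) + 1),
    ((4 : ℂ) ^ ν)⁻¹
      * schur (n i - ν) (fun k => xPlus x y t k + (ν : ℂ) * sCoeff k + a i k)
      * schur (n j - ν) (fun k => conj (xPlus x y t k) + (ν : ℂ) * conj (sCoeff k) + conj (a j k))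

/-- The determinant `σ(x, y, t)`. -/
def sigma {N : ℕ} (n : Fin N → ℕ) (a : Fin N → ℕ → ℂ) (x y t : ℝ) : ℂ :=
  (Matrix.of fun i j => mEntry n a x y t i j).det

theorem conj_schur (k : ℕ) (x : ℕ → ℂ) :
    conj (schur k x) = schur k (fun j => conj (x j)) := by
  have hs : ∀ z : ℕ → ℂ, PowerSeries.HasSubst
      (PowerSeries.mk fun n => if n = 0 then (0 : ℂ) else z n) := fun z =>
    PowerSeries.HasSubst.of_constantCoeff_zero' (by simp)
  have hm : (PowerSeries.mk fun n => if n = 0 then (0 : ℂ) else conj (x n))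
      = PowerSeries.map (starRingEnd ℂ) (PowerSeries.mk fun n => if n = 0 then (0 : ℂ) else x n) := by
    ext n
    by_cases h : n = 0 <;> simp [h]
  unfold schur
  rw [PowerSeries.coeff_subst' (hs x), PowerSeries.coeff_subst' (hs _), hm]
  refine Eq.trans (AddMonoidHom.map_finsum (starRingEnd ℂ : ℂ →+ ℂ)
    (PowerSeries.coeff_subst_finite' (hs x) (PowerSeries.exp ℂ) k)) ?_
  refine finsum_congr fun d => ?_
  rw [← map_pow, PowerSeries.coeff_map]
  simp only [PowerSeries.coeff_exp, smul_eq_mul, AddMonoidHom.coe_coe, map_mul]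
  congr 1
  simp

theorem conj_mEntry {N : ℕ} (n : Fin N → ℕ) (a : Fin N → ℕ → ℂ) (x y t : ℝ) (i j : Fin N) :
    conj (mEntry n a x y t i j) = mEntry n a x y t j i := by
  unfold mEntry
  rw [map_sum, min_comm]
  refine Finset.sum_congr rfl fun ν _ => ?_
  rw [map_mul, map_mul, conj_schur, conj_schur, mul_right_comm]
  simp only [map_add, map_mul, Complex.conj_conj, map_inv₀, map_pow, map_natCast, Complex.conj_ofNat]

/-- `σ` is real-valued. -/
theorem sigma_im {N : ℕ} (n : Fin N → ℕ) (a : Fin N → ℕ → ℂ) (x y t : ℝ) :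
    (sigma n a x y t).im = 0 := by
  have h : (Matrix.of fun i j => mEntry n a x y t i j).IsHermitian := by
    ext i j
    exact conj_mEntry n a x y t j i
  have h2 : conj (sigma n a x y t) = sigma n a x y t := by
    unfold sigma
    conv_rhs => rw [← h.eq]
    exact (Matrix.det_conjTranspose _).symm
  exact Complex.conj_eq_iff_im.1 h2

/-- The `N`-th order lump `u_Λ = 2 ∂ₓ² ln σ` with index vector `n`. -/
def higherLump {N : ℕ} (n : Fin N → ℕ) (a : Fin N → ℕ → ℂ) (x y t : ℝ) : ℝ :=
  2 * iteratedDeriv 2 (fun ξ : ℝ => Real.log (sigma n a ξ y t).re) x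

/-- The index vector `(1, 3, …, 2N - 1)`. -/
def oddIndex (N : ℕ) (i : Fin N) : ℕ := 2 * (i : ℕ) + 1

/-- The fundamental lump, a single hump centred at `(12 t, 0)`. -/
def fundLump (x y t : ℝ) : ℝ :=
  16 * (1 - 4 * (x - 12 * t) ^ 2 + 16 * y ^ 2) / (1 + 4 * (x - 12 * t) ^ 2 + 16 * y ^ 2) ^ 2

/-- The lower triangular matrix with entries `1 / (i - j)!`. -/
def matF (N : ℕ) : Matrix (Fin N) (Fin N) ℂ :=
  Matrix.of fun i j => if j ≤ i then 1 / ((((i : ℕ) - (j : ℕ))! : ℕ) : ℂ) else 0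

/-- `D = diag (a_{1,1}, …, a_{N,1})`. -/
def matD {N : ℕ} (a : Fin N → ℕ → ℂ) : Matrix (Fin N) (Fin N) ℂ :=
  Matrix.diagonal fun i => a i 1

/-- `G = F⁻¹ D F`. -/
def matG {N : ℕ} (a : Fin N → ℕ → ℂ) : Matrix (Fin N) (Fin N) ℂ :=
  (matF N)⁻¹ * matD a * matF N

/-- The minor `M_r` of `G` on its last `r` rows and first `r` columns (`M_0 = 1`). -/
def minorM {N : ℕ} (a : Fin N → ℕ → ℂ) (r : ℕ) (hr : r ≤ N) : ℂ :=
  ((matG a).submatrix (fun i : Fin r => (⟨N - r + (i : ℕ), by omega⟩ : Fin N))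
    (Fin.castLE hr)).det

/-- The pivot `β_{r+1,r+1}`, `r = 0, …, [N/2] - 1`, of the elimination from the bottom row upwards
(`G_{N+1-[N/2] ≤ i ≤ N, 1 ≤ j ≤ [N/2]} = A B`, `A` unit upper triangular, `B` zero above the
antidiagonal, with antidiagonal `β_{1,1}, β_{2,2}, …` read from the bottom left). As the lower left
`r × r` block of `A B` has determinant `(-1) ^ (r (r - 1) / 2) β_{1,1} ⋯ β_{r,r}`, it is
`β_{r+1,r+1} = (-1) ^ r M_{r+1} / M_r`. -/
def beta {N : ℕ} (a : Fin N → ℕ → ℂ) (r : Fin (N / 2)) : ℂ :=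
  (-1) ^ (r : ℕ) * (minorM a ((r : ℕ) + 1) (by omega) / minorM a (r : ℕ) (by omega))

/-- The nondegeneracy assumption: `M_r ≠ 0` for `1 ≤ r ≤ [N/2] - 1`, and the last pivot
`β_{[N/2],[N/2]}` differs from `0` if `N` is odd and from `-4/3` if `N` is even. -/
def Nondegenerate {N : ℕ} (a : Fin N → ℕ → ℂ) : Prop :=
  (∀ (r : ℕ) (hr : r ≤ N), 1 ≤ r → r + 1 ≤ N / 2 → minorM a r hr ≠ 0) ∧
  (∀ r : Fin (N / 2), (r : ℕ) + 1 = N / 2 → beta a r ≠ if Even N then -(4 / 3) else 0)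

/-- The number of lumps on ring `r + 1`: `2N - 1 - 4r`. -/
def ringSize (N : ℕ) (r : Fin (N / 2)) : ℕ := 2 * N - 1 - 4 * (r : ℕ)

/-- The numerator `N - 1 - 2r` of the growth exponent of ring `r + 1`. -/
def ringNum (N : ℕ) (r : Fin (N / 2)) : ℕ := N - 1 - 2 * (r : ℕ)

/-- `β_{r+1,r+1}`, increased by `4/3` on the innermost ring for even `N`. -/
def ringBeta {N : ℕ} (a : Fin N → ℕ → ℂ) (r : Fin (N / 2)) : ℂ :=
  if Even N ∧ (r : ℕ) + 1 = N / 2 then beta a r + 4 / 3 else beta a r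

/-- The values `z₀` of ring `r + 1`: with `m = 2N - 1 - 4r` all complex solutions of
`z ^ m = (-1) ^ N β m!! (m - 2)!!`. -/
def ringRoots {N : ℕ} (a : Fin N → ℕ → ℂ) (r : Fin (N / 2)) : Finset ℂ :=
  Polynomial.nthRootsFinset (ringSize N r)
    ((-1 : ℂ) ^ N * ringBeta a r * ((ringSize N r)‼ : ℂ) * ((ringSize N r - 2)‼ : ℂ))

/-- The real number `b ^ (p / m)` for odd `m`, with the real branch for negative `b`. -/
def oddPow (b : ℝ) (p m : ℕ) : ℝ := Real.sign b ^ p * |b| ^ ((p : ℝ) / (m : ℝ))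

/-- The lumps: one for each root on each ring, and one central lump if `N` is odd. -/
abbrev LumpIndex {N : ℕ} (a : Fin N → ℕ → ℂ) : Type :=
  (Σ r : Fin (N / 2), {z : ℂ // z ∈ ringRoots a r}) ⊕ Fin (N % 2)

end KPLump

end

/-! The matrix `(m_ij)` is a Gram matrix Φ Φ*, where Φ is an N × 2N matrix of Schur polynomials, so
Cauchy–Binet writes σ as a sum of squared moduli of the N × N minors of Φ (`sigma_re_eq`). Put w =
(x - 12t) + 2iy and τ = -12t. The addition formula for Schur polynomials factors Φ into a matrix in
τ, a matrix in w and a diagonal matrix (`schurMat_eq`). A second Cauchy–Binet then expands the minor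
on the columns J as a sum over column sets D: a function of τ of order τ ^ `expT D` times a
polynomial in w and conj w with leading part a multiple of w ^ (`expX D` - `gap J`).

The lumps sit at the zeros of the first minor, J = {0, …, N-1}. Its large-time behaviour is read off
a Newton polygon. The vertices are the sets {1, 3, …, 2(N-s)-1} ∪ {0, 2, …, 2(s-1)} for 0 ≤ s ≤
[N/2], and every edge carries only its two end points (`weight_lt`). On an edge, the scaling τ = κ ^
m, w = κ ^ p ω leaves a multiple of ω ^ n (ω ^ m - q). The constant q is the right-hand side of the
equation for the ring. Between neighbouring vertices the coefficients in τ differ by the pivot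
(`leadTime_vertexCols_succ`), where the correction 4/3 for even N stems from the third time
variable, and the coefficients in w differ by a quotient of Vandermonde determinants, which gives
the double factorials (`leadMinor_vertexCols_succ`). The nonzero roots are simple, hence persist as
exact zeros w₀ of the first minor (`Nondegenerate.exists_ringFun_root`).

Near such a zero the first minor is close to A (w - w₀), its x-derivative to A, the minor on {0, …,
N-2, N} to A / 2, and all other minors and derivatives up to order two are of lower order. Hence σ
is close to |A|² (|w - w₀|² + 1/4), which is the fundamental lump
(`isBigO_higherLump_sub_fundLump`). For odd N the last vertex has degree 1 in w, so at bounded w the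
first minor is linear to leading order, and its zero is the central lump.

Everywhere else either an edge polynomial that does not vanish, a large multiple of A, or a single
monomial (`Between.isLittleO`) dominates all derivatives, and the solution tends to zero. Uniformity
on the plane is obtained by testing along ultrafilters (`Nondegenerate.exists_lumps`). -/

noncomputable section
namespace KPLump
open Finset

/-! ### The Cauchy–Binet formula -/

/-- Strictly increasing choices of `n` indices out of `m`. -/
abbrev Cols (n m : ℕ) : Type := {f : Fin n → Fin m // StrictMono f}

instance (n m : ℕ) : Fintype (Cols n m) := by
  classical
  infer_instance

/-- With `sort_unique`, this groups the Leibniz sum over injective maps by column sets. -/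
theorem exists_sort {n m : ℕ} {g : Fin n → Fin m} (hg : Function.Injective g) :
    ∃ (f : Cols n m) (π : Equiv.Perm (Fin n)), g = f.1 ∘ π := by
  refine ⟨⟨g ∘ Tuple.sort g, (Tuple.monotone_sort g).strictMono_of_injective
    (hg.comp (Tuple.sort g).injective)⟩, (Tuple.sort g)⁻¹, ?_⟩
  ext i
  simp

theorem sort_unique {n m : ℕ} {f f' : Cols n m} {π π' : Equiv.Perm (Fin n)}
    (h : f.1 ∘ π = f'.1 ∘ π') : f = f' ∧ π = π' := by
  have hr : Set.range f.1 = Set.range f'.1 := by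
    rw [← π.surjective.range_comp f.1, h, π'.surjective.range_comp f'.1]
  have hf : f = f' := Subtype.ext ((StrictMono.range_inj f.2 f'.2).1 hr)
  refine ⟨hf, ?_⟩
  subst hf
  ext i
  have := f.2.injective (congrFun h i)
  simp only [this]

/-- The sign of the permutation enters both determinants and squares to one. Products of
complementary minors may therefore be computed in any convenient order of the columns. -/
theorem det_mul_det_submatrix_comp {n m : ℕ} {R : Type*} [CommRing R]
    (A : Matrix (Fin n) (Fin m) R) (B : Matrix (Fin m) (Fin n) R) (f : Fin n → Fin m)
    (π : Equiv.Perm (Fin n)) :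
    (A.submatrix id (f ∘ π)).det * (B.submatrix (f ∘ π) id).det
      = (A.submatrix id f).det * (B.submatrix f id).det := by
  have h1 : (A.submatrix id (f ∘ π)).det = Equiv.Perm.sign π * (A.submatrix id f).det :=
    Matrix.det_permute' π (A.submatrix id f)
  have h2 : (B.submatrix (f ∘ π) id).det = Equiv.Perm.sign π * (B.submatrix f id).det :=
    Matrix.det_permute π (B.submatrix f id)
  rw [h1, h2, mul_mul_mul_comm]
  rcases Int.units_eq_one_or (Equiv.Perm.sign π) with h | h <;> simp [h]

/-- The Cauchy–Binet formula. -/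
theorem det_mul_cauchyBinet {n m : ℕ} {R : Type*} [CommRing R]
    (A : Matrix (Fin n) (Fin m) R) (B : Matrix (Fin m) (Fin n) R) :
    (A * B).det = ∑ f : Cols n m, (A.submatrix id f.1).det * (B.submatrix f.1 id).det := by
  classical
  -- Multilinearity in the rows gives a sum over all maps `g`. Maps that are not injective repeat a
  -- row, and the injective ones are sorted.
  have h1 : (A * B).det
      = ∑ g : Fin n → Fin m, (∏ i, A i (g i)) * (B.submatrix g id).det := by
    have : (A * B) = Matrix.of fun i => ∑ k, A i k • B k := by
      ext i j
      simp [Matrix.mul_apply, Finset.sum_apply]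
    rw [this]
    change Matrix.detRowAlternating (fun i => ∑ k, A i k • B k) = _
    have := (Matrix.detRowAlternating (n := Fin n) (R := R)).toMultilinearMap.map_sum
      (fun i k => A i k • B k)
    refine this.trans (Finset.sum_congr rfl fun g _ => ?_)
    exact ((Matrix.detRowAlternating (n := Fin n) (R := R)).toMultilinearMap.map_smul_univ
      (fun i => A i (g i)) (fun i => B (g i)))
  have h2 : ∑ g : Fin n → Fin m, (∏ i, A i (g i)) * (B.submatrix g id).det
      = ∑ g ∈ univ.filter (fun g : Fin n → Fin m => Function.Injective g),
        (∏ i, A i (g i)) * (B.submatrix g id).det := by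
    symm
    refine Finset.sum_subset (Finset.filter_subset _ _) fun g _ hg => ?_
    have hg' : ¬ Function.Injective g := by simpa using hg
    rw [Function.Injective] at hg'
    push Not at hg'
    obtain ⟨i, j, hij, hne⟩ := hg'
    rw [Matrix.det_zero_of_row_eq hne (by ext k; simp [hij]), mul_zero]
  have h3 : ∑ g ∈ univ.filter (fun g : Fin n → Fin m => Function.Injective g),
        (∏ i, A i (g i)) * (B.submatrix g id).det
      = ∑ q : Cols n m × Equiv.Perm (Fin n),
        (∏ i, A i (q.1.1 (q.2 i))) * (B.submatrix (q.1.1 ∘ q.2) id).det := by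
    symm
    refine Finset.sum_bij (fun q _ => q.1.1 ∘ q.2) ?_ ?_ ?_ ?_
    · intro q _
      simpa using q.1.2.injective.comp q.2.injective
    · rintro ⟨f, π⟩ _ ⟨f', π'⟩ _ h
      obtain ⟨h1, h2⟩ := sort_unique h
      exact Prod.ext h1 h2
    · intro g hg
      obtain ⟨f, π, h⟩ := exists_sort (by simpa using hg)
      exact ⟨(f, π), by simp, h.symm⟩
    · intro q _
      rfl
  rw [h1, h2, h3, Fintype.sum_prod_type]
  refine Finset.sum_congr rfl fun f _ => ?_
  rw [← Matrix.det_transpose, Matrix.det_apply, Finset.sum_mul]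
  refine Finset.sum_congr rfl fun π _ => ?_
  have h2 : (B.submatrix (f.1 ∘ π) id).det = Equiv.Perm.sign π * (B.submatrix f.1 id).det :=
    Matrix.det_permute π (B.submatrix f.1 id)
  rw [h2]
  simp [Units.smul_def]
  ring

/-! ### Elementary Schur polynomials -/

/-- The power series `∑_{n ≥ 1} x_n ε ^ n`. -/
def argSeries (x : ℕ → ℂ) : PowerSeries ℂ := PowerSeries.mk fun n => if n = 0 then 0 else x n

theorem hasSubst_argSeries (x : ℕ → ℂ) : PowerSeries.HasSubst (argSeries x) :=
  PowerSeries.HasSubst.of_constantCoeff_zero' (by simp [argSeries])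

/-- The generating function of the elementary Schur polynomials. -/
def schurSeries (x : ℕ → ℂ) : PowerSeries ℂ := (PowerSeries.exp ℂ).subst (argSeries x)

theorem coeff_schurSeries (k : ℕ) (x : ℕ → ℂ) :
    PowerSeries.coeff k (schurSeries x) = schur k x := rfl

theorem derivative_schurSeries (x : ℕ → ℂ) :
    PowerSeries.derivative ℂ (schurSeries x)
      = schurSeries x * PowerSeries.derivative ℂ (argSeries x) := by
  rw [schurSeries, PowerSeries.derivative_subst (hasSubst_argSeries x), PowerSeries.derivative_exp]

theorem schur_zero (x : ℕ → ℂ) : schur 0 x = 1 := by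
  rw [← coeff_schurSeries, PowerSeries.coeff_zero_eq_constantCoeff_apply, schurSeries,
    ← PowerSeries.coeff_zero_eq_constantCoeff_apply, PowerSeries.coeff_subst' (hasSubst_argSeries x)]
  rw [finsum_eq_single _ 0]
  · simp
  · intro d hd
    simp [argSeries, hd]

/-- Coefficient comparison in S' = S X'. This recursion is what the later inductions on degrees and
on powers of time use in place of the definition by substitution. -/
theorem succ_mul_schur (n : ℕ) (x : ℕ → ℂ) :
    ((n : ℂ) + 1) * schur (n + 1) x
      = ∑ k ∈ range (n + 1), ((k : ℂ) + 1) * x (k + 1) * schur (n - k) x := by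
  have h := congrArg (PowerSeries.coeff n) (derivative_schurSeries x)
  rw [PowerSeries.coeff_derivative, coeff_schurSeries, PowerSeries.coeff_mul,
    Finset.Nat.sum_antidiagonal_eq_sum_range_succ_mk, ← Finset.sum_range_reflect] at h
  rw [mul_comm, h]
  refine Finset.sum_congr rfl fun k hk => ?_
  have hk' : k ≤ n := by simpa [Nat.lt_succ_iff] using hk
  have : n - (n + 1 - 1 - k) = k := by omega
  rw [PowerSeries.coeff_derivative, coeff_schurSeries]
  simp only [this, argSeries, PowerSeries.coeff_mk]
  simp
  ring

theorem constantCoeff_schurSeries (x : ℕ → ℂ) :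
    PowerSeries.constantCoeff (schurSeries x) = 1 := by
  rw [← PowerSeries.coeff_zero_eq_constantCoeff_apply, coeff_schurSeries, schur_zero]

/-- Uniqueness for the linear differential equation f' = f p: in characteristic zero the
coefficients are determined recursively. -/
theorem eq_of_derivative_eq_mul {f g p : PowerSeries ℂ}
    (hf : PowerSeries.derivative ℂ f = f * p) (hg : PowerSeries.derivative ℂ g = g * p)
    (h0 : PowerSeries.constantCoeff f = PowerSeries.constantCoeff g) : f = g := by
  ext n
  induction n using Nat.strong_induction_on with
  | _ n ih =>
    rcases n with _ | n
    · simpa using h0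
    have h1 := congrArg (PowerSeries.coeff n) hf
    have h2 := congrArg (PowerSeries.coeff n) hg
    rw [PowerSeries.coeff_derivative, PowerSeries.coeff_mul] at h1 h2
    have : ∑ q ∈ antidiagonal n, PowerSeries.coeff q.1 f * PowerSeries.coeff q.2 p
        = ∑ q ∈ antidiagonal n, PowerSeries.coeff q.1 g * PowerSeries.coeff q.2 p := by
      refine Finset.sum_congr rfl fun q hq => ?_
      rw [ih q.1 (by have := mem_antidiagonal.1 hq; omega)]
    rw [this, ← h2] at h1
    exact mul_right_cancel₀ (by exact_mod_cast Nat.succ_ne_zero n) h1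

/-- Both sides solve the same linear equation with constant term 1, which replaces exp(X + Y) = exp
X exp Y. -/
theorem schurSeries_add (x y : ℕ → ℂ) :
    schurSeries (fun k => x k + y k) = schurSeries x * schurSeries y := by
  refine eq_of_derivative_eq_mul (derivative_schurSeries _) ?_ ?_
  · have : argSeries (fun k => x k + y k) = argSeries x + argSeries y := by
      ext n
      by_cases h : n = 0 <;> simp [argSeries, h]
    rw [this, map_add, Derivation.leibniz, derivative_schurSeries, derivative_schurSeries]
    simp only [smul_eq_mul]
    ring
  · simp [constantCoeff_schurSeries]

theorem schur_add (n : ℕ) (x y : ℕ → ℂ) :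
    schur n (fun k => x k + y k) = ∑ q ∈ antidiagonal n, schur q.1 x * schur q.2 y := by
  rw [← coeff_schurSeries, schurSeries_add, PowerSeries.coeff_mul]
  rfl

end KPLump
end

noncomputable section
namespace KPLump
open Finset

/-! ### Polynomials in `w` and `conj w` of bounded degree -/

/-- The functions on `ℂ` that are polynomials in `w` and `conj w` of degree less than `z`. -/
def degLT (z : ℤ) : Submodule ℂ (ℂ → ℂ) :=
  Submodule.span ℂ {f | ∃ b c : ℕ, (b : ℤ) + c < z ∧ f = fun w => w ^ b * conj w ^ c}

theorem monomial_mem_degLT {z : ℤ} {b c : ℕ} (h : (b : ℤ) + c < z) :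
    (fun w : ℂ => w ^ b * conj w ^ c) ∈ degLT z :=
  Submodule.subset_span ⟨b, c, h, rfl⟩

theorem pow_mem_degLT {z : ℤ} {b : ℕ} (h : (b : ℤ) < z) : (fun w : ℂ => w ^ b) ∈ degLT z := by
  simpa using monomial_mem_degLT (c := 0) (by simpa using h)

theorem const_mem_degLT {z : ℤ} (h : 0 < z) (c : ℂ) : (fun _ : ℂ => c) ∈ degLT z := by
  have := (degLT z).smul_mem c (pow_mem_degLT (b := 0) (by simpa using h))
  convert this using 1
  ext w
  simp

theorem degLT_mono {z z' : ℤ} (h : z ≤ z') : degLT z ≤ degLT z' := by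
  refine Submodule.span_mono ?_
  rintro f ⟨b, c, hbc, rfl⟩
  exact ⟨b, c, hbc.trans_le h, rfl⟩

/-- Degrees are integers because differences of column sums may be negative. In that case a minor
vanishes identically and is not merely small. -/
theorem eq_zero_of_mem_degLT {z : ℤ} (hz : z ≤ 0) {f : ℂ → ℂ} (hf : f ∈ degLT z) : f = 0 := by
  have : degLT z = ⊥ := by
    rw [degLT, Submodule.span_eq_bot]
    rintro f ⟨b, c, hbc, rfl⟩
    omega
  simpa [this] using hf

/-- Both bounds are strict, so the degree of the product is at most `z + z' - 2`; hence the `- 1`.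
-/
theorem mul_mem_degLT {z z' : ℤ} {f g : ℂ → ℂ} (hf : f ∈ degLT z) (hg : g ∈ degLT z') :
    (fun w => f w * g w) ∈ degLT (z + z' - 1) := by
  unfold degLT at hf hg
  induction hf using Submodule.span_induction with
  | zero =>
    simp only [Pi.zero_apply, zero_mul]
    exact (degLT _).zero_mem
  | add f₁ f₂ _ _ h₁ h₂ =>
    have := (degLT _).add_mem h₁ h₂
    convert this using 1
    ext w
    simp [add_mul]
  | smul a f _ h =>
    have := (degLT _).smul_mem a h
    convert this using 1
    ext w
    simp [mul_assoc]
  | mem f hf =>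
    obtain ⟨b, c, hbc, rfl⟩ := hf
    induction hg using Submodule.span_induction with
    | zero =>
      simp only [Pi.zero_apply, mul_zero]
      exact (degLT _).zero_mem
    | add f₁ f₂ _ _ h₁ h₂ =>
      have := (degLT _).add_mem h₁ h₂
      convert this using 1
      ext w
      simp [mul_add]
    | smul a f _ h =>
      have := (degLT _).smul_mem a h
      convert this using 1
      ext w
      simp
      ring
    | mem g hg =>
      obtain ⟨b', c', hbc', rfl⟩ := hg
      have := monomial_mem_degLT (z := z + z' - 1) (b := b + b') (c := c + c') (by push_cast; omega)
      convert this using 1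
      ext w
      ring

/-- Along real increments w and conj w both have derivative 1, so a monomial loses one degree
although it need not be holomorphic. -/
theorem exists_derivative_degLT {z : ℤ} {f : ℂ → ℂ} (hf : f ∈ degLT z) :
    ∃ f' ∈ degLT (z - 1), ∀ w, HasDerivAt (fun x : ℝ => f (w + x)) (f' w) 0 := by
  unfold degLT at hf
  induction hf using Submodule.span_induction with
  | zero => exact ⟨0, (degLT _).zero_mem, fun w => by simpa using hasDerivAt_const (0 : ℝ) (0 : ℂ)⟩
  | add f₁ f₂ _ _ h₁ h₂ =>
    obtain ⟨g₁, hg₁, h₁⟩ := h₁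
    obtain ⟨g₂, hg₂, h₂⟩ := h₂
    exact ⟨g₁ + g₂, (degLT _).add_mem hg₁ hg₂, fun w => (h₁ w).add (h₂ w)⟩
  | smul a f _ h =>
    obtain ⟨g, hg, h⟩ := h
    exact ⟨a • g, (degLT _).smul_mem a hg, fun w => (h w).const_smul a⟩
  | mem f hf =>
    obtain ⟨b, c, hbc, rfl⟩ := hf
    refine ⟨(b : ℂ) • (fun w => w ^ (b - 1) * conj w ^ c) + (c : ℂ) • fun w => w ^ b * conj w ^ (c - 1),
      (degLT _).add_mem ?_ ?_, fun w => ?_⟩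
    · rcases b with _ | b
      · simp
      · exact (degLT _).smul_mem _ (monomial_mem_degLT (by push_cast at *; omega))
    · rcases c with _ | c
      · simp
      · exact (degLT _).smul_mem _ (monomial_mem_degLT (by push_cast at *; omega))
    · have h1 : HasDerivAt (fun x : ℝ => w + (x : ℂ)) 1 0 := by
        simpa using (Complex.ofRealCLM.hasDerivAt (x := (0 : ℝ))).const_add w
      have h2 : HasDerivAt (fun x : ℝ => conj (w + (x : ℂ))) 1 0 := by
        simpa [Complex.conj_ofReal] using
          (Complex.ofRealCLM.hasDerivAt (x := (0 : ℝ))).const_add (conj w)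
      have := (h1.pow b).mul (h2.pow c)
      refine this.congr_deriv ?_
      simp
      ring

/-- `f` is a polynomial in `w` and `conj w` with `f w = v * w ^ z + (terms of lower degree)`. -/
def HasLead (z : ℤ) (v : ℂ) (f : ℂ → ℂ) : Prop :=
  (z < 0 → v = 0) ∧ (fun w => f w - v * w ^ z.toNat) ∈ degLT z

theorem HasLead.mem_degLT {z : ℤ} {v : ℂ} {f : ℂ → ℂ} (h : HasLead z v f) : f ∈ degLT (z + 1) := by
  have h1 := degLT_mono (by omega : z ≤ z + 1) h.2
  have h2 : (fun w : ℂ => v * w ^ z.toNat) ∈ degLT (z + 1) := by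
    rcases lt_or_ge z 0 with hz | hz
    · simp only [h.1 hz, zero_mul]
      exact (degLT _).zero_mem
    · exact (degLT _).smul_mem v (pow_mem_degLT (b := z.toNat) (by omega))
  have := (degLT _).add_mem h1 h2
  convert this using 1
  ext w
  simp

theorem HasLead.eq_zero {z : ℤ} {v : ℂ} {f : ℂ → ℂ} (h : HasLead z v f) (hz : z < 0) : f = 0 :=
  eq_zero_of_mem_degLT (by omega) h.mem_degLT

theorem hasLead_of_mem {z : ℤ} {f : ℂ → ℂ} (h : f ∈ degLT z) : HasLead z 0 f :=
  ⟨fun _ => rfl, by simpa using h⟩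

theorem hasLead_zero (z : ℤ) : HasLead z 0 (fun _ => 0) := hasLead_of_mem (degLT _).zero_mem

theorem HasLead.mul {z y : ℤ} {v u : ℂ} {f g : ℂ → ℂ} (hf : HasLead z v f) (hg : HasLead y u g) :
    HasLead (z + y) (v * u) (fun w => f w * g w) := by
  rcases lt_or_ge z 0 with hz | hz
  · rw [hf.eq_zero hz, hf.1 hz]
    simpa using hasLead_zero (z + y)
  rcases lt_or_ge y 0 with hy | hy
  · rw [hg.eq_zero hy, hg.1 hy]
    simpa using hasLead_zero (z + y)
  refine ⟨fun h => by omega, ?_⟩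
  have h1 := mul_mem_degLT hf.2 hg.mem_degLT
  have h2 := mul_mem_degLT ((degLT _).smul_mem v (pow_mem_degLT (b := z.toNat) (z := z + 1)
    (by omega))) hg.2
  have := (degLT _).add_mem (degLT_mono (by omega : _ ≤ z + y) h1)
    (degLT_mono (by omega : _ ≤ z + y) h2)
  convert this using 1
  ext w
  simp only [Pi.add_apply, Pi.smul_apply, smul_eq_mul, Int.toNat_add hz hy, pow_add]
  ring

theorem HasLead.add {z : ℤ} {v u : ℂ} {f g : ℂ → ℂ} (hf : HasLead z v f) (hg : HasLead z u g) :
    HasLead z (v + u) (fun w => f w + g w) := by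
  refine ⟨fun h => by rw [hf.1 h, hg.1 h, add_zero], ?_⟩
  convert (degLT _).add_mem hf.2 hg.2 using 1
  ext w
  simp
  ring

theorem HasLead.const_mul {z : ℤ} {v : ℂ} {f : ℂ → ℂ} (hf : HasLead z v f) (a : ℂ) :
    HasLead z (a * v) (fun w => a * f w) := by
  refine ⟨fun h => by rw [hf.1 h, mul_zero], ?_⟩
  convert (degLT _).smul_mem a hf.2 using 1
  ext w
  simp
  ring

theorem hasLead_one : HasLead 0 1 (fun _ => 1) := ⟨fun h => by simp at h, by
  have : (fun w : ℂ => (1 : ℂ) - 1 * w ^ (0 : ℤ).toNat) = 0 := by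
    ext w
    simp
  rw [this]
  exact (degLT 0).zero_mem⟩

theorem HasLead.sum {ι : Type*} {s : Finset ι} {z : ℤ} {v : ι → ℂ} {f : ι → ℂ → ℂ}
    (h : ∀ i ∈ s, HasLead z (v i) (f i)) :
    HasLead z (∑ i ∈ s, v i) (fun w => ∑ i ∈ s, f i w) := by
  classical
  induction s using Finset.induction_on with
  | empty => simpa using hasLead_zero z
  | insert i s hi ih =>
    simp only [Finset.sum_insert hi]
    exact (h i (mem_insert_self i s)).add (ih fun j hj => h j (mem_insert_of_mem hj))

theorem HasLead.prod {ι : Type*} {s : Finset ι} {z : ι → ℤ} {v : ι → ℂ} {f : ι → ℂ → ℂ}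
    (h : ∀ i ∈ s, HasLead (z i) (v i) (f i)) :
    HasLead (∑ i ∈ s, z i) (∏ i ∈ s, v i) (fun w => ∏ i ∈ s, f i w) := by
  classical
  induction s using Finset.induction_on with
  | empty => simpa using hasLead_one
  | insert i s hi ih =>
    simp only [Finset.sum_insert hi, Finset.prod_insert hi]
    exact (h i (mem_insert_self i s)).mul (ih fun j hj => h j (mem_insert_of_mem hj))

/-- The degrees `a i - b j` of the entries are graded, so all Leibniz products have the same degree
and the leading coefficients form the same determinant. -/
theorem HasLead.det {n : ℕ} {a b : Fin n → ℤ} {v : Matrix (Fin n) (Fin n) ℂ}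
    {f : ℂ → Matrix (Fin n) (Fin n) ℂ}
    (h : ∀ i j, HasLead (a i - b j) (v i j) (fun w => f w i j)) :
    HasLead (∑ i, a i - ∑ j, b j) v.det (fun w => (f w).det) := by
  simp only [Matrix.det_apply']
  refine HasLead.sum fun π _ => HasLead.const_mul ?_ _
  have := HasLead.prod (s := univ) fun i _ => h (π i) i
  rwa [Finset.sum_sub_distrib, Equiv.sum_comp π a] at this

theorem HasLead.exists_derivative {z : ℤ} {v : ℂ} {f : ℂ → ℂ} (h : HasLead z v f) :
    ∃ f', HasLead (z - 1) (v * z) f' ∧ ∀ w, HasDerivAt (fun x : ℝ => f (w + x)) (f' w) 0 := by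
  obtain ⟨g, hg, hd⟩ := exists_derivative_degLT h.2
  -- For `z = 0` the truncated exponent is wrong, but the coefficient `v * z` is then zero.
  refine ⟨fun w => g w + v * z * w ^ (z - 1).toNat, ⟨fun hz => ?_, by simpa using hg⟩, fun w => ?_⟩
  · rcases lt_or_ge z 0 with h0 | h0
    · rw [h.1 h0, zero_mul]
    · rw [show z = 0 by omega]
      simp
  · have h1 : HasDerivAt (fun x : ℝ => w + (x : ℂ)) 1 0 := by
      simpa using (Complex.ofRealCLM.hasDerivAt (x := (0 : ℝ))).const_add w
    have := (hd w).add ((h1.pow z.toNat).const_mul v)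
    refine (this.congr_deriv ?_).congr_of_eventuallyEq (Filter.Eventually.of_forall fun x => ?_)
    · rcases lt_or_ge z 0 with h0 | h0
      · simp [h.1 h0]
      · have e1 : ((z.toNat : ℕ) : ℂ) = (z : ℂ) := by
          exact_mod_cast congrArg (Int.cast : ℤ → ℂ) (Int.toNat_of_nonneg h0)
        have e2 : z.toNat - 1 = (z - 1).toNat := by omega
        rw [e1, e2]
        simp
        ring
    · simp

/-- In the recursion for S_{n+1} a summand with x_{k+1}, k ≥ 1, has degree at most 1 + (n - k) ≤ n.
Only x_1 S_n reaches degree n + 1, and x_1 contains no conj w. -/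
theorem hasLead_schur {x : ℂ → ℕ → ℂ} {c : ℂ} (h1 : ∀ w, x w 1 = w + c)
    (h2 : ∀ k, 2 ≤ k → (fun w => x w k) ∈ degLT 2) (n : ℕ) :
    HasLead n (1 / (n ! : ℂ)) (fun w => schur n (x w)) := by
  induction n using Nat.strong_induction_on with
  | _ n ih =>
    rcases n with _ | n
    · simpa [schur_zero] using hasLead_one
    have hn : ((n : ℂ) + 1) ≠ 0 := by exact_mod_cast Nat.succ_ne_zero n
    have hx1 : HasLead 1 1 (fun w => x w 1) := by
      refine ⟨fun h => by omega, ?_⟩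
      simp only [h1]
      simpa using const_mem_degLT one_pos c
    have h0 := (hx1.mul (ih n (by omega))).add (hasLead_of_mem (z := 1 + n)
      (f := fun w => ∑ k ∈ range n, ((k : ℂ) + 2) * x w (k + 2) * schur (n - (k + 1)) (x w)) ?_)
    · have := h0.const_mul (1 / ((n : ℂ) + 1))
      have e : (1 : ℂ) / (((n + 1) ! : ℕ) : ℂ) = 1 / ((n : ℂ) + 1) * (1 * (1 / (n ! : ℂ)) + 0) := by
        rw [Nat.factorial_succ]
        push_cast
        field_simp
        simp
      rw [e, show (((n + 1 : ℕ) : ℤ)) = 1 + n by push_cast; ring]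
      convert this using 2 with w
      have hs := succ_mul_schur n (x w)
      rw [Finset.sum_range_succ'] at hs
      rw [eq_comm, div_mul_eq_mul_div, div_eq_iff hn, mul_comm (schur (n + 1) (x w)), hs]
      simp only [Nat.cast_add, Nat.cast_one, Nat.cast_zero, zero_add, one_mul, tsub_zero]
      rw [add_comm]
      congr 1
      refine Finset.sum_congr rfl fun k _ => ?_
      ring_nf
    · have : (fun w => ∑ k ∈ range n, ((k : ℂ) + 2) * x w (k + 2) * schur (n - (k + 1)) (x w))
          = ∑ k ∈ range n, ((k : ℂ) + 2) • fun w => x w (k + 2) * schur (n - (k + 1)) (x w) := by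
        ext w
        simp [Finset.sum_apply, mul_assoc]
      rw [this]
      refine (degLT _).sum_mem fun k hk => (degLT _).smul_mem _ ?_
      have hk' := mem_range.1 hk
      have := mul_mem_degLT (h2 (k + 2) (by omega)) (ih (n - (k + 1)) (by omega)).mem_degLT
      exact degLT_mono (by omega) this

end KPLump
end

noncomputable section
namespace KPLump
open Finset

/-! ### Splitting off the time dependence -/

/-- The slow time `-12 t`, the leading part of `x₂⁺`. -/
def slow (t : ℝ) : ℝ := -12 * t

/-- The complex coordinate `x₁⁺ = (x - 12 t) + 2 i y`. -/
def pos (x y t : ℝ) : ℂ := ((x - 12 * t : ℝ) : ℂ) + 2 * Complex.I * (y : ℂ)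

/-- The coefficient of the slow time in `x_k⁺`. -/
def slowCoeff (k : ℕ) : ℂ := ((3 : ℂ) ^ k - 3) / (3 * (k ! : ℂ))

/-- The part of `x_k⁺` that is linear in the complex coordinate. -/
def linPart (k : ℕ) (w : ℂ) : ℂ :=
  (w * (1 / 2 + 2 ^ k / 4) + conj w * (1 / 2 - 2 ^ k / 4)) / (k ! : ℂ)

theorem conj_pos (x y t : ℝ) : conj (pos x y t) = ((x - 12 * t : ℝ) : ℂ) - 2 * Complex.I * (y : ℂ) := by
  simp only [pos, map_add, map_mul, Complex.conj_ofReal, Complex.conj_I, Complex.conj_ofNat]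
  ring

/-- In the frame moving with velocity 12 the time drops out of the first variable, since `slowCoeff
1 = 0`; it enters from the second variable on, with coefficient 1 there. -/
theorem xPlus_eq (x y t : ℝ) (k : ℕ) :
    xPlus x y t k = linPart k (pos x y t) + slow t * slowCoeff k := by
  have hk : (k ! : ℂ) ≠ 0 := by exact_mod_cast Nat.factorial_ne_zero k
  unfold xPlus linPart slowCoeff slow
  rw [conj_pos, pos]
  push_cast
  field_simp
  ring

/-- `S_{n - d}`, which is `0` for `d > n`. -/
def schurSub (n d : ℕ) (x : ℕ → ℂ) : ℂ := if d ≤ n then schur (n - d) x else 0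

/-- The addition formula in the form of a matrix product. The convention that S vanishes at negative
index lets the sum run over a fixed range. -/
theorem schurSub_add {n m : ℕ} (hn : n < m) (j : ℕ) (x y : ℕ → ℂ) :
    schurSub n j (fun k => x k + y k) = ∑ d ∈ range m, schurSub n d x * schurSub d j y := by
  unfold schurSub
  split_ifs with h
  · rw [schur_add]
    symm
    rw [← Finset.sum_subset (s₁ := Finset.Icc j n)]
    · refine Finset.sum_bij (fun d _ => (n - d, d - j)) ?_ ?_ ?_ ?_
      · intro d hd
        have := Finset.mem_Icc.1 hd
        simp
        omega
      · intro d hd d' hd' h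
        have h1 := Finset.mem_Icc.1 hd
        have h2 := Finset.mem_Icc.1 hd'
        simp at h
        omega
      · rintro ⟨u, v⟩ huv
        have := mem_antidiagonal.1 huv
        exact ⟨v + j, by simp; omega, by simp; omega⟩
      · intro d hd
        have := Finset.mem_Icc.1 hd
        rw [if_pos this.1, if_pos this.2]
    · intro d hd
      have := Finset.mem_Icc.1 hd
      exact mem_range.2 (by omega)
    · intro d hd hd'
      simp only [Finset.mem_Icc, not_and_or, not_le] at hd'
      rcases hd' with h | h
      · rw [if_neg (by omega : ¬ j ≤ d), mul_zero]
      · rw [if_neg (by omega : ¬ d ≤ n), zero_mul]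
  · refine (Finset.sum_eq_zero fun d _ => ?_).symm
    by_cases hd : d ≤ n
    · rw [if_neg (by omega : ¬ j ≤ d), mul_zero]
    · rw [if_neg hd, zero_mul]

variable {N : ℕ}

/-- The factor of the Schur matrix that depends on time only. -/
def timeMat (a : Fin N → ℕ → ℂ) (τ : ℝ) : Matrix (Fin N) (Fin (2 * N)) ℂ :=
  Matrix.of fun i d => schurSub (2 * i + 1) d fun k => τ * slowCoeff k + a i k

/-- The factor of the Schur matrix that depends on the complex coordinate only. -/
def posMat (N : ℕ) (w : ℂ) : Matrix (Fin (2 * N)) (Fin (2 * N)) ℂ :=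
  Matrix.of fun d j => schurSub d j fun k => linPart k w + (j : ℕ) * sCoeff k

/-- The Schur matrix, of which `(m_{ij})` is the weighted Gram matrix. -/
def schurMat (a : Fin N → ℕ → ℂ) (x y t : ℝ) : Matrix (Fin N) (Fin (2 * N)) ℂ :=
  Matrix.of fun i j => ((2 : ℂ) ^ (j : ℕ))⁻¹ *
    schurSub (2 * i + 1) j fun k => xPlus x y t k + (j : ℕ) * sCoeff k + a i k

/-- The row-dependent parameters `a i` go with the time, the column-dependent shifts by `sCoeff`
with the position, so the two factors are matrices in one variable each. -/
theorem schurMat_eq (a : Fin N → ℕ → ℂ) (x y t : ℝ) :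
    schurMat a x y t = timeMat a (slow t) * posMat N (pos x y t)
      * Matrix.diagonal fun j : Fin (2 * N) => ((2 : ℂ) ^ (j : ℕ))⁻¹ := by
  ext i j
  rw [Matrix.mul_diagonal, Matrix.mul_apply, mul_comm]
  simp only [schurMat, timeMat, posMat, Matrix.of_apply]
  congr 1
  rw [Fin.sum_univ_eq_sum_range (fun d => schurSub (2 * i + 1) d
      (fun k => (slow t : ℂ) * slowCoeff k + a i k) *
      schurSub d j fun k => linPart k (pos x y t) + (j : ℕ) * sCoeff k) (2 * N),
    ← schurSub_add (by have := i.2; omega)]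
  congr 1
  ext k
  rw [xPlus_eq]
  ring

theorem conj_schurSub (n d : ℕ) (x : ℕ → ℂ) :
    conj (schurSub n d x) = schurSub n d fun k => conj (x k) := by
  unfold schurSub
  split_ifs
  · exact conj_schur _ _
  · simp

/-- The weight 4^{-ν} is shared equally as 2^{-ν} between the two factors, and terms beyond the
smaller index vanish by the convention of `schurSub`. -/
theorem mEntry_eq (a : Fin N → ℕ → ℂ) (x y t : ℝ) (i j : Fin N) :
    mEntry (oddIndex N) a x y t i j
      = (schurMat a x y t * (schurMat a x y t).conjTranspose) i j := by
  rw [Matrix.mul_apply]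
  simp only [Matrix.conjTranspose_apply, schurMat, Matrix.of_apply, mEntry, oddIndex]
  rw [Fin.sum_univ_eq_sum_range (fun ν => ((2 : ℂ) ^ ν)⁻¹ *
    (schurSub (2 * i + 1) ν fun k => xPlus x y t k + (ν : ℂ) * sCoeff k + a i k) *
    star (((2 : ℂ) ^ ν)⁻¹ *
      (schurSub (2 * j + 1) ν fun k => xPlus x y t k + (ν : ℂ) * sCoeff k + a j k))) (2 * N)]
  refine Eq.trans ?_ (Finset.sum_subset (s₁ := range (min (2 * (i : ℕ) + 1) (2 * j + 1) + 1)) ?_ ?_)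
  · refine Finset.sum_congr rfl fun ν hν => ?_
    have hν := mem_range.1 hν
    rw [← starRingEnd_apply, map_mul, conj_schurSub]
    unfold schurSub
    rw [if_pos (by omega), if_pos (by omega)]
    have : ((4 : ℂ) ^ ν)⁻¹ = ((2 : ℂ) ^ ν)⁻¹ * ((2 : ℂ) ^ ν)⁻¹ := by
      rw [← mul_inv, ← mul_pow]
      norm_num
    simp only [map_add, map_mul, map_natCast, this, map_inv₀, map_pow, Complex.conj_ofNat]
    ring
  · intro ν hν
    have hν := mem_range.1 hν
    exact mem_range.2 (by omega)
  · intro ν _ hν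
    simp only [mem_range, not_lt] at hν
    rcases le_total i j with h | h
    · have : ¬ ν ≤ 2 * (i : ℕ) + 1 := by
        have : (i : ℕ) ≤ j := h
        omega
      simp [schurSub, this]
    · have : ¬ ν ≤ 2 * (j : ℕ) + 1 := by
        have : (j : ℕ) ≤ i := h
        omega
      simp [schurSub, this]

/-- The coefficient of the minors of `posMat` on the rows `D` in the minors of the Schur matrix. -/
def timeMinor (a : Fin N → ℕ → ℂ) (τ : ℝ) (D : Cols N (2 * N)) : ℂ :=
  ((timeMat a τ).submatrix id D.1).det

/-- The minors of `posMat`. -/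
def posMinor (D J : Cols N (2 * N)) (w : ℂ) : ℂ := ((posMat N w).submatrix D.1 J.1).det

/-- The minors of the Schur matrix up to constants. -/
def schurMinor (a : Fin N → ℕ → ℂ) (τ : ℝ) (J : Cols N (2 * N)) (w : ℂ) : ℂ :=
  ((2 : ℂ) ^ (∑ i, (J.1 i : ℕ)))⁻¹ * ∑ D : Cols N (2 * N), timeMinor a τ D * posMinor D J w

/-- Cauchy–Binet for the product of the time and the position factor; the diagonal factor
contributes the power of 2. -/
theorem det_schurMat_submatrix (a : Fin N → ℕ → ℂ) (x y t : ℝ) (J : Cols N (2 * N)) :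
    ((schurMat a x y t).submatrix id J.1).det = schurMinor a (slow t) J (pos x y t) := by
  have h1 : (schurMat a x y t).submatrix id J.1
      = (timeMat a (slow t) * (posMat N (pos x y t)).submatrix id J.1)
        * Matrix.diagonal fun i : Fin N => ((2 : ℂ) ^ (J.1 i : ℕ))⁻¹ := by
    ext i j
    rw [schurMat_eq, Matrix.submatrix_apply, Matrix.mul_diagonal, Matrix.mul_diagonal]
    rfl
  rw [h1, Matrix.det_mul, det_mul_cauchyBinet, Matrix.det_diagonal, mul_comm]
  simp only [schurMinor, timeMinor, posMinor, Finset.prod_inv_distrib, Finset.prod_pow_eq_pow_sum]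
  rfl

/-- Cauchy–Binet for a matrix times its adjoint. As a sum of squares, σ is bounded below by each
single minor, and the rest of the proof asks which minors dominate. -/
theorem sigma_re_eq (a : Fin N → ℕ → ℂ) (x y t : ℝ) :
    (sigma (oddIndex N) a x y t).re
      = ∑ J : Cols N (2 * N), Complex.normSq (schurMinor a (slow t) J (pos x y t)) := by
  have h : (Matrix.of fun i j => mEntry (oddIndex N) a x y t i j)
      = schurMat a x y t * (schurMat a x y t).conjTranspose := by
    ext i j
    exact mEntry_eq a x y t i j
  rw [sigma, h, det_mul_cauchyBinet, Complex.re_sum]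
  refine Finset.sum_congr rfl fun J _ => ?_
  have : ((schurMat a x y t).conjTranspose.submatrix J.1 id)
      = ((schurMat a x y t).submatrix id J.1).conjTranspose := rfl
  rw [this, Matrix.det_conjTranspose, det_schurMat_submatrix, ← starRingEnd_apply,
    Complex.mul_conj, Complex.ofReal_re]

/-- At `k = 1` the coefficient of conj w cancels. This is why the leading parts of all minors are
pure powers of w. -/
theorem linPart_one (w : ℂ) : linPart 1 w = w := by
  simp only [linPart, Nat.factorial_one]
  push_cast
  ring

theorem linPart_mem_degLT (k : ℕ) (c : ℂ) : (fun w => linPart k w + c) ∈ degLT 2 := by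
  have h1 : (fun w : ℂ => w) ∈ degLT 2 := by simpa using pow_mem_degLT (z := 2) (b := 1) (by simp)
  have h2 : (fun w : ℂ => conj w) ∈ degLT 2 := by
    simpa using monomial_mem_degLT (z := 2) (b := 0) (c := 1) (by simp)
  have := (degLT 2).add_mem ((degLT 2).add_mem
    ((degLT 2).smul_mem ((1 / 2 + 2 ^ k / 4) / (k ! : ℂ)) h1)
    ((degLT 2).smul_mem ((1 / 2 - 2 ^ k / 4) / (k ! : ℂ)) h2)) (const_mem_degLT (by simp) c)
  convert this using 1
  ext w
  simp [linPart]
  ring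

/-- `1 / (n - d)!`, which is `0` for `d > n`. -/
def invFact (n d : ℕ) : ℂ := if d ≤ n then 1 / ((n - d)! : ℂ) else 0

/-- The leading coefficients of the minors of `posMat`. -/
def leadMinor {m : ℕ} (f g : Fin N → Fin m) : ℂ :=
  (Matrix.of fun i j => invFact (f i) (g j)).det

/-- The entry in row `D i` and column `J j` is a Schur polynomial of index `D i - J j`, so the
degrees are graded as `HasLead.det` requires. -/
theorem hasLead_posMinor (D J : Cols N (2 * N)) :
    HasLead (∑ i, ((D.1 i : ℕ) : ℤ) - ∑ i, ((J.1 i : ℕ) : ℤ)) (leadMinor D.1 J.1)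
      (posMinor D J) := by
  refine HasLead.det (a := fun i => ((D.1 i : ℕ) : ℤ)) (b := fun i => ((J.1 i : ℕ) : ℤ))
    fun i j => ?_
  simp only [posMat, Matrix.submatrix_apply, Matrix.of_apply, schurSub, invFact]
  split_ifs with h
  · rw [← Nat.cast_sub h]
    refine hasLead_schur (c := ((J.1 j : ℕ) : ℂ) * sCoeff 1) (fun w => by rw [linPart_one]) (fun k _ => ?_) _
    exact linPart_mem_degLT k _
  · exact hasLead_zero _

end KPLump
end

noncomputable section
namespace KPLump
open Finset

/-! ### Asymptotics in the slow time -/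

/-- `f τ = v * τ ^ z + O(τ ^ (z - 1))` for large real `τ`. -/
def TimeLead (z : ℤ) (v : ℂ) (f : ℝ → ℂ) : Prop :=
  ∃ K : ℝ, ∀ τ : ℝ, 1 ≤ |τ| → ‖f τ - v * (τ : ℂ) ^ z‖ ≤ K * |τ| ^ (z - 1)

theorem TimeLead.const_mul {z : ℤ} {v : ℂ} {f : ℝ → ℂ} (h : TimeLead z v f) (c : ℂ) :
    TimeLead z (c * v) fun τ => c * f τ := by
  obtain ⟨K, h⟩ := h
  refine ⟨‖c‖ * K, fun τ hτ => ?_⟩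
  rw [mul_assoc, ← mul_sub, norm_mul, mul_assoc]
  gcongr
  exact h τ hτ

theorem TimeLead.add {z : ℤ} {v u : ℂ} {f g : ℝ → ℂ} (hf : TimeLead z v f) (hg : TimeLead z u g) :
    TimeLead z (v + u) fun τ => f τ + g τ := by
  obtain ⟨K, hf⟩ := hf
  obtain ⟨L, hg⟩ := hg
  refine ⟨K + L, fun τ hτ => ?_⟩
  rw [add_mul, add_mul, add_sub_add_comm]
  exact (norm_add_le _ _).trans (add_le_add (hf τ hτ) (hg τ hτ))

theorem timeLead_zero (z : ℤ) : TimeLead z 0 fun _ => 0 := ⟨0, fun τ _ => by simp⟩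

theorem timeLead_const (c : ℂ) : TimeLead 0 c fun _ => c := ⟨0, fun τ _ => by simp⟩

theorem TimeLead.bound {z : ℤ} {v : ℂ} {f : ℝ → ℂ} (h : TimeLead z v f) :
    ∃ K : ℝ, 0 ≤ K ∧ ∀ τ : ℝ, 1 ≤ |τ| → ‖f τ‖ ≤ K * |τ| ^ z := by
  obtain ⟨K, h⟩ := h
  refine ⟨‖v‖ + |K|, by positivity, fun τ hτ => ?_⟩
  have h0 : 0 < |τ| := by linarith
  have h1 : |τ| ^ (z - 1) ≤ |τ| ^ z := zpow_le_zpow_right₀ hτ (by omega)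
  have h2 := h τ hτ
  have h3 : ‖v * (τ : ℂ) ^ z‖ = ‖v‖ * |τ| ^ z := by
    rw [norm_mul, norm_zpow, Complex.norm_real, Real.norm_eq_abs]
  calc ‖f τ‖ = ‖v * (τ : ℂ) ^ z + (f τ - v * (τ : ℂ) ^ z)‖ := by congr 1; ring
    _ ≤ ‖v‖ * |τ| ^ z + K * |τ| ^ (z - 1) := (norm_add_le _ _).trans (by rw [h3]; gcongr)
    _ ≤ ‖v‖ * |τ| ^ z + |K| * |τ| ^ z := by
      gcongr
      exact le_abs_self K
    _ = _ := by ring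

theorem TimeLead.of_lt {z y : ℤ} {v : ℂ} {f : ℝ → ℂ} (h : TimeLead z v f) (hy : z < y) :
    TimeLead y 0 f := by
  obtain ⟨K, hK, h⟩ := h.bound
  refine ⟨K, fun τ hτ => ?_⟩
  rw [zero_mul, sub_zero]
  refine (h τ hτ).trans ?_
  exact mul_le_mul_of_nonneg_left (zpow_le_zpow_right₀ hτ (by omega)) hK

theorem TimeLead.mul {z y : ℤ} {v u : ℂ} {f g : ℝ → ℂ} (hf : TimeLead z v f)
    (hg : TimeLead y u g) : TimeLead (z + y) (v * u) fun τ => f τ * g τ := by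
  obtain ⟨L, hL, hg'⟩ := hg.bound
  obtain ⟨K, hf⟩ := hf
  obtain ⟨M, hg⟩ := hg
  refine ⟨K * L + ‖v‖ * M, fun τ hτ => ?_⟩
  have h0 : 0 < |τ| := by linarith
  have hτ0 : (τ : ℂ) ≠ 0 := by
    rw [Ne, Complex.ofReal_eq_zero]
    exact abs_pos.1 h0
  have e : f τ * g τ - v * u * (τ : ℂ) ^ (z + y)
      = (f τ - v * (τ : ℂ) ^ z) * g τ + v * (τ : ℂ) ^ z * (g τ - u * (τ : ℂ) ^ y) := by
    rw [zpow_add₀ hτ0]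
    ring
  have e1 : |τ| ^ (z + y - 1) = |τ| ^ (z - 1) * |τ| ^ y := by
    rw [← zpow_add₀ h0.ne']
    congr 1
    ring
  have e2 : |τ| ^ (z + y - 1) = |τ| ^ z * |τ| ^ (y - 1) := by
    rw [← zpow_add₀ h0.ne']
    congr 1
    ring
  have hK : 0 ≤ K * |τ| ^ (z - 1) := (norm_nonneg _).trans (hf τ hτ)
  rw [e]
  calc _ ≤ (K * |τ| ^ (z - 1)) * (L * |τ| ^ y) + ‖v‖ * |τ| ^ z * (M * |τ| ^ (y - 1)) := by
        refine (norm_add_le _ _).trans ?_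
        rw [norm_mul, norm_mul, norm_mul, norm_zpow, Complex.norm_real, Real.norm_eq_abs]
        gcongr
        · exact hf τ hτ
        · exact hg' τ hτ
        · exact hg τ hτ
    _ = K * L * (|τ| ^ (z - 1) * |τ| ^ y) + ‖v‖ * M * (|τ| ^ z * |τ| ^ (y - 1)) := by ring
    _ = _ := by rw [← e1, ← e2]; ring

theorem TimeLead.sum {ι : Type*} {s : Finset ι} {z : ℤ} {v : ι → ℂ} {f : ι → ℝ → ℂ}
    (h : ∀ i ∈ s, TimeLead z (v i) (f i)) :
    TimeLead z (∑ i ∈ s, v i) (fun w => ∑ i ∈ s, f i w) := by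
  classical
  induction s using Finset.induction_on with
  | empty => simpa using timeLead_zero z
  | insert i s hi ih =>
    simp only [Finset.sum_insert hi]
    exact (h i (mem_insert_self i s)).add (ih fun j hj => h j (mem_insert_of_mem hj))

theorem TimeLead.prod {ι : Type*} {s : Finset ι} {z : ι → ℤ} {v : ι → ℂ} {f : ι → ℝ → ℂ}
    (h : ∀ i ∈ s, TimeLead (z i) (v i) (f i)) :
    TimeLead (∑ i ∈ s, z i) (∏ i ∈ s, v i) (fun w => ∏ i ∈ s, f i w) := by
  classical
  induction s using Finset.induction_on with
  | empty => simpa using timeLead_const 1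
  | insert i s hi ih =>
    simp only [Finset.sum_insert hi, Finset.prod_insert hi]
    exact (h i (mem_insert_self i s)).mul (ih fun j hj => h j (mem_insert_of_mem hj))

theorem TimeLead.det {n : ℕ} {a b : Fin n → ℤ} {v : Matrix (Fin n) (Fin n) ℂ}
    {f : ℝ → Matrix (Fin n) (Fin n) ℂ}
    (h : ∀ i j, TimeLead (a i - b j) (v i j) (fun w => f w i j)) :
    TimeLead (∑ i, a i - ∑ j, b j) v.det (fun w => (f w).det) := by
  simp only [Matrix.det_apply']
  refine TimeLead.sum fun π _ => TimeLead.const_mul ?_ _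
  have := TimeLead.prod (s := univ) fun i _ => h (π i) i
  rwa [Finset.sum_sub_distrib, Equiv.sum_comp π a] at this

theorem timeLead_arg (g c : ℂ) : TimeLead 1 g fun τ => τ * g + c := by
  refine ⟨‖c‖, fun τ _ => ?_⟩
  simp [mul_comm]

theorem slowCoeff_one : slowCoeff 1 = 0 := by simp [slowCoeff]

theorem slowCoeff_two : slowCoeff 2 = 1 := by norm_num [slowCoeff, Nat.factorial]

theorem slowCoeff_three : slowCoeff 3 = 4 / 3 := by norm_num [slowCoeff, Nat.factorial]

/-- The leading coefficients of `S_n` in the slow time. -/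
def schurLead (c : ℂ) (n : ℕ) : ℂ :=
  if Even n then invFact (n / 2) 0 else c * invFact (n / 2) 0 + 4 / 3 * invFact (n / 2) 1

theorem schurLead_even (c : ℂ) (m : ℕ) : schurLead c (2 * m) = 1 / (m ! : ℂ) := by
  simp [schurLead, invFact]

theorem schurLead_odd (c : ℂ) (m : ℕ) :
    schurLead c (2 * m + 1) = c * (1 / (m ! : ℂ)) + 4 / 3 * invFact m 1 := by
  have h1 : ¬ Even (2 * m + 1) := by simp
  have h2 : (2 * m + 1) / 2 = m := by omega
  simp [schurLead, h2, invFact]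

/-- The leading coefficient of the `k`-th term of the recursion for `S_{n + 1}`. -/
def schurLeadTerm (c : ℂ) (n k : ℕ) : ℂ :=
  if k = 0 then (if Even n then c * schurLead c n else 0)
  else if k = 1 then 2 * schurLead c (n - 1)
  else if k = 2 then (if Even n then 4 * schurLead c (n - 2) else 0) else 0

theorem schurLeadTerm_eq_zero (c : ℂ) (n k : ℕ) : schurLeadTerm c n (k + 3) = 0 := by
  simp [schurLeadTerm]

/-- This is the leading order of the recursion for (n + 1) S_{n+1}. Only the first three variables
contribute, the first and the third only when n + 1 is odd. -/
theorem sum_schurLeadTerm (c : ℂ) (n : ℕ) :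
    ∑ k ∈ range (n + 1), schurLeadTerm c n k = schurLead c (n + 1) * ((n : ℂ) + 1) := by
  rcases Nat.even_or_odd' n with ⟨m, rfl | rfl⟩
  · rcases m with _ | m
    · simp [schurLeadTerm, schurLead, invFact]
    · have h3 : 2 * (m + 1) + 1 = 2 * m + 1 + 1 + 1 := by ring
      have h4 : 2 * (m + 1) - 1 = 2 * m + 1 := by omega
      have h5 : 2 * (m + 1) - 2 = 2 * m := by omega
      have hf : (m ! : ℂ) ≠ 0 := by exact_mod_cast Nat.factorial_ne_zero m
      have hm1 : ((m : ℂ) + 1) ≠ 0 := by exact_mod_cast Nat.succ_ne_zero m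
      have hs : ∑ k ∈ range (2 * (m + 1) + 1), schurLeadTerm c (2 * (m + 1)) k
          = 4 * schurLead c (2 * m) + 2 * schurLead c (2 * m + 1) + c * schurLead c (2 * (m + 1)) := by
        rw [h3, Finset.sum_range_succ', Finset.sum_range_succ', Finset.sum_range_succ',
          Finset.sum_eq_zero (fun k _ => schurLeadTerm_eq_zero c _ k)]
        simp [schurLeadTerm, h4, h5]
      rw [hs, schurLead_odd, schurLead_odd, schurLead_even, schurLead_even]
      rcases m with _ | m
      · simp [invFact]
        ring
      · have hf : (m ! : ℂ) ≠ 0 := by exact_mod_cast Nat.factorial_ne_zero m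
        have hm2 : ((m : ℂ) + 1) ≠ 0 := by exact_mod_cast Nat.succ_ne_zero m
        simp only [invFact, Nat.factorial_succ]
        push_cast at hm1 ⊢
        simp [Nat.factorial_succ]
        field_simp
        ring
  · have h3 : 2 * m + 1 + 1 = 2 * (m + 1) := by ring
    have hm : ((m : ℂ) + 1) ≠ 0 := by exact_mod_cast Nat.succ_ne_zero m
    have hf : (m ! : ℂ) ≠ 0 := by exact_mod_cast Nat.factorial_ne_zero m
    have hs : ∑ k ∈ range (2 * m + 1 + 1), schurLeadTerm c (2 * m + 1) k
        = 2 * schurLead c (2 * m) := by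
      rw [Finset.sum_range_succ', Finset.sum_range_succ', Finset.sum_eq_zero]
      · simp [schurLeadTerm]
      · intro k _
        simp [schurLeadTerm]
    rw [hs, h3, schurLead_even, schurLead_even, Nat.factorial_succ]
    push_cast
    field_simp
    ring

/-- The generating function is exp(c ε + τ ε² + (4/3) τ ε³ + …) up to bounded terms and higher
powers of ε. Its top power of τ at ε^(2m) is τ^m / m!; at ε^(2m+1) one factor ε² is traded either
for c ε with one τ less needed, or for (4/3) τ ε³. -/
theorem timeLead_schur (a : ℕ → ℂ) (n : ℕ) :
    TimeLead (n / 2 : ℕ) (schurLead (a 1) n) fun τ => schur n fun k => τ * slowCoeff k + a k := by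
  obtain ⟨X, hX⟩ : ∃ X : ℕ → ℝ → ℂ, X = fun k (τ : ℝ) => (τ : ℂ) * slowCoeff k + a k := ⟨_, rfl⟩
  obtain ⟨S, hS⟩ : ∃ S : ℕ → ℝ → ℂ, S = fun n (τ : ℝ) => schur n fun k => (τ : ℂ) * slowCoeff k + a k :=
    ⟨_, rfl⟩
  have hrec : ∀ n, S (n + 1) = fun τ => 1 / ((n : ℂ) + 1) * ∑ k ∈ range (n + 1),
      ((k : ℂ) + 1) * (X (k + 1) τ * S (n - k) τ) := by
    intro n
    have hn : ((n : ℂ) + 1) ≠ 0 := by exact_mod_cast Nat.succ_ne_zero n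
    ext τ
    simp only [hS, hX, ← mul_assoc]
    rw [one_div_mul_eq_div, eq_div_iff hn, mul_comm]
    exact succ_mul_schur n _
  have hX1 : TimeLead 0 (a 1) (X 1) := by
    simpa [hX, slowCoeff_one] using timeLead_const (a 1)
  have hXk : ∀ k, TimeLead 1 (slowCoeff k) (X k) := fun k => by
    rw [hX]
    exact timeLead_arg _ _
  have hS0 : S 0 = fun _ => 1 := by
    ext τ
    simp [hS, schur_zero]
  change TimeLead (n / 2 : ℕ) (schurLead (a 1) n) (fun τ => _)
  suffices TimeLead (n / 2 : ℕ) (schurLead (a 1) n) (S n) by rw [hS] at this; exact this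
  clear hS hX
  induction n using Nat.strong_induction_on with
  | _ n ih =>
    rcases n with _ | n
    · have : schurLead (a 1) 0 = 1 := by simp [schurLead, invFact]
      rw [hS0, this]
      exact timeLead_const 1
    have hn : ((n : ℂ) + 1) ≠ 0 := by exact_mod_cast Nat.succ_ne_zero n
    have hterm : ∀ k ∈ range (n + 1), TimeLead ((n + 1) / 2 : ℕ) (schurLeadTerm (a 1) n k)
        fun τ => ((k : ℂ) + 1) * (X (k + 1) τ * S (n - k) τ) := by
      intro k hk
      have hk := mem_range.1 hk
      have hSk := ih (n - k) (by omega)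
      have hg := ((hXk (k + 1)).mul hSk).const_mul ((k : ℂ) + 1)
      have hodd : ¬ Even n → n / 2 < (n + 1) / 2 := fun he => by
        obtain ⟨m, rfl⟩ := Nat.not_even_iff_odd.1 he
        omega
      have heven : Even n → n / 2 = (n + 1) / 2 := by
        rintro ⟨m, rfl⟩
        omega
      rcases k with _ | _ | _ | k
      -- The first variable is constant in τ, so the sharper exponent 0 from `hX1` is needed instead
      -- of 1.
      · have h := (hX1.mul hSk).const_mul (((0 : ℕ) : ℂ) + 1)
        by_cases he : Even n
        · convert h using 1
          · have := heven he
            simp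
            omega
          · simp [schurLeadTerm, he]
        · rw [schurLeadTerm, if_pos rfl, if_neg he]
          refine h.of_lt ?_
          have := hodd he
          simp
          omega
      · convert hg using 1
        · omega
        · simp [schurLeadTerm, slowCoeff_two]
          norm_num
      · by_cases he : Even n
        · convert hg using 1
          · have := heven he
            omega
          · simp [schurLeadTerm, he, slowCoeff_three]
            norm_num
            ring
        · have : schurLeadTerm (a 1) n (0 + 1 + 1) = 0 := by simp [schurLeadTerm, he]
          rw [this]
          refine hg.of_lt ?_
          have := hodd he
          omega
      · rw [schurLeadTerm_eq_zero]
        exact hg.of_lt (by omega)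
    have hsum := (TimeLead.sum hterm).const_mul (1 / ((n : ℂ) + 1))
    rw [sum_schurLeadTerm] at hsum
    rw [hrec]
    convert hsum using 1
    field_simp

end KPLump
end

noncomputable section
namespace KPLump
open Finset

variable {N : ℕ}

/-! ### Leading coefficients of the time minors -/

/-- The leading coefficients of the entries of `timeMat`. -/
def timeLeadMat (a : Fin N → ℕ → ℂ) : Matrix (Fin N) (Fin (2 * N)) ℂ :=
  Matrix.of fun i d => if Even (d : ℕ)
    then a i 1 * invFact i (d / 2) + 4 / 3 * invFact i (d / 2 + 1) else invFact i (d / 2)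

/-- The leading coefficients of the time minors. -/
def leadTime (a : Fin N → ℕ → ℂ) (f : Fin N → Fin (2 * N)) : ℂ :=
  ((timeLeadMat a).submatrix id f).det

theorem invFact_of_lt {n d : ℕ} (h : n < d) : invFact n d = 0 := if_neg (by omega)

/-- The Schur index 2i + 1 - d has half i - ⌊d/2⌋ for either parity of d. It is odd for even d, so
the parameters `a i 1` and the constant 4/3 appear exactly in the even columns. -/
theorem timeLead_timeMat (a : Fin N → ℕ → ℂ) (i : Fin N) (d : Fin (2 * N)) :
    TimeLead ((i : ℕ) - ((d : ℕ) / 2 : ℕ) : ℤ) (timeLeadMat a i d) fun τ => timeMat a τ i d := by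
  simp only [timeMat, timeLeadMat, Matrix.of_apply, schurSub]
  by_cases h : (d : ℕ) ≤ 2 * i + 1
  · simp only [if_pos h]
    have h1 := timeLead_schur (a i) (2 * i + 1 - d)
    have h2 : ((2 * (i : ℕ) + 1 - d) / 2 : ℕ) = (i : ℕ) - (d : ℕ) / 2 := by omega
    have h3 : (((2 * (i : ℕ) + 1 - d) / 2 : ℕ) : ℤ) = ((i : ℕ) - ((d : ℕ) / 2 : ℕ) : ℤ) := by omega
    rw [h3] at h1
    convert h1 using 1
    have he : Even (2 * (i : ℕ) + 1 - d) ↔ ¬ Even (d : ℕ) := by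
      rw [Nat.even_iff, Nat.even_iff]
      omega
    have e0 : invFact ((i : ℕ) - (d : ℕ) / 2) 0 = invFact i ((d : ℕ) / 2) := by
      rw [invFact, invFact, if_pos (by omega), if_pos (by omega), Nat.sub_zero]
    have e1 : invFact ((i : ℕ) - (d : ℕ) / 2) 1 = invFact i ((d : ℕ) / 2 + 1) := by
      rw [invFact, invFact]
      by_cases hd : (d : ℕ) / 2 + 1 ≤ i
      · rw [if_pos (by omega), if_pos hd, Nat.sub_sub]
      · rw [if_neg (by omega), if_neg hd]
    simp only [schurLead, h2, he, e0, e1]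
    split_ifs <;> rfl
  · simp only [if_neg h]
    rw [invFact_of_lt (by omega), invFact_of_lt (by omega)]
    simpa using timeLead_zero _

theorem timeLead_timeMinor (a : Fin N → ℕ → ℂ) (D : Cols N (2 * N)) :
    TimeLead (∑ i : Fin N, ((i : ℕ) : ℤ) - ∑ j, (((D.1 j : ℕ) / 2 : ℕ) : ℤ)) (leadTime a D.1)
      fun τ => timeMinor a τ D :=
  TimeLead.det (a := fun i => ((i : ℕ) : ℤ)) (b := fun j => (((D.1 j : ℕ) / 2 : ℕ) : ℤ))
    fun i j => timeLead_timeMat a i (D.1 j)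

/-- In each Leibniz product some entry has column index beyond its row index, by comparing sums.
Exact vanishing is needed later, as decay in τ alone would not control terms in an unbounded w. -/
theorem timeMinor_eq_zero (a : Fin N → ℕ → ℂ) (D : Cols N (2 * N)) (τ : ℝ)
    (h : ∑ i : Fin N, ((i : ℕ) : ℤ) < ∑ j, (((D.1 j : ℕ) / 2 : ℕ) : ℤ)) : timeMinor a τ D = 0 := by
  rw [timeMinor, Matrix.det_apply]
  refine Finset.sum_eq_zero fun π _ => ?_
  obtain ⟨j, -, hj⟩ : ∃ j ∈ (univ : Finset (Fin N)),
      ((π j : ℕ) : ℤ) < (((D.1 j : ℕ) / 2 : ℕ) : ℤ) := by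
    refine Finset.exists_lt_of_sum_lt ?_
    rwa [Equiv.sum_comp π (fun i : Fin N => ((i : ℕ) : ℤ))]
  rw [Finset.prod_eq_zero (mem_univ j), smul_zero]
  have : ¬ (D.1 j : ℕ) ≤ 2 * (π j : ℕ) + 1 := by omega
  simp [timeMat, schurSub, this]

theorem matF_apply (i j : Fin N) : matF N i j = invFact i j := by
  simp only [matF, Matrix.of_apply, invFact, Fin.le_def]

theorem det_matF (N : ℕ) : (matF N).det = 1 := by
  rw [Matrix.det_of_isLowerTriangular]
  · refine Finset.prod_eq_one fun i _ => ?_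
    simp [matF]
  · intro i j hij
    have : i < j := hij
    simp [matF, not_le.2 this]

/-- `G + 4/3` on the subdiagonal. -/
def shiftedG (a : Fin N → ℕ → ℂ) : Matrix (Fin N) (Fin N) ℂ :=
  matG a + Matrix.of fun i j : Fin N => if (i : ℕ) = j + 1 then 4 / 3 else 0

/-- `F⁻¹ * timeLeadMat`. -/
def reducedLeadMat (a : Fin N → ℕ → ℂ) : Matrix (Fin N) (Fin (2 * N)) ℂ :=
  Matrix.of fun i d => if Even (d : ℕ) then shiftedG a i ⟨d / 2, by omega⟩
    else if (i : ℕ) = d / 2 then 1 else 0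

theorem matF_mul_matG (a : Fin N → ℕ → ℂ) : matF N * matG a = matD a * matF N := by
  rw [matG, Matrix.mul_assoc, Matrix.mul_nonsing_inv_cancel_left]
  rw [det_matF]
  exact isUnit_one

/-- The odd columns are columns of F. In the even columns the diagonal part is D F = F G, and the
part with 4/3 is the next column of F, that is, F times the subdiagonal shift. -/
theorem timeLeadMat_eq (a : Fin N → ℕ → ℂ) : timeLeadMat a = matF N * reducedLeadMat a := by
  ext i d
  have hl : (d : ℕ) / 2 < N := by omega
  rw [Matrix.mul_apply]
  simp only [timeLeadMat, reducedLeadMat, Matrix.of_apply]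
  by_cases h : Even (d : ℕ)
  · simp only [if_pos h, shiftedG, Matrix.add_apply, Matrix.of_apply, mul_add,
      Finset.sum_add_distrib]
    rw [← Matrix.mul_apply, matF_mul_matG, matD, Matrix.diagonal_mul, matF_apply]
    congr 1
    by_cases hd : (d : ℕ) / 2 + 1 < N
    · rw [Finset.sum_eq_single ⟨(d : ℕ) / 2 + 1, hd⟩]
      · simp [matF_apply]
        ring
      · intro b _ hb
        rw [if_neg, mul_zero]
        intro h'
        exact hb (Fin.ext h')
      · simp
    · rw [invFact_of_lt (by omega), Finset.sum_eq_zero]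
      · simp
      · intro b _
        rw [if_neg (by omega), mul_zero]
  · simp only [if_neg h]
    rw [Finset.sum_eq_single ⟨(d : ℕ) / 2, hl⟩]
    · simp [matF_apply]
    · intro b _ hb
      rw [if_neg, mul_zero]
      intro h'
      exact hb (Fin.ext h')
    · simp

theorem leadTime_eq (a : Fin N → ℕ → ℂ) (f : Fin N → Fin (2 * N)) :
    leadTime a f = ((reducedLeadMat a).submatrix id f).det := by
  have : (timeLeadMat a).submatrix id f = matF N * (reducedLeadMat a).submatrix id f := by
    rw [timeLeadMat_eq]
    rfl
  rw [leadTime, this, Matrix.det_mul, det_matF, one_mul]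

/-- The columns `1, 3, …, 2(N - s) - 1` followed by `2(s - 1), …, 2, 0`. -/
def vertexCols (N s : ℕ) (k : Fin N) : Fin (2 * N) :=
  if (k : ℕ) + s < N then ⟨2 * k + 1, by omega⟩ else ⟨2 * (N - 1 - k), by omega⟩

/-- Reversal followed by the cyclic rotation fixes 0 and reverses the other points. -/
theorem sign_revPerm_succ (n : ℕ) : Equiv.Perm.sign (Fin.revPerm : Equiv.Perm (Fin (n + 1)))
    = (-1) ^ n * Equiv.Perm.sign (Fin.revPerm : Equiv.Perm (Fin n)) := by
  have h : finRotate (n + 1) * (Fin.revPerm : Equiv.Perm (Fin (n + 1)))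
      = Equiv.Perm.decomposeFin.symm (0, (Fin.revPerm : Equiv.Perm (Fin n))) := by
    ext i
    refine Fin.cases ?_ (fun i => ?_) i
    · simp
    · have h1 : Fin.rev i.succ = (Fin.rev i).castSucc := by
        ext
        simp [Fin.val_rev]
      simp [h1]
  have h2 := congrArg Equiv.Perm.sign h
  rw [map_mul, sign_finRotate, Equiv.Perm.decomposeFin.symm_sign, if_pos rfl, one_mul] at h2
  rw [← h2, ← mul_assoc, Nat.add_sub_cancel, ← mul_pow]
  simp

/-- The minor of `shiftedG a` on the last `s` rows and first `s` columns. -/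
def shiftedMinor (a : Fin N → ℕ → ℂ) (s : ℕ) (hs : s ≤ N) : ℂ :=
  ((shiftedG a).submatrix (fun i : Fin s => (⟨N - s + (i : ℕ), by omega⟩ : Fin N))
    (Fin.castLE hs)).det

/-- After removal of F the odd columns are the first N - s unit vectors. They split off, and the
remaining block consists of the last s rows and first s columns of `shiftedG` in reversed column
order. -/
theorem leadTime_vertexCols (a : Fin N → ℕ → ℂ) (s : ℕ) (hs : s ≤ N) :
    leadTime a (vertexCols N s)
      = (Equiv.Perm.sign (Fin.revPerm : Equiv.Perm (Fin s)) : ℤ) * shiftedMinor a s hs := by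
  rw [leadTime_eq, Matrix.twoBlockTriangular_det _ (fun k : Fin N => (k : ℕ) + s < N)]
  · have h1 : (((reducedLeadMat a).submatrix id (vertexCols N s)).toSquareBlockProp
        fun k : Fin N => (k : ℕ) + s < N) = 1 := by
      ext ⟨i, hi⟩ ⟨j, hj⟩
      simp only [Matrix.toSquareBlockProp_def, Matrix.submatrix_apply, Matrix.of_apply, id,
        reducedLeadMat, vertexCols, if_pos hj]
      have h2 : (2 * (j : ℕ) + 1) / 2 = j := by omega
      simp [h2, Matrix.one_apply, Fin.ext_iff]
    rw [h1, Matrix.det_one, one_mul]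
    let e : Fin s ≃ {k : Fin N // ¬ (k : ℕ) + s < N} :=
      { toFun := fun i => ⟨⟨N - s + i, by omega⟩, by simp; omega⟩
        invFun := fun k => ⟨k.1 - (N - s), by have := k.2; omega⟩
        left_inv := fun i => by ext; simp
        right_inv := fun k => by
          have := k.2
          ext
          simp
          omega }
    rw [← Matrix.det_submatrix_equiv_self e, shiftedMinor, ← Matrix.det_permute']
    congr 1
    ext i j
    have h2 : ¬ (N - s + (j : ℕ) + s < N) := by omega
    have h3 : (2 * (N - 1 - (N - s + (j : ℕ)))) / 2 = s - (j + 1) := by omega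
    simp [Matrix.toSquareBlockProp_def, reducedLeadMat, vertexCols, e, h2]
    congr 1
    ext
    simp [Fin.val_rev]
    omega
  · intro i hi j hj
    simp only [Matrix.submatrix_apply, id, reducedLeadMat, vertexCols, Matrix.of_apply, if_pos hj]
    have h2 : (2 * (j : ℕ) + 1) / 2 = j := by omega
    have h3 : (i : ℕ) ≠ j := fun h => hi (by rw [h]; exact hj)
    simp [h2, h3]

end KPLump
end

noncomputable section
namespace KPLump
open Finset

/-! ### Pivots as ratios of time coefficients; position coefficients as Vandermonde determinants. -/

variable {N : ℕ}

/-- For 2s < N the lower left s × s block does not meet the subdiagonal. -/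
theorem shiftedMinor_eq_minorM (a : Fin N → ℕ → ℂ) {s : ℕ} (hs : s ≤ N) (h : 2 * s < N) :
    shiftedMinor a s hs = minorM a s hs := by
  rw [shiftedMinor, minorM]
  congr 1
  ext i j
  have : ¬ (N - s + (i : ℕ) = j + 1) := by omega
  simp [shiftedG, this]

theorem det_add_corner {n : ℕ} (A : Matrix (Fin (n + 1)) (Fin (n + 1)) ℂ) (c : ℂ) :
    (A + Matrix.of fun i j => if i = 0 ∧ j = Fin.last n then c else 0).det
      = A.det + c * (-1) ^ n * (A.submatrix Fin.succ Fin.castSucc).det := by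
  rw [Matrix.det_succ_row_zero, Matrix.det_succ_row_zero A]
  have h : ∀ j : Fin (n + 1),
      (A + Matrix.of fun i j => if i = 0 ∧ j = Fin.last n then c else 0).submatrix Fin.succ
        j.succAbove = A.submatrix Fin.succ j.succAbove := by
    intro j
    ext i k
    simp
  simp only [h, Matrix.add_apply, Matrix.of_apply, mul_add, add_mul, Finset.sum_add_distrib]
  congr 1
  rw [Finset.sum_eq_single (Fin.last n)]
  · simp only [Fin.succAbove_last, and_self, if_true, Fin.val_last]
    ring
  · intro j _ hj
    simp [hj]
  · simp

/-- At 2s = N the block meets the subdiagonal in its upper right corner only. Expansion adds the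
cofactor there, which is the preceding minor; this is the source of the exceptional 4/3 for even N.
-/
theorem shiftedMinor_half (a : Fin N → ℕ → ℂ) {r : ℕ} (hr : r + 1 ≤ N) (h : 2 * (r + 1) = N) :
    shiftedMinor a (r + 1) hr
      = minorM a (r + 1) hr + 4 / 3 * (-1) ^ r * minorM a r (by omega) := by
  have e : minorM a r (by omega)
      = (((matG a).submatrix (fun i : Fin (r + 1) => (⟨N - (r + 1) + (i : ℕ), by omega⟩ : Fin N))
        (Fin.castLE hr)).submatrix Fin.succ Fin.castSucc).det := by
    rw [minorM]
    congr 1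
    ext i j
    simp only [Matrix.submatrix_apply]
    congr 1
    ext
    simp
    omega
  rw [e, minorM, ← det_add_corner, shiftedMinor]
  congr 1
  ext i j
  have : (N - (r + 1) + (i : ℕ) = j + 1) ↔ i = 0 ∧ j = Fin.last r := by
    rw [Fin.ext_iff, Fin.ext_iff, Fin.val_zero, Fin.val_last]
    omega
  simp [shiftedG, this]

theorem Nondegenerate.minorM_ne_zero {a : Fin N → ℕ → ℂ} (ha : Nondegenerate a) {r : ℕ}
    (hr : r ≤ N) (h : r + 1 ≤ N / 2) : minorM a r hr ≠ 0 := by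
  rcases Nat.eq_zero_or_pos r with rfl | h0
  · simp [minorM]
  · exact ha.1 r hr h0 h

/-- The reversal sign changes by (-1)^r from one vertex to the next, which is the sign in `beta`; it
also squares away the sign of the corner cofactor. -/
theorem leadTime_vertexCols_succ {a : Fin N → ℕ → ℂ} (ha : Nondegenerate a) (r : Fin (N / 2)) :
    leadTime a (vertexCols N (r + 1)) = ringBeta a r * leadTime a (vertexCols N r) := by
  have hr := r.2
  have hM := ha.minorM_ne_zero (r := r) (by omega) (by omega)
  rw [leadTime_vertexCols a _ (by omega : (r : ℕ) + 1 ≤ N),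
    leadTime_vertexCols a _ (by omega : (r : ℕ) ≤ N), sign_revPerm_succ,
    shiftedMinor_eq_minorM a _ (by omega : 2 * (r : ℕ) < N)]
  have hsq : ((-1 : ℂ) ^ (r : ℕ)) * (-1) ^ (r : ℕ) = 1 := by
    rw [← mul_pow]
    simp
  have key : (-1) ^ (r : ℕ) * shiftedMinor a ((r : ℕ) + 1) (by omega)
      = ringBeta a r * minorM a r (by omega) := by
    by_cases h : 2 * ((r : ℕ) + 1) < N
    · have h' : ¬ (Even N ∧ (r : ℕ) + 1 = N / 2) := by
        rintro ⟨⟨k, rfl⟩, h2⟩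
        omega
      rw [shiftedMinor_eq_minorM a _ h, ringBeta, if_neg h', beta]
      field_simp
    · have h' : 2 * ((r : ℕ) + 1) = N := by omega
      rw [shiftedMinor_half a _ h', ringBeta, if_pos ⟨⟨(r : ℕ) + 1, by omega⟩, by omega⟩, beta]
      field_simp
      linear_combination (4 : ℂ) * minorM a (r : ℕ) (by omega) * hsq
  push_cast
  linear_combination ((Equiv.Perm.sign (Fin.revPerm : Equiv.Perm (Fin r)) : ℤ) : ℂ) * key

theorem Nondegenerate.ringBeta_ne_zero {a : Fin N → ℕ → ℂ} (ha : Nondegenerate a)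
    (r : Fin (N / 2)) : ringBeta a r ≠ 0 := by
  have hr := r.2
  by_cases h : (r : ℕ) + 1 = N / 2
  · have := ha.2 r h
    rw [ringBeta]
    split_ifs with he
    · rw [if_pos he.1] at this
      intro h0
      exact this (eq_neg_of_add_eq_zero_left h0)
    · rw [if_neg fun h' => he ⟨h', h⟩] at this
      exact this
  · rw [ringBeta, if_neg fun h' => h h'.2, beta]
    exact mul_ne_zero (pow_ne_zero _ (by norm_num)) (div_ne_zero
      (ha.minorM_ne_zero _ (by omega)) (ha.minorM_ne_zero _ (by omega)))

theorem leadTime_vertexCols_ne_zero {a : Fin N → ℕ → ℂ} (ha : Nondegenerate a) {s : ℕ}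
    (hs : s ≤ N / 2) : leadTime a (vertexCols N s) ≠ 0 := by
  induction s with
  | zero =>
    rw [leadTime_vertexCols a _ (Nat.zero_le N)]
    simp [shiftedMinor]
  | succ s ih =>
    have := leadTime_vertexCols_succ ha ⟨s, by omega⟩
    simp only at this
    rw [this]
    exact mul_ne_zero (ha.ringBeta_ne_zero _) (ih (by omega))

/-! ### Leading coefficients of the position minors -/

/-- The first `N` columns. -/
def firstCols (N : ℕ) : Cols N (2 * N) :=
  ⟨Fin.castLE (by omega), fun _ _ h => h⟩

/-- 1 / (f - j)! is 1 / f! times a falling factorial, a monic polynomial of degree j in f, so column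
operations lead to a Vandermonde matrix. -/
theorem leadMinor_firstCols (f : Fin N → Fin (2 * N)) :
    leadMinor f (firstCols N).1
      = (Matrix.vandermonde fun i => ((f i : ℕ) : ℂ)).det / ∏ i, ((f i : ℕ)! : ℂ) := by
  rw [Matrix.det_eval_matrixOfPolynomials_eq_det_vandermonde (fun i => ((f i : ℕ) : ℂ))
    (fun j => descPochhammer ℂ j) (fun j => by rw [descPochhammer_natDegree])
    (fun j => monic_descPochhammer ℂ j), div_eq_inv_mul, ← Finset.prod_inv_distrib,
    ← Matrix.det_mul_column]
  rw [leadMinor]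
  congr 1
  ext i j
  have hf : (((f i : ℕ))! : ℂ) ≠ 0 := by exact_mod_cast Nat.factorial_ne_zero _
  change invFact (f i) (j : ℕ) = (((f i : ℕ)! : ℂ))⁻¹ * (descPochhammer ℂ j).eval ((f i : ℕ) : ℂ)
  simp only [descPochhammer_eval_eq_descFactorial, invFact]
  by_cases h : (j : ℕ) ≤ f i
  · rw [if_pos h]
    have h1 : ((((f i : ℕ) - (j : ℕ))! : ℕ) : ℂ) ≠ 0 := by
      exact_mod_cast Nat.factorial_ne_zero _
    have h2 := Nat.factorial_mul_descFactorial h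
    rw [← h2] at hf ⊢
    push_cast at hf ⊢
    have h3 := right_ne_zero_of_mul hf
    field_simp
  · rw [if_neg h, Nat.descFactorial_eq_zero_iff_lt.2 (by omega)]
    simp

theorem leadMinor_firstCols_ne_zero {f : Fin N → Fin (2 * N)} (hf : Function.Injective f) :
    leadMinor f (firstCols N).1 ≠ 0 := by
  rw [leadMinor_firstCols]
  refine div_ne_zero (Matrix.det_vandermonde_ne_zero_iff.2 fun i j h => ?_)
    (Finset.prod_ne_zero_iff.2 fun i _ => by exact_mod_cast Nat.factorial_ne_zero _)
  have : (f i : ℕ) = f j := by exact_mod_cast h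
  exact hf (Fin.ext this)

theorem det_vandermonde_cons {n : ℕ} (x : ℂ) (w : Fin n → ℂ) :
    (Matrix.vandermonde (Fin.cons x w : Fin (n + 1) → ℂ)).det
      = (∏ j, (w j - x)) * (Matrix.vandermonde w).det := by
  rw [Matrix.det_vandermonde, Matrix.det_vandermonde, Fin.prod_univ_succ, Fin.prod_Ioi_zero]
  simp [Fin.prod_Ioi_succ]

/-- Changing one node of a Vandermonde determinant. -/
theorem det_vandermonde_change (v v' : Fin N → ℂ) (k : Fin N) (h : ∀ i, i ≠ k → v i = v' i) :
    (Matrix.vandermonde v).det * ∏ i ∈ univ.erase k, (v' i - v' k)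
      = (Matrix.vandermonde v').det * ∏ i ∈ univ.erase k, (v i - v k) := by
  obtain ⟨n, rfl⟩ : ∃ n, N = n + 1 := ⟨N - 1, by have := k.2; omega⟩
  -- The swap brings the node `k` to the front, where its differences split off as one factor and
  -- the other nodes remain unchanged. The statement is cross-multiplied so that no factor has to be
  -- nonzero.
  set π : Equiv.Perm (Fin (n + 1)) := Equiv.swap 0 k with hπ
  have key : ∀ u : Fin (n + 1) → ℂ, (Matrix.vandermonde u).det
      = (Equiv.Perm.sign π : ℤ) * ((∏ i ∈ univ.erase k, (u i - u k))
        * (Matrix.vandermonde fun j : Fin n => u (π j.succ)).det) := by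
    intro u
    have h1 : (Matrix.vandermonde u).det
        = (Equiv.Perm.sign π : ℤ) * (Matrix.vandermonde (u ∘ π)).det := by
      have : Matrix.vandermonde (u ∘ π) = (Matrix.vandermonde u).submatrix π id := rfl
      rw [this, Matrix.det_permute, ← mul_assoc]
      rcases Int.units_eq_one_or (Equiv.Perm.sign π) with h | h <;> simp [h]
    have h2 : u ∘ π = Fin.cons (u k) fun j : Fin n => u (π j.succ) := by
      ext i
      refine Fin.cases ?_ (fun j => ?_) i
      · simp [hπ]
      · simp
    rw [h1, h2, det_vandermonde_cons]
    congr 2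
    refine Finset.prod_bij (fun j _ => π j.succ) ?_ ?_ ?_ ?_
    · intro j _
      refine mem_erase.2 ⟨fun h => ?_, mem_univ _⟩
      have h0 : π 0 = k := by simp [hπ]
      exact Fin.succ_ne_zero j (π.injective (h.trans h0.symm))
    · intro i _ j _ h
      exact Fin.succ_injective _ (π.injective h)
    · intro i hi
      have hi := (mem_erase.1 hi).1
      have h0 : π.symm i ≠ 0 := fun h => hi (by
        rw [Equiv.symm_apply_eq] at h
        simpa [hπ] using h)
      obtain ⟨j, hj⟩ := Fin.exists_succ_eq.2 h0
      exact ⟨j, mem_univ _, by rw [hj, Equiv.apply_symm_apply]⟩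
    · intro j _
      rfl
  have hw : (fun j : Fin n => v (π j.succ)) = fun j : Fin n => v' (π j.succ) := by
    ext j
    refine h _ fun hk => ?_
    have h0 : π 0 = k := by simp [hπ]
    exact Fin.succ_ne_zero j (π.injective (hk.trans h0.symm))
  rw [key v, key v', hw]
  ring

theorem prod_odd_eq (q : ℕ) : ∏ i ∈ range q, (2 * (i : ℂ) + 1) = ((2 * q - 1)‼ : ℂ) := by
  rcases q with _ | q
  · simp
  · have : 2 * (q + 1) - 1 = 2 * q + 1 := by omega
    rw [this, Nat.doubleFactorial_eq_prod_odd, Finset.prod_range_succ']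
    push_cast
    simp

theorem prod_even_eq (q : ℕ) : ∏ i ∈ range q, (2 * (i : ℂ) + 2) = ((2 * q)‼ : ℂ) := by
  rw [Nat.doubleFactorial_eq_prod_even]
  push_cast
  refine Finset.prod_congr rfl fun i _ => by ring

theorem prod_even_sub (q : ℕ) :
    ∏ i ∈ range q, (2 * (i : ℂ) - 2 * q) = (-1) ^ q * ((2 * q)‼ : ℂ) := by
  rw [← Finset.prod_range_reflect, ← prod_even_eq]
  have : ((-1 : ℂ)) ^ q = ∏ i ∈ range q, (-1 : ℂ) := by simp
  rw [this, ← Finset.prod_mul_distrib]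
  refine Finset.prod_congr rfl fun i hi => ?_
  have := mem_range.1 hi
  rw [show q - 1 - i = q - (i + 1) by omega, Nat.cast_sub (by omega)]
  push_cast
  ring

theorem prod_odd_sub (q : ℕ) :
    ∏ i ∈ range q, (2 * (i : ℂ) + 1 - 2 * q) = (-1) ^ q * ((2 * q - 1)‼ : ℂ) := by
  rw [← Finset.prod_range_reflect, ← prod_odd_eq]
  have : ((-1 : ℂ)) ^ q = ∏ i ∈ range q, (-1 : ℂ) := by simp
  rw [this, ← Finset.prod_mul_distrib]
  refine Finset.prod_congr rfl fun i hi => ?_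
  have := mem_range.1 hi
  rw [show q - 1 - i = q - (i + 1) by omega, Nat.cast_sub (by omega)]
  push_cast
  ring

end KPLump
end

noncomputable section
namespace KPLump
open Finset

/-! ### The exchange of one column between neighbouring vertices, and the minors on the next
columns. -/

variable {N : ℕ}

theorem vertexCols_val (N s : ℕ) (k : Fin N) :
    (vertexCols N s k : ℕ) = if (k : ℕ) + s < N then 2 * (k : ℕ) + 1 else 2 * (N - 1 - k) := by
  unfold vertexCols
  split_ifs <;> rfl

theorem vertexCols_injective {s : ℕ} : Function.Injective (vertexCols N s) := by
  intro i j h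
  have h' := congrArg Fin.val h
  rw [vertexCols_val, vertexCols_val] at h'
  ext
  split_ifs at h' <;> omega

/-- The index whose column is exchanged between the vertices `r` and `r + 1`. -/
def pivot (r : Fin (N / 2)) : Fin N := ⟨N - 1 - r, by omega⟩

theorem vertexCols_pivot (r : Fin (N / 2)) :
    (vertexCols N r (pivot r) : ℕ) = 2 * (N - 1 - r) + 1 := by
  rw [vertexCols_val, pivot]
  simp only
  rw [if_pos (by omega)]

theorem vertexCols_succ_pivot (r : Fin (N / 2)) :
    (vertexCols N (r + 1) (pivot r) : ℕ) = 2 * r := by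
  rw [vertexCols_val, pivot]
  simp only
  rw [if_neg (by omega)]
  omega

theorem vertexCols_succ_of_ne (r : Fin (N / 2)) {i : Fin N} (hi : i ≠ pivot r) :
    vertexCols N (r + 1) i = vertexCols N r i := by
  have : (i : ℕ) ≠ N - 1 - r := fun h => hi (Fin.ext h)
  ext
  rw [vertexCols_val, vertexCols_val]
  split_ifs <;> omega

/-- Apart from the pivot, the nodes of vertex r are the first N - 1 - r odd and the first r even
numbers. -/
theorem prod_erase_pivot (r : Fin (N / 2)) (x : ℂ) :
    ∏ i ∈ univ.erase (pivot r), (((vertexCols N r i : ℕ) : ℂ) - x)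
      = (∏ i ∈ range (N - 1 - r), (2 * (i : ℂ) + 1 - x)) * ∏ l ∈ range r, (2 * (l : ℂ) - x) := by
  have hr := r.2
  have h1 : ∏ i ∈ univ.erase (pivot r), (((vertexCols N r i : ℕ) : ℂ) - x)
      = ∏ k ∈ (range N).erase (N - 1 - r),
        ((((if k + r < N then 2 * k + 1 else 2 * (N - 1 - k) : ℕ)) : ℂ) - x) := by
    refine Finset.prod_bij (fun i _ => (i : ℕ)) ?_ ?_ ?_ ?_
    · intro i hi
      exact mem_erase.2 ⟨fun h => (mem_erase.1 hi).1 (Fin.ext h), mem_range.2 i.2⟩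
    · intro i _ j _ h
      exact Fin.ext h
    · intro k hk
      have hk := mem_erase.1 hk
      exact ⟨⟨k, mem_range.1 hk.2⟩, mem_erase.2 ⟨fun h => hk.1 (congrArg Fin.val h), mem_univ _⟩, rfl⟩
    · intro i _
      rw [vertexCols_val]
  have h2 : (range N).erase (N - 1 - r)
      = range (N - 1 - r) ∪ (range r).image fun l => N - 1 - l := by
    ext k
    simp only [mem_erase, mem_range, mem_union, mem_image]
    constructor
    · intro h
      by_cases hk : k < N - 1 - r
      · exact Or.inl hk
      · exact Or.inr ⟨N - 1 - k, by omega, by omega⟩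
    · rintro (h | ⟨l, hl, rfl⟩) <;> omega
  have h3 : Disjoint (range (N - 1 - r)) ((range r).image fun l => N - 1 - l) := by
    rw [Finset.disjoint_left]
    intro k hk hk'
    obtain ⟨l, hl, rfl⟩ := mem_image.1 hk'
    have := mem_range.1 hl
    have := mem_range.1 hk
    omega
  rw [h1, h2, Finset.prod_union h3, Finset.prod_image]
  · congr 1
    · refine Finset.prod_congr rfl fun k hk => ?_
      have := mem_range.1 hk
      rw [if_pos (by omega)]
      push_cast
      ring
    · refine Finset.prod_congr rfl fun l hl => ?_
      have := mem_range.1 hl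
      rw [if_neg (by omega), show N - 1 - (N - 1 - l) = l by omega]
      push_cast
      ring
  · intro i hi j hj h
    have := mem_range.1 hi
    have := mem_range.1 hj
    simp only at h
    omega

/-- The odd nodes below 2r and the even nodes give (-1)^r (2r-1)!! and (-1)^r (2r)!!, together
(2r)!. The odd nodes above 2r give (m-2)!!. -/
theorem prod_erase_pivot_low (r : Fin (N / 2)) :
    ∏ i ∈ univ.erase (pivot r), (((vertexCols N r i : ℕ) : ℂ) - ((2 * (r : ℕ) : ℕ) : ℂ))
      = ((2 * (r : ℕ))! : ℂ) * ((ringSize N r - 2)‼ : ℂ) := by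
  have hr := r.2
  obtain ⟨q, hq⟩ : ∃ q, N - 1 - (r : ℕ) = r + q := ⟨N - 1 - 2 * r, by omega⟩
  have h1 : ∏ i ∈ range q, (2 * (((r : ℕ) + i : ℕ) : ℂ) + 1 - 2 * (r : ℕ))
      = ((ringSize N r - 2)‼ : ℂ) := by
    rw [show ringSize N r - 2 = 2 * q - 1 by unfold ringSize; omega, ← prod_odd_eq]
    refine Finset.prod_congr rfl fun i _ => ?_
    push_cast
    ring
  have h2 : ((2 * (r : ℕ))! : ℂ) = ((2 * (r : ℕ) - 1)‼ : ℂ) * ((2 * (r : ℕ))‼ : ℂ) := by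
    rcases Nat.eq_zero_or_pos (r : ℕ) with h | h
    · simp [h]
    · have := Nat.factorial_eq_mul_doubleFactorial (2 * (r : ℕ) - 1)
      rw [show 2 * (r : ℕ) - 1 + 1 = 2 * r by omega] at this
      rw [this]
      push_cast
      ring
  have h3 : ((-1 : ℂ) ^ (r : ℕ)) * (-1) ^ (r : ℕ) = 1 := by
    rw [← mul_pow]
    simp
  rw [prod_erase_pivot, hq, Finset.prod_range_add]
  push_cast at h1 ⊢
  rw [h1, prod_odd_sub, prod_even_sub, h2]
  linear_combination ((2 * (r : ℕ) - 1)‼ : ℂ) * ((2 * (r : ℕ))‼ : ℂ) * ((ringSize N r - 2)‼ : ℂ) * h3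

/-- The differences with the odd nodes are even and give a full double factorial. Those with the
even nodes are the odd numbers between m and the node itself, so the factor m!! completes the
factorial. -/
theorem prod_erase_pivot_high (r : Fin (N / 2)) :
    (∏ i ∈ univ.erase (pivot r),
        (((vertexCols N r i : ℕ) : ℂ) - ((2 * (N - 1 - (r : ℕ)) + 1 : ℕ) : ℂ)))
        * ((ringSize N r)‼ : ℂ)
      = (-1) ^ (N - 1) * ((2 * (N - 1 - (r : ℕ)) + 1)! : ℂ) := by
  have hr := r.2
  obtain ⟨M, hM⟩ : ∃ M, N - 1 - (r : ℕ) = M := ⟨_, rfl⟩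
  obtain ⟨q, hq⟩ : ∃ q, M = r + q := ⟨M - r, by omega⟩
  rw [prod_erase_pivot, hM]
  have h1 : ∏ i ∈ range M, (2 * (i : ℂ) + 1 - ((2 * M + 1 : ℕ) : ℂ)) = (-1) ^ M * ((2 * M)‼ : ℂ) := by
    rw [← prod_even_sub]
    refine Finset.prod_congr rfl fun i _ => ?_
    push_cast
    ring
  have h2 : (∏ l ∈ range r, (2 * (l : ℂ) - ((2 * M + 1 : ℕ) : ℂ))) * ((ringSize N r)‼ : ℂ)
      = (-1) ^ (r : ℕ) * ((2 * M + 1)‼ : ℂ) := by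
    have e1 : ringSize N r = 2 * (q + 1) - 1 := by unfold ringSize; omega
    have e2 : 2 * M + 1 = 2 * (q + 1 + r) - 1 := by omega
    have e3 : ∏ l ∈ range r, (2 * (l : ℂ) - ((2 * M + 1 : ℕ) : ℂ))
        = (-1) ^ (r : ℕ) * ∏ l ∈ range r, (2 * ((q + 1 + l : ℕ) : ℂ) + 1) := by
      have : ((-1 : ℂ)) ^ (r : ℕ) = ∏ i ∈ range (r : ℕ), (-1 : ℂ) := by simp
      rw [this, ← Finset.prod_mul_distrib, ← Finset.prod_range_reflect]
      refine Finset.prod_congr rfl fun l hl => ?_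
      have := mem_range.1 hl
      have e : ((r - 1 - l : ℕ) : ℂ) = r - 1 - l := by
        rw [Nat.sub_sub, Nat.cast_sub (by omega)]
        push_cast
        ring
      rw [e, hq]
      push_cast
      ring
    rw [e3, e1, e2, ← prod_odd_eq, ← prod_odd_eq, Finset.prod_range_add _ (q + 1) r]
    ring
  rw [h1, mul_assoc, h2, show N - 1 = M + r by omega, pow_add,
    Nat.factorial_eq_mul_doubleFactorial]
  push_cast
  ring

/-- The ratio of the leading coefficients of consecutive vertices. -/
theorem leadMinor_vertexCols_succ (r : Fin (N / 2)) :
    leadMinor (vertexCols N (r + 1)) (firstCols N).1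
      = (-1) ^ (N - 1) * ((ringSize N r)‼ : ℂ) * ((ringSize N r - 2)‼ : ℂ)
        * leadMinor (vertexCols N r) (firstCols N).1 := by
  have hne : ∀ (s : ℕ), (∏ i, ((vertexCols N s i : ℕ)! : ℂ)) ≠ 0 := fun s =>
    Finset.prod_ne_zero_iff.2 fun i _ => by exact_mod_cast Nat.factorial_ne_zero _
  have hV := det_vandermonde_change (fun i => ((vertexCols N (r + 1) i : ℕ) : ℂ))
    (fun i => ((vertexCols N r i : ℕ) : ℂ)) (pivot r) fun i hi => by
      simp only [vertexCols_succ_of_ne r hi]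
  have hP : ∏ i ∈ univ.erase (pivot r),
      (((vertexCols N (r + 1) i : ℕ) : ℂ) - ((vertexCols N (r + 1) (pivot r) : ℕ) : ℂ))
      = ∏ i ∈ univ.erase (pivot r), (((vertexCols N r i : ℕ) : ℂ) - ((2 * (r : ℕ) : ℕ) : ℂ)) := by
    refine Finset.prod_congr rfl fun i hi => ?_
    rw [vertexCols_succ_of_ne r (mem_erase.1 hi).1, vertexCols_succ_pivot]
  have hF : ∀ s : ℕ, ∏ i, ((vertexCols N s i : ℕ)! : ℂ)
      = ((vertexCols N s (pivot r) : ℕ)! : ℂ)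
        * ∏ i ∈ univ.erase (pivot r), ((vertexCols N s i : ℕ)! : ℂ) :=
    fun s => (Finset.mul_prod_erase _ _ (mem_univ _)).symm
  have hE : ∏ i ∈ univ.erase (pivot r), ((vertexCols N (r + 1) i : ℕ)! : ℂ)
      = ∏ i ∈ univ.erase (pivot r), ((vertexCols N r i : ℕ)! : ℂ) :=
    Finset.prod_congr rfl fun i hi => by rw [vertexCols_succ_of_ne r (mem_erase.1 hi).1]
  have h1 := hne r
  have h2 := hne (r + 1)
  have hL := prod_erase_pivot_low r
  have hH := prod_erase_pivot_high r
  have hB : ((2 * (N - 1 - (r : ℕ)) + 1)! : ℂ) ≠ 0 := by exact_mod_cast Nat.factorial_ne_zero _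
  have hA : ((2 * (r : ℕ))! : ℂ) ≠ 0 := by exact_mod_cast Nat.factorial_ne_zero _
  have hm : ((ringSize N r)‼ : ℂ) ≠ 0 := by exact_mod_cast (Nat.doubleFactorial_pos _).ne'
  rw [hP, hL, vertexCols_pivot] at hV
  rw [leadMinor_firstCols, leadMinor_firstCols]
  rw [hF, vertexCols_succ_pivot, hE] at h2 ⊢
  rw [hF, vertexCols_pivot] at h1 ⊢
  have h3 := right_ne_zero_of_mul h1
  have hs : ((-1 : ℂ) ^ (N - 1)) * (-1) ^ (N - 1) = 1 := by
    rw [← mul_pow]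
    simp
  generalize (Matrix.vandermonde fun i => ((vertexCols N r i : ℕ) : ℂ)).det = V at hV ⊢
  generalize (Matrix.vandermonde fun i => ((vertexCols N (r + 1) i : ℕ) : ℂ)).det = V' at hV ⊢
  -- The ratio of the Vandermonde determinants is the low product over the high one,
  -- cross-multiplied; the two extra factorials are those of the exchanged columns.
  have key : V' * ((2 * (N - 1 - (r : ℕ)) + 1)! : ℂ)
      = (-1) ^ (N - 1) * ((ringSize N r)‼ : ℂ) * ((ringSize N r - 2)‼ : ℂ) * V
        * ((2 * (r : ℕ))! : ℂ) := by
    linear_combination (-1) ^ (N - 1) * ((ringSize N r)‼ : ℂ) * hV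
      - V' * (-1) ^ (N - 1) * hH - V' * ((2 * (N - 1 - (r : ℕ)) + 1)! : ℂ) * hs
  rw [← mul_div_assoc, div_eq_div_iff h2 h1]
  linear_combination (∏ i ∈ univ.erase (pivot r), ((vertexCols N r i : ℕ)! : ℂ)) * key

/-- The first `N - 1` columns and the column `N`. -/
def nextCols (N : ℕ) : Cols N (2 * N) :=
  ⟨fun j => if (j : ℕ) + 1 = N then ⟨N, by have := j.2; omega⟩ else ⟨j, by have := j.2; omega⟩,
    fun i j h => by
    have h' : (i : ℕ) < j := h
    have hi : ¬ (i : ℕ) + 1 = N := by omega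
    simp only [if_neg hi]
    split_ifs
    · simp only [Fin.mk_lt_mk]
      omega
    · exact h'⟩

/-- From f / (f-j)! = 1 / (f-j-1)! + j / (f-j)! one gets diag(f) v = u + v diag(j). Multiplying by
the adjugate of v and taking traces gives the claim, since tr(adj(v) u) is the minor on the next
columns. The factor equals the degree in w, so this minor behaves like a derivative of the first
one. -/
theorem leadMinor_nextCols (h0 : 0 < N) (f : Fin N → Fin (2 * N)) :
    leadMinor f (nextCols N).1
      = (∑ i, ((f i : ℕ) : ℂ) - ∑ j : Fin N, ((j : ℕ) : ℂ)) * leadMinor f (firstCols N).1 := by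
  set v : Matrix (Fin N) (Fin N) ℂ := Matrix.of fun i j => invFact (f i) j with hv
  set u : Matrix (Fin N) (Fin N) ℂ := Matrix.of fun i j => invFact (f i) (j + 1) with hu
  have hv' : leadMinor f (firstCols N).1 = v.det := rfl
  have h1 : Matrix.diagonal (fun i => ((f i : ℕ) : ℂ)) * v
      = u + v * Matrix.diagonal fun j : Fin N => ((j : ℕ) : ℂ) := by
    ext i j
    simp only [Matrix.diagonal_mul, Matrix.add_apply, Matrix.mul_diagonal, hv, hu, Matrix.of_apply,
      invFact]
    by_cases h : (j : ℕ) + 1 ≤ f i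
    · rw [if_pos h, if_pos (by omega)]
      obtain ⟨k, hk⟩ : ∃ k, (f i : ℕ) = j + 1 + k := ⟨f i - (j + 1), by omega⟩
      rw [hk, show (j : ℕ) + 1 + k - j = k + 1 by omega, show (j : ℕ) + 1 + k - (j + 1) = k by omega,
        Nat.factorial_succ]
      have h2 : (k ! : ℂ) ≠ 0 := by exact_mod_cast Nat.factorial_ne_zero _
      have h3 : (k : ℂ) + 1 ≠ 0 := by exact_mod_cast Nat.succ_ne_zero k
      push_cast
      field_simp
      ring
    · rw [if_neg h]
      by_cases h' : (j : ℕ) ≤ f i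
      · rw [if_pos h', show (f i : ℕ) = j by omega]
        simp
      · rw [if_neg h']
        simp
  have h2 := congrArg (fun A => (v.adjugate * A).trace) h1
  simp only [Matrix.mul_add, Matrix.trace_add] at h2
  have h3 : (v.adjugate * (Matrix.diagonal (fun i => ((f i : ℕ) : ℂ)) * v)).trace
      = (∑ i, ((f i : ℕ) : ℂ)) * v.det := by
    rw [Matrix.trace_mul_comm, Matrix.mul_assoc, Matrix.mul_adjugate, Matrix.mul_smul, Matrix.mul_one,
      Matrix.trace_smul, Matrix.trace_diagonal, smul_eq_mul, mul_comm]
  have h4 : (v.adjugate * (v * Matrix.diagonal fun j : Fin N => ((j : ℕ) : ℂ))).trace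
      = (∑ j : Fin N, ((j : ℕ) : ℂ)) * v.det := by
    rw [← Matrix.mul_assoc, Matrix.adjugate_mul, Matrix.smul_mul, Matrix.one_mul,
      Matrix.trace_smul, Matrix.trace_diagonal, smul_eq_mul, mul_comm]
  -- The trace is the sum over j of det v with column j replaced by column j + 1. All but the last
  -- term repeat a column.
  have h5 : (v.adjugate * u).trace = leadMinor f (nextCols N).1 := by
    have hd : ∀ j, (v.adjugate * u) j j = (v.updateCol j (u.col j)).det := by
      intro j
      rw [← Matrix.cramer_apply, Matrix.cramer_eq_adjugate_mulVec]
      rfl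
    rw [Matrix.trace]
    simp only [Matrix.diag_apply, hd]
    · rw [Finset.sum_eq_single (⟨N - 1, by omega⟩ : Fin N)]
      · rw [leadMinor]
        congr 1
        ext i j
        by_cases hj : j = ⟨N - 1, by omega⟩
        · subst hj
          rw [Matrix.updateCol_self]
          have : N - 1 + 1 = N := by omega
          simp [hu, nextCols, this]
        · rw [Matrix.updateCol_ne hj]
          have : ¬ (j : ℕ) + 1 = N := fun h => hj (Fin.ext (by simp; omega))
          simp [hv, nextCols, this]
      · intro j _ hj
        have hj' : (j : ℕ) + 1 < N := by
          have : (j : ℕ) ≠ N - 1 := fun h => hj (Fin.ext h)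
          omega
        refine Matrix.det_zero_of_column_eq (i := j) (j := ⟨j + 1, hj'⟩) (fun h => ?_) fun i => ?_
        · have := congrArg Fin.val h
          simp at this
        · rw [Matrix.updateCol_self, Matrix.updateCol_ne]
          · simp [hu, hv]
          · intro h
            have := congrArg Fin.val h
            simp at this
      · simp
  rw [h3, h4, h5] at h2
  rw [hv']
  linear_combination -h2

end KPLump
end

noncomputable section
namespace KPLump
open Finset

variable {N : ℕ}

/-! ### Exponents of the minors -/

/-- The exponent of the slow time in the minor with columns `D`. -/
def expT (D : Cols N (2 * N)) : ℤ :=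
  ∑ i : Fin N, ((i : ℕ) : ℤ) - ∑ j, (((D.1 j : ℕ) / 2 : ℕ) : ℤ)

/-- The degree of the position minor with rows `D` and the first `N` columns. -/
def expX (D : Cols N (2 * N)) : ℤ :=
  ∑ i, ((D.1 i : ℕ) : ℤ) - ∑ i, (((firstCols N).1 i : ℕ) : ℤ)

/-- The columns of `vertexCols` in increasing order. -/
def vertex (N s : ℕ) : Cols N (2 * N) := (exists_sort (vertexCols_injective (N := N) (s := s))).choose

theorem vertex_spec (N s : ℕ) :
    ∃ π : Equiv.Perm (Fin N), vertexCols N s = (vertex N s).1 ∘ π :=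
  (exists_sort (vertexCols_injective (N := N) (s := s))).choose_spec

/-- The separate coefficients depend on the order of the columns, their product does not. Hence the
explicit unsorted order may be used. -/
theorem leadTime_mul_leadMinor_vertex (a : Fin N → ℕ → ℂ) (s : ℕ) :
    leadTime a (vertex N s).1 * leadMinor (vertex N s).1 (firstCols N).1
      = leadTime a (vertexCols N s) * leadMinor (vertexCols N s) (firstCols N).1 := by
  obtain ⟨π, h⟩ := vertex_spec N s
  rw [h]
  exact (det_mul_det_submatrix_comp (timeLeadMat a)
    (Matrix.of fun (i : Fin (2 * N)) (j : Fin N) => invFact i ((firstCols N).1 j)) (vertex N s).1 π).symm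

/-- The set of columns. -/
def colSet (D : Cols N (2 * N)) : Finset (Fin (2 * N)) := univ.image D.1

theorem card_colSet (D : Cols N (2 * N)) : (colSet D).card = N := by
  rw [colSet, Finset.card_image_of_injective _ D.2.injective, Finset.card_univ, Fintype.card_fin]

theorem sum_colSet (D : Cols N (2 * N)) (f : Fin (2 * N) → ℤ) :
    ∑ d ∈ colSet D, f d = ∑ i, f (D.1 i) :=
  Finset.sum_image fun _ _ _ _ h => D.2.injective h

theorem colSet_injective : Function.Injective (colSet (N := N)) := by
  intro D D' h
  refine Subtype.ext ((StrictMono.range_inj D.2 D'.2).1 ?_)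
  have := congrArg (fun S : Finset (Fin (2 * N)) => (S : Set (Fin (2 * N)))) h
  simpa [colSet] using this

theorem mem_colSet_vertex {s : ℕ} (_hs : s ≤ N) (d : Fin (2 * N)) :
    d ∈ colSet (vertex N s) ↔
      ((d : ℕ) % 2 = 0 ∧ (d : ℕ) / 2 < s) ∨ ((d : ℕ) % 2 = 1 ∧ (d : ℕ) / 2 + s < N) := by
  obtain ⟨π, h⟩ := vertex_spec N s
  have h1 : d ∈ colSet (vertex N s) ↔ ∃ k, vertexCols N s k = d := by
    simp only [colSet, mem_image, mem_univ, true_and, h, Function.comp]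
    constructor
    · rintro ⟨i, hi⟩
      exact ⟨π.symm i, by simpa using hi⟩
    · rintro ⟨i, hi⟩
      exact ⟨π i, hi⟩
  rw [h1]
  constructor
  · rintro ⟨k, rfl⟩
    rw [vertexCols_val]
    split_ifs <;> omega
  · rintro (⟨h1, h2⟩ | ⟨h1, h2⟩)
    · refine ⟨⟨N - 1 - d / 2, by omega⟩, Fin.ext ?_⟩
      rw [vertexCols_val]
      simp only
      rw [if_neg (by omega)]
      omega
    · refine ⟨⟨d / 2, by omega⟩, Fin.ext ?_⟩
      rw [vertexCols_val]
      simp only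
      rw [if_pos (by omega)]
      omega

/-- With weights 2p + 1 and p the contribution of a column d = 2⌊d/2⌋ + (d mod 2) reduces to p (d
mod 2) - ⌊d/2⌋. The weight of D is thus additive over its columns. -/
theorem mul_expT_add_mul_expX (p : ℤ) (D : Cols N (2 * N)) :
    (2 * p + 1) * expT D + p * expX D
      = (2 * p + 1) * ∑ i : Fin N, ((i : ℕ) : ℤ) - p * ∑ i, (((firstCols N).1 i : ℕ) : ℤ)
        + ∑ d ∈ colSet D, (p * (((d : ℕ) % 2 : ℕ) : ℤ) - (((d : ℕ) / 2 : ℕ) : ℤ)) := by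
  have h : ∑ d ∈ colSet D, (p * (((d : ℕ) % 2 : ℕ) : ℤ) - (((d : ℕ) / 2 : ℕ) : ℤ))
      = p * ∑ i, ((D.1 i : ℕ) : ℤ) - (2 * p + 1) * ∑ j, (((D.1 j : ℕ) / 2 : ℕ) : ℤ) := by
    rw [sum_colSet, Finset.mul_sum, Finset.mul_sum, ← Finset.sum_sub_distrib]
    refine Finset.sum_congr rfl fun i _ => ?_
    have h1 : (((D.1 i : ℕ)) : ℤ) = 2 * (((D.1 i : ℕ) / 2 : ℕ) : ℤ) + (((D.1 i : ℕ) % 2 : ℕ) : ℤ) := by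
      omega
    rw [h1]
    ring
  rw [h, expT, expX]
  ring

/-- The columns common to the vertices `r` and `r + 1`. -/
def edgeSet (r : Fin (N / 2)) : Finset (Fin (2 * N)) :=
  univ.filter fun d => ((d : ℕ) % 2 = 0 ∧ (d : ℕ) / 2 < r) ∨
    ((d : ℕ) % 2 = 1 ∧ (d : ℕ) / 2 + (r + 1) < N)

theorem colSet_vertex (r : Fin (N / 2)) :
    colSet (vertex N r) = insert ⟨2 * (N - 1 - r) + 1, by omega⟩ (edgeSet r) := by
  have hr := r.2
  ext d
  rw [mem_colSet_vertex (by omega), mem_insert, edgeSet, mem_filter, Fin.ext_iff]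
  simp only [mem_univ, true_and]
  omega

theorem colSet_vertex_succ (r : Fin (N / 2)) :
    colSet (vertex N (r + 1)) = insert ⟨2 * r, by omega⟩ (edgeSet r) := by
  have hr := r.2
  ext d
  rw [mem_colSet_vertex (by omega), mem_insert, edgeSet, mem_filter, Fin.ext_iff]
  simp only [mem_univ, true_and]
  omega

theorem top_notMem_edgeSet (r : Fin (N / 2)) :
    (⟨2 * (N - 1 - r) + 1, by omega⟩ : Fin (2 * N)) ∉ edgeSet r := by
  simp only [edgeSet, mem_filter, mem_univ, true_and]
  omega

theorem bot_notMem_edgeSet (r : Fin (N / 2)) :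
    (⟨2 * r, by omega⟩ : Fin (2 * N)) ∉ edgeSet r := by
  simp only [edgeSet, mem_filter, mem_univ, true_and]
  omega

theorem expX_vertex (r : Fin (N / 2)) :
    expX (vertex N r) = expX (vertex N (r + 1)) + ringSize N r := by
  have hr := r.2
  have h : ∀ D : Cols N (2 * N), ∑ i, ((D.1 i : ℕ) : ℤ) = ∑ d ∈ colSet D, ((d : ℕ) : ℤ) :=
    fun D => (sum_colSet D fun d => ((d : ℕ) : ℤ)).symm
  rw [expX, expX, h (vertex N r), h (vertex N (r + 1)), colSet_vertex, colSet_vertex_succ,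
    Finset.sum_insert (top_notMem_edgeSet r), Finset.sum_insert (bot_notMem_edgeSet r), ringSize]
  simp only
  omega

theorem expT_vertex (r : Fin (N / 2)) :
    expT (vertex N (r + 1)) = expT (vertex N r) + ringNum N r := by
  have hr := r.2
  have h : ∀ D : Cols N (2 * N), ∑ i, (((D.1 i : ℕ) / 2 : ℕ) : ℤ)
      = ∑ d ∈ colSet D, (((d : ℕ) / 2 : ℕ) : ℤ) :=
    fun D => (sum_colSet D fun d => (((d : ℕ) / 2 : ℕ) : ℤ)).symm
  rw [expT, expT, h (vertex N r), h (vertex N (r + 1)), colSet_vertex, colSet_vertex_succ,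
    Finset.sum_insert (top_notMem_edgeSet r), Finset.sum_insert (bot_notMem_edgeSet r), ringNum]
  simp only
  omega

theorem ringSize_eq (r : Fin (N / 2)) : ringSize N r = 2 * ringNum N r + 1 := by
  have hr := r.2
  unfold ringSize ringNum
  omega

theorem ringNum_pos (r : Fin (N / 2)) : 0 < ringNum N r := by
  have hr := r.2
  unfold ringNum
  omega

/-- On the `r`-th edge of the Newton polygon only the two vertices have maximal weight. -/
theorem weight_lt (r : Fin (N / 2)) {D : Cols N (2 * N)} (h1 : D ≠ vertex N r)
    (h2 : D ≠ vertex N (r + 1)) :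
    (ringSize N r : ℤ) * expT D + ringNum N r * expX D + 1
      ≤ ringSize N r * expT (vertex N r) + ringNum N r * expX (vertex N r) := by
  have hr := r.2
  have hm : (ringSize N r : ℤ) = 2 * (ringNum N r : ℤ) + 1 := by exact_mod_cast ringSize_eq r
  have hp : (ringNum N r : ℤ) = N - 1 - 2 * (r : ℕ) := by
    unfold ringNum
    omega
  rw [hm, mul_expT_add_mul_expX, mul_expT_add_mul_expX]
  -- The column weight is shifted by r, which changes every total by the same N r. Then ψ ≥ 1 on the
  -- common columns of the two vertices, ψ = 0 on the two exchanged columns and ψ ≤ -1 elsewhere.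
  set ψ : Fin (2 * N) → ℤ := fun d =>
    (ringNum N r : ℤ) * (((d : ℕ) % 2 : ℕ) : ℤ) - (((d : ℕ) / 2 : ℕ) : ℤ) + (r : ℕ) with hψ
  have hsum : ∀ D : Cols N (2 * N),
      ∑ d ∈ colSet D, ((ringNum N r : ℤ) * (((d : ℕ) % 2 : ℕ) : ℤ) - (((d : ℕ) / 2 : ℕ) : ℤ))
        = ∑ d ∈ colSet D, ψ d - N * (r : ℕ) := by
    intro D
    simp only [hψ, Finset.sum_add_distrib, Finset.sum_const, card_colSet]
    simp
  rw [hsum, hsum]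
  suffices ∑ d ∈ colSet D, ψ d + 1 ≤ ∑ d ∈ colSet (vertex N r), ψ d by linarith
  have hψ0 : ∀ d : Fin (2 * N), (d : ℕ) % 2 = 0 → ψ d = (r : ℕ) - ((d : ℕ) / 2 : ℕ) := by
    intro d hd
    simp only [hψ, hd]
    push_cast
    ring
  have hψ1 : ∀ d : Fin (2 * N), (d : ℕ) % 2 = 1 → ψ d = N - 1 - (r : ℕ) - ((d : ℕ) / 2 : ℕ) := by
    intro d hd
    simp only [hψ, hd, hp]
    push_cast
    ring
  have hpos : ∀ d ∈ edgeSet r, 1 ≤ ψ d := by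
    intro d hd
    simp only [edgeSet, mem_filter, mem_univ, true_and] at hd
    rcases hd with ⟨h, h'⟩ | ⟨h, h'⟩
    · rw [hψ0 d h]
      omega
    · rw [hψ1 d h]
      omega
  have hneg : ∀ d, d ∉ edgeSet r → ψ d ≤ 0 := by
    intro d hd
    simp only [edgeSet, mem_filter, mem_univ, true_and, not_or, not_and] at hd
    rcases Nat.mod_two_eq_zero_or_one d with h | h
    · rw [hψ0 d h]
      have := hd.1 h
      omega
    · rw [hψ1 d h]
      have := hd.2 h
      omega
  have hzero : ∀ d, d ∉ edgeSet r → (d : ℕ) ≠ 2 * (N - 1 - r) + 1 → (d : ℕ) ≠ 2 * r → ψ d ≤ -1 := by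
    intro d hd h1 h2
    simp only [edgeSet, mem_filter, mem_univ, true_and, not_or, not_and] at hd
    rcases Nat.mod_two_eq_zero_or_one d with h | h
    · rw [hψ0 d h]
      have := hd.1 h
      omega
    · rw [hψ1 d h]
      have := hd.2 h
      omega
  have htop : ψ ⟨2 * (N - 1 - r) + 1, by omega⟩ = 0 := by
    rw [hψ1 _ (by simp only; omega)]
    simp only
    omega
  rw [colSet_vertex, Finset.sum_insert (top_notMem_edgeSet r), htop, zero_add]
  have e1 : ∑ d ∈ colSet D, ψ d
      = ∑ d ∈ colSet D ∩ edgeSet r, ψ d + ∑ d ∈ colSet D \ edgeSet r, ψ d :=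
    (Finset.sum_inter_add_sum_sdiff _ _ _).symm
  have e2 : ∑ d ∈ edgeSet r, ψ d
      = ∑ d ∈ colSet D ∩ edgeSet r, ψ d + ∑ d ∈ edgeSet r \ colSet D, ψ d := by
    rw [Finset.inter_comm]
    exact (Finset.sum_inter_add_sum_sdiff _ _ _).symm
  have e3 : 0 ≤ ∑ d ∈ edgeSet r \ colSet D, ψ d :=
    Finset.sum_nonneg fun d hd => by linarith [hpos d (mem_sdiff.1 hd).1]
  have e4 : ∑ d ∈ colSet D \ edgeSet r, ψ d ≤ 0 :=
    Finset.sum_nonpos fun d hd => hneg d (mem_sdiff.1 hd).2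
  rw [e1, e2]
  -- Maximal weight leaves no room: D contains all common columns and has one further column of
  -- weight 0, which must be one of the two exchanged ones.
  by_contra hcon
  have e5 : ∑ d ∈ edgeSet r \ colSet D, ψ d = 0 := by linarith
  have e6 : ∑ d ∈ colSet D \ edgeSet r, ψ d = 0 := by linarith
  have hsub : edgeSet r ⊆ colSet D := by
    rw [← Finset.sdiff_eq_empty_iff_subset, Finset.eq_empty_iff_forall_notMem]
    intro d hd
    have := (Finset.sum_eq_zero_iff_of_nonneg (fun d hd => by
      linarith [hpos d (mem_sdiff.1 hd).1])).1 e5 d hd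
    linarith [hpos d (mem_sdiff.1 hd).1]
  have hcard : (edgeSet r).card + 1 = N := by
    have := card_colSet (vertex N r)
    rwa [colSet_vertex, Finset.card_insert_of_notMem (top_notMem_edgeSet r)] at this
  obtain ⟨z, hz⟩ : ∃ z, colSet D \ edgeSet r = {z} := by
    rw [← Finset.card_eq_one, Finset.card_sdiff_of_subset hsub, card_colSet]
    omega
  have hD : colSet D = insert z (edgeSet r) := by
    rw [Finset.insert_eq, ← hz, Finset.sdiff_union_of_subset hsub]
  have hz' : z ∉ edgeSet r := (mem_sdiff.1 (hz ▸ mem_singleton_self z : z ∈ colSet D \ edgeSet r)).2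
  rw [hz, Finset.sum_singleton] at e6
  by_cases hz1 : (z : ℕ) = 2 * (N - 1 - r) + 1
  · refine h1 (colSet_injective ?_)
    rw [hD, colSet_vertex]
    congr 1
    exact Fin.ext hz1
  · by_cases hz2 : (z : ℕ) = 2 * r
    · refine h2 (colSet_injective ?_)
      rw [hD, colSet_vertex_succ]
      congr 1
      exact Fin.ext hz2
    · linarith [hzero z hz' hz1 hz2]

theorem weight_vertex_succ (r : Fin (N / 2)) :
    (ringSize N r : ℤ) * expT (vertex N (r + 1)) + ringNum N r * expX (vertex N (r + 1))
      = ringSize N r * expT (vertex N r) + ringNum N r * expX (vertex N r) := by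
  rw [expT_vertex, expX_vertex]
  ring

theorem weight_le (r : Fin (N / 2)) (D : Cols N (2 * N)) :
    (ringSize N r : ℤ) * expT D + ringNum N r * expX D
      ≤ ringSize N r * expT (vertex N r) + ringNum N r * expX (vertex N r) := by
  by_cases h1 : D = vertex N r
  · rw [h1]
  by_cases h2 : D = vertex N (r + 1)
  · rw [h2, weight_vertex_succ]
  linarith [weight_lt r h1 h2]

/-- A nonnegative `expT` bounds the sum of ⌊d/2⌋, and the sum of the parities is below N unless all
columns are odd, which is vertex 0. This settles the region outside all rings. -/
theorem expX_lt_of_expT_nonneg {D : Cols N (2 * N)} (h : 0 ≤ expT D) (hD : D ≠ vertex N 0) :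
    expX D < expX (vertex N 0) := by
  have hdec : ∀ D : Cols N (2 * N), expX D = 2 * ∑ d ∈ colSet D, (((d : ℕ) / 2 : ℕ) : ℤ)
      + ∑ d ∈ colSet D, (((d : ℕ) % 2 : ℕ) : ℤ) - ∑ i, (((firstCols N).1 i : ℕ) : ℤ) := by
    intro D
    rw [expX, sum_colSet, sum_colSet, Finset.mul_sum, ← Finset.sum_add_distrib]
    congr 1
    refine Finset.sum_congr rfl fun i _ => ?_
    omega
  have hT : ∀ D : Cols N (2 * N), expT D
      = ∑ i : Fin N, ((i : ℕ) : ℤ) - ∑ d ∈ colSet D, (((d : ℕ) / 2 : ℕ) : ℤ) := by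
    intro D
    rw [expT, sum_colSet]
  obtain ⟨π, hπ⟩ := vertex_spec N 0
  have h0 : ∑ d ∈ colSet (vertex N 0), (((d : ℕ) / 2 : ℕ) : ℤ) = ∑ i : Fin N, ((i : ℕ) : ℤ) := by
    rw [sum_colSet, ← Equiv.sum_comp π]
    refine Finset.sum_congr rfl fun i _ => ?_
    have h1 : (vertex N 0).1 (π i) = vertexCols N 0 i := by rw [hπ]; rfl
    rw [h1, vertexCols_val, if_pos (by omega)]
    omega
  have h1 : ∑ d ∈ colSet (vertex N 0), (((d : ℕ) % 2 : ℕ) : ℤ) = N := by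
    rw [Finset.sum_congr rfl (g := fun _ => (1 : ℤ)) fun d hd => ?_]
    · simp [card_colSet]
    · have := (mem_colSet_vertex (Nat.zero_le N) d).1 hd
      omega
  have h2 : ∑ d ∈ colSet D, (((d : ℕ) % 2 : ℕ) : ℤ) < N := by
    have h3 : ∑ d ∈ colSet D, (1 : ℤ) = N := by simp [card_colSet]
    rw [← h3]
    refine Finset.sum_lt_sum (fun d _ => by omega) ?_
    by_contra hcon
    push Not at hcon
    refine hD (colSet_injective ?_)
    refine Finset.eq_of_subset_of_card_le (fun d hd => ?_) (by rw [card_colSet, card_colSet])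
    rw [mem_colSet_vertex (Nat.zero_le N)]
    have := hcon d hd
    have := d.2
    omega
  rw [hT] at h
  rw [hdec, hdec, h0, h1]
  linarith

/-- The columns are the first N - [N/2] odd and the first [N/2] even numbers. The value is the
degree left inside the last ring, so it says whether a central lump exists. -/
theorem expX_vertex_half (N : ℕ) : expX (vertex N (N / 2)) = (N % 2 : ℕ) := by
  obtain ⟨π, hπ⟩ := vertex_spec N (N / 2)
  have h1 : ∑ i, (((vertex N (N / 2)).1 i : ℕ) : ℤ) = ∑ i, ((vertexCols N (N / 2) i : ℕ) : ℤ) := by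
    rw [← Equiv.sum_comp π, hπ]
    rfl
  have h2 : ∑ i, ((vertexCols N (N / 2) i : ℕ) : ℤ)
      = ∑ k ∈ range N, ((if k + N / 2 < N then 2 * k + 1 else 2 * (N - 1 - k) : ℕ) : ℤ) := by
    rw [← Fin.sum_univ_eq_sum_range fun k =>
      ((if k + N / 2 < N then 2 * k + 1 else 2 * (N - 1 - k) : ℕ) : ℤ)]
    refine Finset.sum_congr rfl fun i _ => ?_
    rw [vertexCols_val]
  have h3 : ∑ i, (((firstCols N).1 i : ℕ) : ℤ) = ∑ k ∈ range N, (k : ℤ) :=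
    Fin.sum_univ_eq_sum_range (fun k => (k : ℤ)) N
  have h4 : ∑ k ∈ range N, ((if k + N / 2 < N then 2 * k + 1 else 2 * (N - 1 - k) : ℕ) : ℤ)
      = ∑ k ∈ range (N - N / 2), (2 * (k : ℤ) + 1) + ∑ l ∈ range (N / 2), 2 * (l : ℤ) := by
    conv_lhs => rw [show N = (N - N / 2) + N / 2 by omega, Finset.sum_range_add]
    congr 1
    · refine Finset.sum_congr rfl fun k hk => ?_
      have := mem_range.1 hk
      rw [if_pos (by omega)]
      push_cast
      ring
    · rw [← Finset.sum_range_reflect (fun l : ℕ => 2 * (l : ℤ))]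
      refine Finset.sum_congr rfl fun k hk => ?_
      have := mem_range.1 hk
      rw [if_neg (by omega)]
      omega
  have hg : ∀ n : ℕ, ∑ k ∈ range n, (k : ℤ) * 2 = n * (n - 1) := by
    intro n
    induction n with
    | zero => simp
    | succ n ih =>
      rw [Finset.sum_range_succ, ih]
      push_cast
      ring
  have h5 : ∑ k ∈ range (N - N / 2), (2 * (k : ℤ) + 1)
      = ((N - N / 2 : ℕ) : ℤ) * ((N - N / 2 : ℕ) : ℤ) := by
    have := hg (N - N / 2)
    rw [Finset.sum_add_distrib, Finset.sum_congr rfl fun (k : ℕ) _ => mul_comm (2 : ℤ) k, this]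
    simp
    ring
  have h6 := hg (N / 2)
  have h7 := hg N
  rw [← Finset.sum_mul] at h7
  rw [expX, h1, h2, h3, h4, h5, Finset.sum_congr rfl fun (k : ℕ) _ => mul_comm (2 : ℤ) k, h6]
  rcases Nat.even_or_odd' N with ⟨s, hs | hs⟩
  · have e1 : N / 2 = s := by omega
    have e2 : N - s = s := by omega
    have e3 : N % 2 = 0 := by omega
    rw [e1, e2, e3]
    have : (N : ℤ) = 2 * s := by exact_mod_cast hs
    rw [this] at h7
    push_cast
    linarith
  · have e1 : N / 2 = s := by omega
    have e2 : N - s = s + 1 := by omega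
    have e3 : N % 2 = 1 := by omega
    rw [e1, e2, e3]
    have : (N : ℤ) = 2 * s + 1 := by exact_mod_cast hs
    rw [this] at h7
    push_cast
    linarith

theorem expX_vertex_nonneg {s : ℕ} (hs : s ≤ N / 2) : 0 ≤ expX (vertex N s) := by
  induction hs using Nat.decreasingInduction with
  | self =>
    rw [expX_vertex_half]
    omega
  | of_succ k hk ih =>
    have := expX_vertex (N := N) ⟨k, hk⟩
    simp only at this
    rw [this]
    omega

/-! ### Gaps of the columns -/

/-- The excess of the columns `J` over the first `N` columns. -/
def gap (J : Cols N (2 * N)) : ℤ :=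
  ∑ i, ((J.1 i : ℕ) : ℤ) - ∑ i, (((firstCols N).1 i : ℕ) : ℤ)

theorem gap_firstCols (N : ℕ) : gap (firstCols N) = 0 := sub_self _

theorem firstCols_val (i : Fin N) : ((firstCols N).1 i : ℕ) = i := rfl

theorem nextCols_val (i : Fin N) :
    ((nextCols N).1 i : ℕ) = if (i : ℕ) + 1 = N then N else (i : ℕ) := by
  simp only [nextCols]
  split_ifs <;> rfl

theorem gap_eq_sum (J : Cols N (2 * N)) : gap J = ∑ i, (((J.1 i : ℕ) : ℤ) - (i : ℕ)) := by
  rw [gap, Finset.sum_sub_distrib]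
  rfl

theorem le_cols (J : Cols N (2 * N)) (i : Fin N) : (i : ℕ) ≤ J.1 i := by
  obtain ⟨i, hi⟩ := i
  induction i with
  | zero => exact Nat.zero_le _
  | succ i ih =>
    have h1 := ih (by omega)
    have h2 : J.1 ⟨i, by omega⟩ < J.1 ⟨i + 1, hi⟩ := J.2 (by simp)
    have h3 : (J.1 ⟨i, by omega⟩ : ℕ) < J.1 ⟨i + 1, hi⟩ := h2
    simp only at h1 ⊢
    omega

theorem cols_sub_le (J : Cols N (2 * N)) (i : Fin N) (hN : N - 1 < N) :
    (J.1 i : ℕ) + (N - 1) ≤ J.1 ⟨N - 1, hN⟩ + i := by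
  obtain ⟨k, hk⟩ : ∃ k, (i : ℕ) + k = N - 1 := ⟨N - 1 - i, by omega⟩
  induction k generalizing i with
  | zero =>
    have : i = ⟨N - 1, hN⟩ := Fin.ext (by simp only; omega)
    rw [this]
  | succ k ih =>
    have h1 := ih ⟨i + 1, by omega⟩ (by simp only; omega)
    have h2 : J.1 i < J.1 ⟨i + 1, by omega⟩ := J.2 (by rw [Fin.lt_def]; simp)
    have h3 : (J.1 i : ℕ) < J.1 ⟨i + 1, by omega⟩ := h2
    simp only at h1
    omega

theorem gap_nextCols (hN : 0 < N) : gap (nextCols N) = 1 := by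
  rw [gap_eq_sum, Finset.sum_eq_single (⟨N - 1, by omega⟩ : Fin N)]
  · rw [nextCols_val, if_pos (by simp only; omega)]
    simp only
    omega
  · intro i _ hi
    have : (i : ℕ) ≠ N - 1 := fun h => hi (Fin.ext h)
    rw [nextCols_val, if_neg (by omega), sub_self]
  · simp

/-- The excess J_i - i is largest at the last index, so a total excess of at most 1 is concentrated
in the last column. -/
theorem two_le_gap (hN : 0 < N) {J : Cols N (2 * N)} (h1 : J ≠ firstCols N) (h2 : J ≠ nextCols N) :
    2 ≤ gap J := by
  have hlast : N - 1 < N := by omega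
  have hnn : ∀ i ∈ (univ : Finset (Fin N)), (0 : ℤ) ≤ ((J.1 i : ℕ) : ℤ) - (i : ℕ) := by
    intro i _
    have := le_cols J i
    omega
  have hle : ∀ i, (((J.1 i : ℕ) : ℤ) - (i : ℕ)) ≤ ((J.1 ⟨N - 1, hlast⟩ : ℕ) : ℤ) - (N - 1 : ℕ) := by
    intro i
    have := cols_sub_le J i hlast
    omega
  have hsplit : gap J = (((J.1 ⟨N - 1, hlast⟩ : ℕ) : ℤ) - (N - 1 : ℕ))
      + ∑ i ∈ univ.erase (⟨N - 1, hlast⟩ : Fin N), (((J.1 i : ℕ) : ℤ) - (i : ℕ)) := by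
    rw [gap_eq_sum, ← Finset.add_sum_erase _ _ (mem_univ (⟨N - 1, hlast⟩ : Fin N))]
  have hrest : 0 ≤ ∑ i ∈ univ.erase (⟨N - 1, hlast⟩ : Fin N), (((J.1 i : ℕ) : ℤ) - (i : ℕ)) :=
    Finset.sum_nonneg fun i _ => hnn i (mem_univ i)
  by_contra hlt
  have hz : ∀ i, i ≠ ⟨N - 1, hlast⟩ → (J.1 i : ℕ) = i := by
    intro i hi
    by_contra hne
    have h3 := le_cols J i
    have h4 := hle i
    have h5 := Finset.single_le_sum (f := fun i : Fin N => ((J.1 i : ℕ) : ℤ) - (i : ℕ))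
      (fun i _ => hnn i (mem_univ i)) (mem_erase.2 ⟨hi, mem_univ i⟩)
    omega
  rcases eq_or_ne ((J.1 ⟨N - 1, hlast⟩ : ℕ)) (N - 1) with h | h
  · refine h1 (Subtype.ext (funext fun i => Fin.ext ?_))
    rw [firstCols_val]
    by_cases hi : i = ⟨N - 1, hlast⟩
    · rw [hi, h]
    · exact hz i hi
  · refine h2 (Subtype.ext (funext fun i => Fin.ext ?_))
    rw [nextCols_val]
    by_cases hi : i = ⟨N - 1, hlast⟩
    · rw [hi, if_pos (by simp only; omega)]
      have := hnn ⟨N - 1, hlast⟩ (mem_univ _)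
      simp only at this
      omega
    · rw [hz i hi, if_neg]
      intro h'
      exact hi (Fin.ext (by simp only; omega))

theorem gap_nonneg (J : Cols N (2 * N)) : 0 ≤ gap J := by
  rw [gap_eq_sum]
  refine Finset.sum_nonneg fun i _ => ?_
  have := le_cols J i
  omega

end KPLump
end

noncomputable section
namespace KPLump
open Finset Filter Asymptotics Topology

variable {N : ℕ}

/-! ### Derivatives in the real direction -/

/-- The derivative in the real direction. -/
def xDeriv (f : ℂ → ℂ) (w : ℂ) : ℂ := deriv (fun x : ℝ => f (w + x)) 0

theorem HasLead.xDeriv {z : ℤ} {v : ℂ} {f : ℂ → ℂ} (h : HasLead z v f) :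
    HasLead (z - 1) (v * z) (xDeriv f) ∧
      ∀ w, HasDerivAt (fun x : ℝ => f (w + x)) (KPLump.xDeriv f w) 0 := by
  obtain ⟨f', h1, h2⟩ := h.exists_derivative
  have : KPLump.xDeriv f = f' := funext fun w => (h2 w).deriv
  rw [this]
  exact ⟨h1, h2⟩

/-- `z (z - 1) ⋯ (z - k + 1)`. -/
def fall (z : ℤ) (k : ℕ) : ℂ := ∏ i ∈ range k, ((z : ℂ) - i)

/-- The derivatives of the position minors. -/
def posDer (k : ℕ) (D J : Cols N (2 * N)) : ℂ → ℂ := KPLump.xDeriv^[k] (posMinor D J)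

/-- An excess of one in the columns costs one degree exactly as a derivative does, so `gap J + k`
measures the order of smallness of all values and derivatives together. -/
theorem hasLead_posDer (k : ℕ) (D J : Cols N (2 * N)) :
    HasLead (expX D - gap J - k) (leadMinor D.1 J.1 * fall (expX D - gap J) k) (posDer k D J) := by
  induction k with
  | zero =>
    have h := hasLead_posMinor D J
    have e : ∑ i, ((D.1 i : ℕ) : ℤ) - ∑ i, ((J.1 i : ℕ) : ℤ) = expX D - gap J := by
      rw [expX, gap]
      ring
    rw [e] at h
    simpa [fall, posDer] using h
  | succ k ih =>
    have h := ih.xDeriv.1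
    rw [posDer, Function.iterate_succ_apply', ← posDer]
    convert h using 1
    · push_cast
      ring
    · rw [fall, fall, Finset.prod_range_succ]
      push_cast
      ring

theorem hasDerivAt_posDer (k : ℕ) (D J : Cols N (2 * N)) (w : ℂ) :
    HasDerivAt (fun x : ℝ => posDer k D J (w + x)) (posDer (k + 1) D J w) 0 := by
  have := (hasLead_posDer k D J).xDeriv.2 w
  rw [posDer, posDer, Function.iterate_succ_apply']
  exact this

/-- The derivatives of the Schur minors. -/
def minorDer (k : ℕ) (a : Fin N → ℕ → ℂ) (τ : ℝ) (J : Cols N (2 * N)) (w : ℂ) : ℂ :=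
  ((2 : ℂ) ^ (∑ i, (J.1 i : ℕ)))⁻¹ * ∑ D : Cols N (2 * N), timeMinor a τ D * posDer k D J w

theorem minorDer_zero (a : Fin N → ℕ → ℂ) (τ : ℝ) (J : Cols N (2 * N)) (w : ℂ) :
    minorDer 0 a τ J w = schurMinor a τ J w := rfl

theorem hasDerivAt_minorDer (k : ℕ) (a : Fin N → ℕ → ℂ) (J : Cols N (2 * N)) (x y t : ℝ) :
    HasDerivAt (fun ξ : ℝ => minorDer k a (slow t) J (pos ξ y t))
      (minorDer (k + 1) a (slow t) J (pos x y t)) x := by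
  have h1 : HasDerivAt (fun ξ : ℝ => minorDer k a (slow t) J (pos x y t + (ξ : ℝ)))
      (minorDer (k + 1) a (slow t) J (pos x y t)) (x - x) := by
    rw [sub_self]
    refine HasDerivAt.const_mul _ (HasDerivAt.fun_sum fun D _ => HasDerivAt.const_mul _ ?_)
    exact hasDerivAt_posDer k D J _
  have h2 : (fun ξ : ℝ => minorDer k a (slow t) J (pos ξ y t))
      = fun ξ : ℝ => minorDer k a (slow t) J (pos x y t + ((ξ - x : ℝ) : ℂ)) := by
    funext ξ
    congr 1
    simp only [pos]
    push_cast
    ring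
  rw [h2]
  exact h1.comp_sub_const x x

/-! ### The solution in terms of the minors -/

/-- A sum of squared moduli of complex functions, in terms of the values `q J k` of the functions
and their derivatives of order `k`. -/
def sq0 {ι : Type*} [Fintype ι] (q : ι → ℕ → ℂ) : ℝ := ∑ J, ((q J 0).re ^ 2 + (q J 0).im ^ 2)

/-- The first derivative of `sq0`. -/
def sq1 {ι : Type*} [Fintype ι] (q : ι → ℕ → ℂ) : ℝ :=
  ∑ J, 2 * ((q J 0).re * (q J 1).re + (q J 0).im * (q J 1).im)

/-- The second derivative of `sq0`. -/
def sq2 {ι : Type*} [Fintype ι] (q : ι → ℕ → ℂ) : ℝ :=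
  ∑ J, 2 * ((q J 1).re ^ 2 + (q J 1).im ^ 2 + (q J 0).re * (q J 2).re + (q J 0).im * (q J 2).im)

/-- `2 ∂ₓ² ln σ` in terms of `σ` and its derivatives. -/
def logSecond {ι : Type*} [Fintype ι] (q : ι → ℕ → ℂ) : ℝ :=
  2 * ((sq2 q * sq0 q - sq1 q ^ 2) / sq0 q ^ 2)

/-- The values and derivatives of all Schur minors. -/
def jet (a : Fin N → ℕ → ℂ) (x y t : ℝ) (J : Cols N (2 * N)) (k : ℕ) : ℂ :=
  minorDer k a (slow t) J (pos x y t)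

theorem sq0_jet (a : Fin N → ℕ → ℂ) (x y t : ℝ) :
    (sigma (oddIndex N) a x y t).re = sq0 (jet a x y t) := by
  rw [sigma_re_eq, sq0]
  refine Finset.sum_congr rfl fun J _ => ?_
  rw [Complex.normSq_apply, jet, minorDer_zero]
  ring

theorem hasDerivAt_re {f : ℝ → ℂ} {f' : ℂ} {x : ℝ} (h : HasDerivAt f f' x) :
    HasDerivAt (fun ξ => (f ξ).re) f'.re x :=
  Complex.reCLM.hasFDerivAt.comp_hasDerivAt x h

theorem hasDerivAt_im {f : ℝ → ℂ} {f' : ℂ} {x : ℝ} (h : HasDerivAt f f' x) :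
    HasDerivAt (fun ξ => (f ξ).im) f'.im x :=
  Complex.imCLM.hasFDerivAt.comp_hasDerivAt x h

theorem hasDerivAt_jet (a : Fin N → ℕ → ℂ) (x y t : ℝ) (J : Cols N (2 * N)) (k : ℕ) :
    HasDerivAt (fun ξ => jet a ξ y t J k) (jet a x y t J (k + 1)) x :=
  hasDerivAt_minorDer k a J x y t

theorem hasDerivAt_sq0 (a : Fin N → ℕ → ℂ) (x y t : ℝ) :
    HasDerivAt (fun ξ => sq0 (jet a ξ y t)) (sq1 (jet a x y t)) x := by
  refine HasDerivAt.fun_sum fun J _ => ?_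
  have h1 := (hasDerivAt_re (hasDerivAt_jet a x y t J 0)).pow 2
  have h2 := (hasDerivAt_im (hasDerivAt_jet a x y t J 0)).pow 2
  refine (h1.add h2).congr_deriv ?_
  simp
  ring

theorem hasDerivAt_sq1 (a : Fin N → ℕ → ℂ) (x y t : ℝ) :
    HasDerivAt (fun ξ => sq1 (jet a ξ y t)) (sq2 (jet a x y t)) x := by
  refine HasDerivAt.fun_sum fun J _ => ?_
  have h1 := hasDerivAt_re (hasDerivAt_jet a x y t J 0)
  have h2 := hasDerivAt_im (hasDerivAt_jet a x y t J 0)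
  have h3 := hasDerivAt_re (hasDerivAt_jet a x y t J 1)
  have h4 := hasDerivAt_im (hasDerivAt_jet a x y t J 1)
  refine (((h1.mul h3).add (h2.mul h4)).const_mul 2).congr_deriv ?_
  simp only [Nat.reduceAdd]
  ring

theorem higherLump_eq (a : Fin N → ℕ → ℂ) (x y t : ℝ) (h : sq0 (jet a x y t) ≠ 0) :
    higherLump (oddIndex N) a x y t = logSecond (jet a x y t) := by
  have hlog : ∀ ξ : ℝ, sq0 (jet a ξ y t) ≠ 0 →
      deriv (fun ξ : ℝ => Real.log (sq0 (jet a ξ y t))) ξ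
        = sq1 (jet a ξ y t) / sq0 (jet a ξ y t) := fun ξ hξ =>
    ((hasDerivAt_sq0 a ξ y t).log hξ).deriv
  have hev : deriv (fun ξ : ℝ => Real.log (sq0 (jet a ξ y t))) =ᶠ[𝓝 x]
      fun ξ => sq1 (jet a ξ y t) / sq0 (jet a ξ y t) := by
    have hc := (hasDerivAt_sq0 a x y t).continuousAt
    filter_upwards [hc.eventually_ne h] with ξ hξ using hlog ξ hξ
  rw [higherLump, logSecond]
  simp only [sq0_jet]
  have h2 : deriv (fun ξ => sq1 (jet a ξ y t) / sq0 (jet a ξ y t)) x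
      = (sq2 (jet a x y t) * sq0 (jet a x y t) - sq1 (jet a x y t) * sq1 (jet a x y t))
        / sq0 (jet a x y t) ^ 2 := ((hasDerivAt_sq1 a x y t).fun_div (hasDerivAt_sq0 a x y t) h).deriv
  rw [iteratedDeriv_succ, iteratedDeriv_one, hev.deriv_eq, h2]
  ring

/-! ### Regions without lumps -/

/-- With C minors and ρ² = σ, the first and second derivatives of σ are at most 2Cε ρ² and 4Cε ρ²;
the constant follows with ε² ≤ ε. -/
theorem abs_logSecond_le {ι : Type*} [Fintype ι] {q : ι → ℕ → ℂ} {j : ι} {ε : ℝ} (hε : ε ≤ 1)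
    (hj : q j 0 ≠ 0) (h1 : ∀ J, ‖q J 1‖ ≤ ε * ‖q j 0‖) (h2 : ∀ J, ‖q J 2‖ ≤ ε * ‖q j 0‖) :
    sq0 q ≠ 0 ∧ |logSecond q| ≤ 8 * (Fintype.card ι + (Fintype.card ι : ℝ) ^ 2) * ε := by
  have hsq : ∀ z : ℂ, z.re ^ 2 + z.im ^ 2 = ‖z‖ ^ 2 := fun z => by
    rw [← Complex.normSq_eq_norm_sq, Complex.normSq_apply]
    ring
  have hle : ∀ J, ‖q J 0‖ ^ 2 ≤ sq0 q := fun J => by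
    simp only [sq0, hsq]
    exact Finset.single_le_sum (f := fun J => ‖q J 0‖ ^ 2) (fun _ _ => by positivity) (mem_univ J)
  have hpos : 0 < sq0 q := lt_of_lt_of_le (by positivity) (hle j)
  refine ⟨hpos.ne', ?_⟩
  set ρ := Real.sqrt (sq0 q) with hρ
  have hρ2 : ρ ^ 2 = sq0 q := Real.sq_sqrt hpos.le
  have hρ0 : 0 < ρ := Real.sqrt_pos.2 hpos
  have hq : ∀ J, ‖q J 0‖ ≤ ρ := fun J => Real.le_sqrt_of_sq_le (hle J)
  have hε0 : 0 ≤ ε := by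
    have := (norm_nonneg _).trans (h1 j)
    exact nonneg_of_mul_nonneg_left this (norm_pos_iff.2 hj)
  have h1' : ∀ J, ‖q J 1‖ ≤ ε * ρ := fun J => (h1 J).trans (by gcongr; exact hq j)
  have h2' : ∀ J, ‖q J 2‖ ≤ ε * ρ := fun J => (h2 J).trans (by gcongr; exact hq j)
  have hip : ∀ z z' : ℂ, |z.re * z'.re + z.im * z'.im| ≤ ‖z‖ * ‖z'‖ := fun z z' => by
    have : z.re * z'.re + z.im * z'.im = (conj z * z').re := by simp
    rw [this]
    refine (Complex.abs_re_le_norm _).trans ?_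
    rw [norm_mul, Complex.norm_conj]
  set C : ℝ := ((Fintype.card ι : ℕ) : ℝ) with hC
  have hS1 : |sq1 q| ≤ 2 * C * ε * ρ ^ 2 := by
    calc |sq1 q| ≤ ∑ J : ι, 2 * (ρ * (ε * ρ)) := by
          refine (Finset.abs_sum_le_sum_abs _ _).trans (Finset.sum_le_sum fun J _ => ?_)
          rw [abs_mul, abs_two]
          gcongr
          exact (hip _ _).trans (mul_le_mul (hq J) (h1' J) (norm_nonneg _) hρ0.le)
      _ = _ := by
          rw [Finset.sum_const, Finset.card_univ, nsmul_eq_mul]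
          ring
  have hS2 : |sq2 q| ≤ 4 * C * ε * ρ ^ 2 := by
    calc |sq2 q| ≤ ∑ J : ι, 2 * (ε * ρ ^ 2 + ρ * (ε * ρ)) := by
          refine (Finset.abs_sum_le_sum_abs _ _).trans (Finset.sum_le_sum fun J _ => ?_)
          rw [abs_mul, abs_two, add_assoc, hsq]
          gcongr
          refine (abs_add_le _ _).trans (add_le_add ?_ ?_)
          · rw [abs_of_nonneg (by positivity)]
            calc ‖q J 1‖ ^ 2 ≤ (ε * ρ) ^ 2 := by gcongr; exact h1' J
              _ = ε * (ε * ρ ^ 2) := by ring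
              _ ≤ 1 * (ε * ρ ^ 2) := by gcongr
              _ = _ := one_mul _
          · exact (hip _ _).trans (mul_le_mul (hq J) (h2' J) (norm_nonneg _) hρ0.le)
      _ = _ := by
          rw [Finset.sum_const, Finset.card_univ, nsmul_eq_mul]
          ring
  rw [logSecond, ← hρ2, abs_mul, abs_two, abs_div, abs_of_pos (by positivity : 0 < (ρ ^ 2) ^ 2)]
  have hC0 : 0 ≤ C := Nat.cast_nonneg _
  have hnum : |sq2 q * ρ ^ 2 - sq1 q ^ 2| ≤ (4 * C * ε + 4 * C ^ 2 * ε) * (ρ ^ 2) ^ 2 := by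
    calc |sq2 q * ρ ^ 2 - sq1 q ^ 2| ≤ |sq2 q| * ρ ^ 2 + |sq1 q| ^ 2 := by
          refine (abs_sub _ _).trans ?_
          rw [abs_mul, abs_pow (sq1 q), abs_of_pos (by positivity : 0 < ρ ^ 2)]
      _ ≤ (4 * C * ε * ρ ^ 2) * ρ ^ 2 + (2 * C * ε * ρ ^ 2) ^ 2 := by gcongr
      _ = (4 * C * ε + 4 * C ^ 2 * (ε * ε)) * (ρ ^ 2) ^ 2 := by ring
      _ ≤ (4 * C * ε + 4 * C ^ 2 * (1 * ε)) * (ρ ^ 2) ^ 2 := by gcongr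
      _ = _ := by ring
  calc 2 * (|sq2 q * ρ ^ 2 - sq1 q ^ 2| / (ρ ^ 2) ^ 2) ≤ 2 * (4 * C * ε + 4 * C ^ 2 * ε) := by
        gcongr
        rwa [div_le_iff₀ (by positivity)]
    _ = _ := by ring

/-- Where the first minor dominates all derivatives, the solution tends to zero. -/
theorem tendsto_higherLump_zero {α : Type*} {l : Filter α} {a : Fin N → ℕ → ℂ} {x y t : α → ℝ}
    {μ : α → ℂ} (hμ : μ =O[l] fun i => jet a (x i) (y i) (t i) (firstCols N) 0)
    (h0 : ∀ᶠ i in l, μ i ≠ 0)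
    (h : ∀ J, ∀ k ∈ ({1, 2} : Finset ℕ), (fun i => jet a (x i) (y i) (t i) J k) =o[l] μ) :
    Tendsto (fun i => higherLump (oddIndex N) a (x i) (y i) (t i)) l (𝓝 0) := by
  rw [Metric.tendsto_nhds]
  intro δ hδ
  set C : ℝ := 8 * (Fintype.card (Cols N (2 * N)) + (Fintype.card (Cols N (2 * N)) : ℝ) ^ 2) with hC
  have hC0 : 0 ≤ C := by positivity
  obtain ⟨ε, hε0, hε1, hε⟩ : ∃ ε : ℝ, 0 < ε ∧ ε ≤ 1 ∧ C * ε < δ := by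
    refine ⟨min 1 (δ / (2 * (C + 1))), by positivity, min_le_left _ _, ?_⟩
    calc C * min 1 (δ / (2 * (C + 1))) ≤ C * (δ / (2 * (C + 1))) := by
          gcongr
          exact min_le_right _ _
      _ ≤ δ / 2 := by
          rw [mul_div_assoc', div_le_div_iff₀ (by positivity) (by positivity)]
          nlinarith
      _ < δ := by linarith
  have hall : ∀ᶠ i in l, ∀ J, ∀ k ∈ ({1, 2} : Finset ℕ),
      ‖jet a (x i) (y i) (t i) J k‖ ≤ ε * ‖jet a (x i) (y i) (t i) (firstCols N) 0‖ := by
    rw [Filter.eventually_all]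
    intro J
    rw [Finset.eventually_all]
    intro k hk
    exact ((h J k hk).trans_isBigO hμ).def hε0
  have hne : ∀ᶠ i in l, jet a (x i) (y i) (t i) (firstCols N) 0 ≠ 0 := by
    obtain ⟨c, hc⟩ := hμ.bound
    filter_upwards [hc, h0] with i hi h0 h1
    rw [h1, norm_zero, mul_zero] at hi
    exact h0 (norm_le_zero_iff.1 hi)
  filter_upwards [hall, hne] with i hi h1
  obtain ⟨h2, h3⟩ := abs_logSecond_le hε1 h1 (fun J => hi J 1 (by simp)) fun J => hi J 2 (by simp)
  rw [higherLump_eq _ _ _ _ h2, Real.dist_eq, sub_zero]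
  exact h3.trans_lt hε

end KPLump
end

noncomputable section
namespace KPLump
open Finset Filter Asymptotics Topology

/-! ### The solution near a lump -/

/-- `f` is bounded and agrees with `f'` up to `O(g)`. -/
def Near {α : Type*} (l : Filter α) (g f f' : α → ℝ) : Prop :=
  f' =O[l] (fun _ => (1 : ℝ)) ∧ (fun i => f i - f' i) =O[l] g

section Near

variable {α : Type*} {l : Filter α} {g f f' h h' : α → ℝ}

theorem Near.add (hf : Near l g f f') (hh : Near l g h h') :
    Near l g (fun i => f i + h i) fun i => f' i + h' i := by
  refine ⟨hf.1.add hh.1, (hf.2.add hh.2).congr_left fun i => ?_⟩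
  ring

theorem Near.sub (hf : Near l g f f') (hh : Near l g h h') :
    Near l g (fun i => f i - h i) fun i => f' i - h' i := by
  refine ⟨hf.1.sub hh.1, (hf.2.sub hh.2).congr_left fun i => ?_⟩
  ring

theorem Near.const_mul (c : ℝ) (hf : Near l g f f') :
    Near l g (fun i => c * f i) fun i => c * f' i := by
  refine ⟨hf.1.const_mul_left c, (hf.2.const_mul_left c).congr_left fun i => ?_⟩
  ring

theorem Near.isBigO_one (hg : g =O[l] fun _ => (1 : ℝ)) (hf : Near l g f f') :
    f =O[l] fun _ => (1 : ℝ) :=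
  ((hf.2.trans hg).add hf.1).congr_left fun i => by ring

theorem Near.mul (hg : g =O[l] fun _ => (1 : ℝ)) (hf : Near l g f f') (hh : Near l g h h') :
    Near l g (fun i => f i * h i) fun i => f' i * h' i := by
  refine ⟨by simpa using hf.1.mul hh.1, ?_⟩
  have h1 := hf.2.mul (hh.isBigO_one hg)
  have h2 := hf.1.mul hh.2
  simp only [mul_one, one_mul] at h1 h2
  refine (h1.add h2).congr_left fun i => ?_
  ring

theorem Near.sum {ι : Type*} {s : Finset ι} {f f' : ι → α → ℝ}
    (hf : ∀ j ∈ s, Near l g (f j) (f' j)) :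
    Near l g (fun i => ∑ j ∈ s, f j i) fun i => ∑ j ∈ s, f' j i := by
  refine ⟨IsBigO.fun_sum fun j hj => (hf j hj).1, ?_⟩
  simp only [← Finset.sum_sub_distrib]
  exact IsBigO.fun_sum fun j hj => (hf j hj).2

theorem Near.re {f f' : α → ℂ} (h1 : f' =O[l] fun _ => (1 : ℝ)) (h2 : (fun i => f i - f' i) =O[l] g) :
    Near l g (fun i => (f i).re) fun i => (f' i).re :=
  ⟨(isBigO_of_le l fun i => by simpa using Complex.abs_re_le_norm (f' i)).trans h1,
    (isBigO_of_le l fun i => by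
      simpa using Complex.abs_re_le_norm (f i - f' i)).trans h2⟩

theorem Near.im {f f' : α → ℂ} (h1 : f' =O[l] fun _ => (1 : ℝ)) (h2 : (fun i => f i - f' i) =O[l] g) :
    Near l g (fun i => (f i).im) fun i => (f' i).im :=
  ⟨(isBigO_of_le l fun i => by simpa using Complex.abs_im_le_norm (f' i)).trans h1,
    (isBigO_of_le l fun i => by
      simpa using Complex.abs_im_le_norm (f i - f' i)).trans h2⟩

theorem Near.div (hg : Tendsto g l (𝓝 0)) (hf : Near l g f f') (hh : Near l g h h') {c : ℝ}
    (hc : 0 < c) (hpos : ∀ i, c ≤ h' i) :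
    Near l g (fun i => f i / h i) fun i => f' i / h' i := by
  have hg1 : g =O[l] fun _ => (1 : ℝ) := hg.isBigO_one ℝ
  have hi' : (fun i => (h' i)⁻¹) =O[l] fun _ => (1 : ℝ) := by
    refine IsBigO.of_bound c⁻¹ (Eventually.of_forall fun i => ?_)
    have := hpos i
    rw [norm_inv, Real.norm_eq_abs, abs_of_pos (by linarith), norm_one, mul_one]
    gcongr
  have hev : ∀ᶠ i in l, c / 2 ≤ h i := by
    have := (hh.2.trans_tendsto hg).eventually (lt_mem_nhds (by linarith : -(c / 2) < 0))
    filter_upwards [this] with i hi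
    have := hpos i
    linarith
  have hi : (fun i => (h i)⁻¹) =O[l] fun _ => (1 : ℝ) := by
    refine IsBigO.of_bound (c / 2)⁻¹ ?_
    filter_upwards [hev] with i hi
    rw [norm_inv, Real.norm_eq_abs, abs_of_pos (by linarith), norm_one, mul_one]
    gcongr
  have hinv : Near l g (fun i => (h i)⁻¹) fun i => (h' i)⁻¹ := by
    refine ⟨hi', ?_⟩
    have h1 := (hi.mul hi').mul hh.2
    simp only [mul_one, one_mul] at h1
    refine h1.neg_left.congr' ?_ EventuallyEq.rfl
    filter_upwards [hev] with i hi
    have h2 : h i ≠ 0 := by linarith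
    have h3 : h' i ≠ 0 := by have := hpos i; linarith
    field_simp
    ring
  simpa only [div_eq_mul_inv] using hf.mul hg1 hinv

end Near

/-- The values and derivatives in the linear model of a lump. -/
def lumpModel {ι : Type*} [DecidableEq ι] (j₀ j₁ : ι) (ζ : ℂ) (J : ι) (k : ℕ) : ℂ :=
  if J = j₀ then (if k = 0 then ζ else if k = 1 then 1 else 0)
  else if J = j₁ ∧ k = 0 then 1 / 2 else 0

section Model

variable {ι : Type*} [Fintype ι] [DecidableEq ι] {j₀ j₁ : ι}

/-- All sums over the model have just two nonzero terms; a generic summand `Q` treats σ and both of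
its derivatives at once. -/
theorem sum_lumpModel (hj : j₀ ≠ j₁) (ζ : ℂ) (Q : ℂ → ℂ → ℂ → ℝ) (h0 : Q 0 0 0 = 0) :
    ∑ J, Q (lumpModel j₀ j₁ ζ J 0) (lumpModel j₀ j₁ ζ J 1) (lumpModel j₀ j₁ ζ J 2)
      = Q ζ 1 0 + Q (1 / 2) 0 0 := by
  have h : ∀ J ∉ ({j₀, j₁} : Finset ι),
      Q (lumpModel j₀ j₁ ζ J 0) (lumpModel j₀ j₁ ζ J 1) (lumpModel j₀ j₁ ζ J 2) = 0 := by
    intro J hJ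
    simp only [mem_insert, mem_singleton, not_or] at hJ
    simp [lumpModel, hJ.1, hJ.2, h0]
  rw [← Finset.sum_subset (subset_univ ({j₀, j₁} : Finset ι)) fun J _ hJ => h J hJ,
    Finset.sum_pair hj]
  simp [lumpModel, hj.symm]

theorem sq0_lumpModel (hj : j₀ ≠ j₁) (ζ : ℂ) :
    sq0 (lumpModel j₀ j₁ ζ) = ζ.re ^ 2 + ζ.im ^ 2 + 1 / 4 := by
  rw [sq0, sum_lumpModel hj ζ (fun u _ _ => u.re ^ 2 + u.im ^ 2) (by simp)]
  norm_num

theorem sq1_lumpModel (hj : j₀ ≠ j₁) (ζ : ℂ) : sq1 (lumpModel j₀ j₁ ζ) = 2 * ζ.re := by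
  rw [sq1, sum_lumpModel hj ζ (fun u v _ => 2 * (u.re * v.re + u.im * v.im)) (by simp)]
  simp

theorem sq2_lumpModel (hj : j₀ ≠ j₁) (ζ : ℂ) : sq2 (lumpModel j₀ j₁ ζ) = 2 := by
  rw [sq2, sum_lumpModel hj ζ
    (fun u v v' => 2 * (v.re ^ 2 + v.im ^ 2 + u.re * v'.re + u.im * v'.im)) (by simp)]
  simp

/-- The model has σ = |ζ|² + 1/4, a quarter of the denominator base of the fundamental lump. The
shift in y is half the imaginary part because the complex coordinate contains 2iy. -/
theorem logSecond_lumpModel (hj : j₀ ≠ j₁) (x y t : ℝ) (w : ℂ) :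
    logSecond (lumpModel j₀ j₁ (pos x y t - w)) = fundLump (x - w.re) (y - w.im / 2) t := by
  rw [logSecond, sq0_lumpModel hj, sq1_lumpModel hj, sq2_lumpModel hj, fundLump]
  have h1 : (pos x y t - w).re = x - 12 * t - w.re := by simp [pos]
  have h2 : (pos x y t - w).im = 2 * y - w.im := by simp [pos]
  rw [h1, h2]
  have h3 : (x - 12 * t - w.re) ^ 2 + (2 * y - w.im) ^ 2 + 1 / 4 ≠ 0 := by positivity
  have h4 : 1 + 4 * (x - w.re - 12 * t) ^ 2 + 16 * (y - w.im / 2) ^ 2 ≠ 0 := by positivity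
  have h5 : 1 + 4 * (x - w.re - 12 * t) ^ 2 + 16 * (y - w.im / 2) ^ 2
      = 4 * ((x - 12 * t - w.re) ^ 2 + (2 * y - w.im) ^ 2 + 1 / 4) := by ring
  rw [h5]
  field_simp
  ring

theorem sq_mul {ι : Type*} [Fintype ι] (A : ℂ) (q : ι → ℕ → ℂ) :
    sq0 (fun J k => A * q J k) = Complex.normSq A * sq0 q ∧
    sq1 (fun J k => A * q J k) = Complex.normSq A * sq1 q ∧
    sq2 (fun J k => A * q J k) = Complex.normSq A * sq2 q := by
  simp only [sq0, sq1, sq2, Finset.mul_sum, Complex.normSq_apply, Complex.mul_re, Complex.mul_im]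
  refine ⟨?_, ?_, ?_⟩ <;> refine Finset.sum_congr rfl fun J _ => ?_ <;> ring

/-- A common factor independent of x disappears in the second logarithmic derivative, so the minors
may be normalised. -/
theorem logSecond_mul {ι : Type*} [Fintype ι] {A : ℂ} (hA : A ≠ 0) (q : ι → ℕ → ℂ) :
    logSecond (fun J k => A * q J k) = logSecond q := by
  obtain ⟨h0, h1, h2⟩ := sq_mul A q
  have h : Complex.normSq A ≠ 0 := by simpa using hA
  rw [logSecond, logSecond, h0, h1, h2]
  congr 1
  rw [show Complex.normSq A * sq2 q * (Complex.normSq A * sq0 q) - (Complex.normSq A * sq1 q) ^ 2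
    = Complex.normSq A ^ 2 * (sq2 q * sq0 q - sq1 q ^ 2) by ring, mul_pow,
    mul_div_mul_left _ _ (pow_ne_zero 2 h)]

variable {α : Type*} {l : Filter α} {g : α → ℝ} {ζ : α → ℂ}

/-- The derivatives of σ are polynomial in bounded quantities, and the final division is harmless
because the model σ is at least 1/4. -/
theorem isBigO_logSecond_sub (hj : j₀ ≠ j₁) (hg : Tendsto g l (𝓝 0))
    (hζ : ζ =O[l] fun _ => (1 : ℝ)) {q : α → ι → ℕ → ℂ}
    (hq : ∀ J, ∀ k ≤ 2, (fun i => q i J k - lumpModel j₀ j₁ (ζ i) J k) =O[l] g) :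
    (∀ᶠ i in l, sq0 (q i) ≠ 0) ∧
      (fun i => logSecond (q i) - logSecond (lumpModel j₀ j₁ (ζ i))) =O[l] g := by
  have hg1 : g =O[l] fun _ => (1 : ℝ) := hg.isBigO_one ℝ
  have hm : ∀ J k, (fun i => lumpModel j₀ j₁ (ζ i) J k) =O[l] fun _ => (1 : ℝ) := by
    intro J k
    unfold lumpModel
    split_ifs
    · exact hζ
    all_goals exact isBigO_const_const _ one_ne_zero _
  have hre := fun J k hk => Near.re (hm J k) (hq J k hk)
  have him := fun J k hk => Near.im (hm J k) (hq J k hk)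
  have n0 : Near l g (fun i => sq0 (q i)) fun i => sq0 (lumpModel j₀ j₁ (ζ i)) := by
    refine Near.sum fun J _ => ?_
    simp only [pow_two]
    exact ((hre J 0 (by simp)).mul hg1 (hre J 0 (by simp))).add
      ((him J 0 (by simp)).mul hg1 (him J 0 (by simp)))
  have n1 : Near l g (fun i => sq1 (q i)) fun i => sq1 (lumpModel j₀ j₁ (ζ i)) :=
    Near.sum fun J _ => Near.const_mul 2 <|
      ((hre J 0 (by simp)).mul hg1 (hre J 1 (by simp))).add
        ((him J 0 (by simp)).mul hg1 (him J 1 (by simp)))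
  have n2 : Near l g (fun i => sq2 (q i)) fun i => sq2 (lumpModel j₀ j₁ (ζ i)) := by
    refine Near.sum fun J _ => Near.const_mul 2 ?_
    simp only [pow_two]
    exact ((((hre J 1 (by simp)).mul hg1 (hre J 1 (by simp))).add
      ((him J 1 (by simp)).mul hg1 (him J 1 (by simp)))).add
        ((hre J 0 (by simp)).mul hg1 (hre J 2 (by simp)))).add
        ((him J 0 (by simp)).mul hg1 (him J 2 (by simp)))
  have hpos : ∀ i, 1 / 4 ≤ sq0 (lumpModel j₀ j₁ (ζ i)) := fun i => by
    rw [sq0_lumpModel hj]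
    nlinarith [sq_nonneg (ζ i).re, sq_nonneg (ζ i).im]
  constructor
  · have := (n0.2.trans_tendsto hg).eventually (lt_mem_nhds (by norm_num : -(1 / 4 : ℝ) < 0))
    filter_upwards [this] with i hi
    have := hpos i
    have h : 0 < sq0 (q i) := by linarith
    exact h.ne'
  -- The denominator is the square of σ, so its lower bound is 1/16.
  · have h1 := ((n2.mul hg1 n0).sub (n1.mul hg1 n1)).div hg (n0.mul hg1 n0)
      (c := 1 / 16) (by norm_num) fun i => by nlinarith [hpos i]
    have h2 := (h1.const_mul 2).2
    simp only [← pow_two] at h2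
    exact h2

end Model

variable {N : ℕ}

theorem firstCols_ne_nextCols (hN : 0 < N) : firstCols N ≠ nextCols N := fun h => by
  have h1 := gap_firstCols N
  have h2 := gap_nextCols hN
  rw [h] at h1
  omega

/-- If the minors behave as in the linear model, the solution is close to a fundamental lump. -/
theorem isBigO_higherLump_sub_fundLump (hN : 0 < N) {a : Fin N → ℕ → ℂ} {α : Type*} {l : Filter α}
    {x y t g : α → ℝ} {w A : α → ℂ} (hg : Tendsto g l (𝓝 0)) (hA : ∀ᶠ i in l, A i ≠ 0)
    (hw : (fun i => pos (x i) (y i) (t i) - w i) =O[l] fun _ => (1 : ℝ))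
    (hfirst : (fun i => jet a (x i) (y i) (t i) (firstCols N) 0
      - A i * (pos (x i) (y i) (t i) - w i)) =O[l] fun i => g i * ‖A i‖)
    (hfirst' : (fun i => jet a (x i) (y i) (t i) (firstCols N) 1 - A i)
      =O[l] fun i => g i * ‖A i‖)
    (hnext : (fun i => jet a (x i) (y i) (t i) (nextCols N) 0 - A i * (1 / 2))
      =O[l] fun i => g i * ‖A i‖)
    (hrest : ∀ J, ∀ k : ℕ, k ≤ 2 → 2 ≤ gap J + k →
      (fun i => jet a (x i) (y i) (t i) J k) =O[l] fun i => g i * ‖A i‖) :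
    (fun i => higherLump (oddIndex N) a (x i) (y i) (t i)
      - fundLump (x i - (w i).re) (y i - (w i).im / 2) (t i)) =O[l] g := by
  classical
  have hne := firstCols_ne_nextCols hN
  have key : ∀ J, ∀ k : ℕ, k ≤ 2 → (fun i => (A i)⁻¹ * jet a (x i) (y i) (t i) J k
      - lumpModel (firstCols N) (nextCols N) (pos (x i) (y i) (t i) - w i) J k) =O[l] g := by
    intro J k hk
    have h1 : (fun i => jet a (x i) (y i) (t i) J k - A i *
        lumpModel (firstCols N) (nextCols N) (pos (x i) (y i) (t i) - w i) J k)
        =O[l] fun i => g i * ‖A i‖ := by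
      by_cases hJ : J = firstCols N
      · subst hJ
        interval_cases k
        · simpa [lumpModel] using hfirst
        · simpa [lumpModel] using hfirst'
        · simpa [lumpModel] using hrest (firstCols N) 2 le_rfl (by rw [gap_firstCols]; norm_num)
      by_cases hJ1 : J = nextCols N ∧ k = 0
      · obtain ⟨rfl, rfl⟩ := hJ1
        simpa [lumpModel, hJ] using hnext
      -- Only three quantities have order below two: the first minor, its derivative, and the next
      -- minor. They are exactly the nonzero entries of the model.
      · have hgap : 2 ≤ gap J + k := by
          by_cases h2 : J = nextCols N
          · rw [h2, gap_nextCols hN]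
            have : k ≠ 0 := fun h => hJ1 ⟨h2, h⟩
            omega
          · have := two_le_gap hN hJ h2
            omega
        simpa [lumpModel, hJ, hJ1] using hrest J k hk hgap
    have h2 := (isBigO_refl (fun i => (A i)⁻¹) l).norm_right.mul h1
    refine (h2.congr' ?_ EventuallyEq.rfl).trans ?_
    · filter_upwards [hA] with i hi
      rw [mul_sub, inv_mul_cancel_left₀ hi]
    · refine IsBigO.of_bound 1 ?_
      filter_upwards [hA] with i hi
      have : ‖A i‖ ≠ 0 := norm_ne_zero_iff.2 hi
      rw [norm_mul, norm_mul, norm_norm, norm_inv, norm_norm, one_mul, mul_comm ‖g i‖,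
        inv_mul_cancel_left₀ this]
  obtain ⟨h1, h2⟩ := isBigO_logSecond_sub hne hg hw key
  refine h2.congr' ?_ EventuallyEq.rfl
  filter_upwards [h1, hA] with i hi hAi
  have hAi' := inv_ne_zero hAi
  rw [(sq_mul (A i)⁻¹ (jet a (x i) (y i) (t i))).1] at hi
  rw [higherLump_eq _ _ _ _ (right_ne_zero_of_mul hi), logSecond_mul hAi',
    logSecond_lumpModel hne]

end KPLump
end

noncomputable section
namespace KPLump
open Finset Filter Asymptotics Topology

variable {N : ℕ}

/-! ### Uniform expansions on the scale of a ring -/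

/-- The functions `f κ` are bounded by a multiple of `|κ| ^ z` and Lipschitz with such a constant,
uniformly on the ball of radius `B`. -/
def RingBound (B : ℝ) (z : ℤ) (f : ℝ → ℂ → ℂ) : Prop :=
  ∃ K : ℝ, 0 ≤ K ∧ ∀ κ : ℝ, 1 ≤ |κ| → ∀ ω ω' : ℂ, ‖ω‖ ≤ B → ‖ω'‖ ≤ B →
    ‖f κ ω‖ ≤ K * |κ| ^ z ∧ ‖f κ ω - f κ ω'‖ ≤ K * |κ| ^ z * ‖ω - ω'‖

section RingBound

variable {B : ℝ} {z z' : ℤ} {f g : ℝ → ℂ → ℂ}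

theorem RingBound.congr (hf : RingBound B z f)
    (h : ∀ κ : ℝ, 1 ≤ |κ| → ∀ ω, f κ ω = g κ ω) : RingBound B z g := by
  obtain ⟨K, hK, hf⟩ := hf
  refine ⟨K, hK, fun κ hκ ω ω' hω hω' => ?_⟩
  rw [← h κ hκ, ← h κ hκ]
  exact hf κ hκ ω ω' hω hω'

theorem RingBound.mono (hf : RingBound B z f) (h : z ≤ z') : RingBound B z' f := by
  obtain ⟨K, hK, hf⟩ := hf
  refine ⟨K, hK, fun κ hκ ω ω' hω hω' => ?_⟩
  obtain ⟨h1, h2⟩ := hf κ hκ ω ω' hω hω'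
  have h3 : |κ| ^ z ≤ |κ| ^ z' := zpow_le_zpow_right₀ hκ h
  exact ⟨h1.trans (by gcongr), h2.trans (by gcongr)⟩

theorem ringBound_of_bound {h : ℝ → ℂ}
    (H : ∃ K : ℝ, 0 ≤ K ∧ ∀ κ : ℝ, 1 ≤ |κ| → ‖h κ‖ ≤ K * |κ| ^ z) :
    RingBound B z fun κ _ => h κ := by
  obtain ⟨K, hK, H⟩ := H
  refine ⟨K, hK, fun κ hκ ω ω' _ _ => ⟨H κ hκ, ?_⟩⟩
  rw [sub_self, norm_zero]
  positivity

theorem ringBound_const (c : ℂ) : RingBound B 0 fun _ _ => c :=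
  ringBound_of_bound ⟨‖c‖, norm_nonneg _, fun κ _ => by simp⟩

theorem ringBound_zpow (z : ℤ) : RingBound B z fun κ _ => (κ : ℂ) ^ z :=
  ringBound_of_bound ⟨1, zero_le_one, fun κ _ => by simp⟩

theorem ringBound_zero : RingBound B z fun _ _ => 0 :=
  ringBound_of_bound ⟨0, le_rfl, fun κ _ => by simp⟩

theorem ringBound_id : RingBound B 0 fun _ ω => ω := by
  refine ⟨max B 1, by positivity, fun κ hκ ω ω' hω _ => ?_⟩
  rw [zpow_zero, mul_one]
  exact ⟨hω.trans (le_max_left _ _), le_mul_of_one_le_left (norm_nonneg _) (le_max_right _ _)⟩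

theorem ringBound_conj : RingBound B 0 fun _ ω => conj ω := by
  obtain ⟨K, hK, h⟩ := ringBound_id (B := B)
  refine ⟨K, hK, fun κ hκ ω ω' hω hω' => ?_⟩
  rw [← map_sub, Complex.norm_conj, Complex.norm_conj]
  exact h κ hκ ω ω' hω hω'

theorem RingBound.add (hf : RingBound B z f) (hg : RingBound B z g) :
    RingBound B z fun κ ω => f κ ω + g κ ω := by
  obtain ⟨K, hK, hf⟩ := hf
  obtain ⟨L, hL, hg⟩ := hg
  refine ⟨K + L, by positivity, fun κ hκ ω ω' hω hω' => ?_⟩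
  obtain ⟨h1, h2⟩ := hf κ hκ ω ω' hω hω'
  obtain ⟨h3, h4⟩ := hg κ hκ ω ω' hω hω'
  refine ⟨(norm_add_le _ _).trans (by rw [add_mul]; exact add_le_add h1 h3), ?_⟩
  rw [add_sub_add_comm, add_mul, add_mul]
  exact (norm_add_le _ _).trans (add_le_add h2 h4)

theorem RingBound.mul (hf : RingBound B z f) (hg : RingBound B z' g) :
    RingBound B (z + z') fun κ ω => f κ ω * g κ ω := by
  obtain ⟨K, hK, hf⟩ := hf
  obtain ⟨L, hL, hg⟩ := hg
  refine ⟨2 * (K * L), by positivity, fun κ hκ ω ω' hω hω' => ?_⟩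
  obtain ⟨h1, h2⟩ := hf κ hκ ω ω' hω hω'
  obtain ⟨h3, h4⟩ := hg κ hκ ω ω' hω hω'
  obtain ⟨h5, -⟩ := hf κ hκ ω' ω' hω' hω'
  have hκ0 : |κ| ≠ 0 := by linarith
  rw [zpow_add₀ hκ0]
  constructor
  · rw [norm_mul]
    calc ‖f κ ω‖ * ‖g κ ω‖ ≤ (K * |κ| ^ z) * (L * |κ| ^ z') := by gcongr
      _ ≤ (K * |κ| ^ z) * (L * |κ| ^ z') + (K * |κ| ^ z) * (L * |κ| ^ z') :=
        le_add_of_nonneg_left (by positivity)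
      _ = _ := by ring
  · have : f κ ω * g κ ω - f κ ω' * g κ ω'
        = (f κ ω - f κ ω') * g κ ω + f κ ω' * (g κ ω - g κ ω') := by ring
    rw [this]
    calc _ ≤ ‖f κ ω - f κ ω'‖ * ‖g κ ω‖ + ‖f κ ω'‖ * ‖g κ ω - g κ ω'‖ := by
          rw [← norm_mul, ← norm_mul]
          exact norm_add_le _ _
      _ ≤ (K * |κ| ^ z * ‖ω - ω'‖) * (L * |κ| ^ z')
          + (K * |κ| ^ z) * (L * |κ| ^ z' * ‖ω - ω'‖) := by gcongr
      _ = _ := by ring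

theorem RingBound.const_mul (c : ℂ) (hf : RingBound B z f) :
    RingBound B z fun κ ω => c * f κ ω := by
  simpa using (ringBound_const c).mul hf

theorem RingBound.pow (hf : RingBound B z f) (n : ℕ) :
    RingBound B (z * n) fun κ ω => f κ ω ^ n := by
  induction n with
  | zero => simpa using ringBound_const (B := B) 1
  | succ n ih =>
    simp only [pow_succ]
    have := ih.mul hf
    rwa [show z * n + z = z * ((n + 1 : ℕ) : ℤ) by push_cast; ring] at this

theorem RingBound.sum {ι : Type*} {s : Finset ι} {f : ι → ℝ → ℂ → ℂ}
    (h : ∀ i ∈ s, RingBound B z (f i)) : RingBound B z fun κ ω => ∑ i ∈ s, f i κ ω := by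
  classical
  induction s using Finset.induction_on with
  | empty => simpa using ringBound_zero
  | insert i s hi ih =>
    simp only [Finset.sum_insert hi]
    exact (h i (mem_insert_self i s)).add (ih fun j hj => h j (mem_insert_of_mem hj))

theorem ringBound_degLT {f : ℂ → ℂ} (hf : f ∈ degLT z) (p : ℕ) :
    RingBound B (p * (z - 1)) fun κ ω => f ((κ : ℂ) ^ p * ω) := by
  unfold degLT at hf
  induction hf using Submodule.span_induction with
  | zero => exact ringBound_zero
  | add f g _ _ hf hg => exact hf.add hg
  | smul c f _ hf => exact hf.const_mul c
  | mem f hf =>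
    obtain ⟨b, c, hbc, rfl⟩ := hf
    have h0 : RingBound B p fun κ _ => (κ : ℂ) ^ p := by simpa using ringBound_zpow (B := B) p
    have h1 := (h0.mul ringBound_id).pow b
    have h2 := (h0.mul ringBound_conj).pow c
    refine ((h1.mul h2).mono ?_).congr fun κ _ ω => ?_
    · have : (p : ℤ) * (b + c) ≤ p * (z - 1) := by gcongr; omega
      linarith
    · simp

/-- Each lost degree in w costs κ^p, hence at least one power of κ, uniformly on the ball and also
for the Lipschitz constants. -/
theorem HasLead.ringBound_sub {v : ℂ} {f : ℂ → ℂ} (hf : HasLead z v f) {p : ℕ} (hp : 0 < p) :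
    RingBound B (p * z - 1) fun κ ω => f ((κ : ℂ) ^ p * ω) - (κ : ℂ) ^ (p * z) * (v * ω ^ z.toNat) := by
  rcases lt_or_ge z 0 with hz | hz
  · rw [hf.eq_zero hz, hf.1 hz]
    simpa using ringBound_zero
  · refine ((ringBound_degLT hf.2 p).mono ?_).congr fun κ hκ ω => ?_
    · have : (1 : ℤ) ≤ p := by omega
      linarith
    · obtain ⟨n, rfl⟩ := Int.eq_ofNat_of_zero_le hz
      simp only [Int.toNat_natCast]
      rw [mul_pow, ← pow_mul, ← Nat.cast_mul, zpow_natCast]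
      ring

theorem ringBound_pow (n : ℕ) : RingBound B 0 fun _ ω => ω ^ n := by
  simpa using (ringBound_id (B := B)).pow n

theorem TimeLead.ringBound_sub {v : ℂ} {f : ℝ → ℂ} (hf : TimeLead z v f) {m : ℕ} (hm : 0 < m) :
    RingBound B (m * z - 1) fun κ _ => f (κ ^ m) - (κ : ℂ) ^ (m * z) * v := by
  obtain ⟨K, hf⟩ := hf
  refine ringBound_of_bound ⟨|K|, abs_nonneg _, fun κ hκ => ?_⟩
  have h1 : 1 ≤ |κ ^ m| := by
    rw [abs_pow]
    exact one_le_pow₀ hκ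
  have h2 := hf (κ ^ m) h1
  rw [abs_pow, ← zpow_natCast |κ|, ← zpow_mul] at h2
  have h3 : ((κ ^ m : ℝ) : ℂ) ^ z = (κ : ℂ) ^ (m * z) := by
    rw [Complex.ofReal_pow, ← zpow_natCast (κ : ℂ), ← zpow_mul]
  rw [h3, mul_comm v] at h2
  refine h2.trans (mul_le_mul (le_abs_self K) (zpow_le_zpow_right₀ hκ ?_) (by positivity)
    (abs_nonneg K))
  have : (1 : ℤ) ≤ m := by omega
  linarith

/-- Under τ = κ^m, w = κ^p ω the leading monomial becomes a pure power of κ times a power of ω.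
Corrections in either factor lose at least one power of κ. -/
theorem ringBound_time_mul {y : ℤ} {v u : ℂ} {T : ℝ → ℂ} {f : ℂ → ℂ} (hT : TimeLead y u T)
    (hf : HasLead z v f) {m p : ℕ} (hm : 0 < m) (hp : 0 < p) :
    RingBound B (m * y + p * z - 1) (fun κ ω => T (κ ^ m) * f ((κ : ℂ) ^ p * ω)
      - (κ : ℂ) ^ (m * y + p * z) * (u * v * ω ^ z.toNat)) ∧
    RingBound B (m * y + p * z) fun κ ω => T (κ ^ m) * f ((κ : ℂ) ^ p * ω) := by
  have h1 := hT.ringBound_sub (B := B) hm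
  have h2 := hf.ringBound_sub (B := B) hp
  have h3 : RingBound B (m * y) fun κ _ => (κ : ℂ) ^ (m * y) * u := by
    simpa using (ringBound_zpow (B := B) (m * y)).mul (ringBound_const u)
  have h4 : RingBound B (p * z) fun κ ω => (κ : ℂ) ^ (p * z) * (v * ω ^ z.toNat) := by
    simpa using (ringBound_zpow (B := B) (p * z)).mul ((ringBound_pow z.toNat).const_mul v)
  have h5 : RingBound B (p * z) fun κ ω => f ((κ : ℂ) ^ p * ω) :=
    ((h2.mono (by omega)).add h4).congr fun κ _ ω => by ring
  have h6 := ((h1.mul h5).mono (by linarith : _ ≤ m * y + p * z - 1)).add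
    ((h3.mul h2).mono (by linarith : _ ≤ m * y + p * z - 1))
  have h7 : RingBound B (m * y + p * z - 1) (fun κ ω => T (κ ^ m) * f ((κ : ℂ) ^ p * ω)
      - (κ : ℂ) ^ (m * y + p * z) * (u * v * ω ^ z.toNat)) := by
    refine h6.congr fun κ hκ ω => ?_
    have hκ0 : (κ : ℂ) ≠ 0 := fun h => by
      rw [Complex.ofReal_eq_zero.1 h, abs_zero] at hκ
      linarith
    rw [zpow_add₀ hκ0]
    ring
  refine ⟨h7, ?_⟩
  exact ((h7.mono (by omega)).add (h3.mul h4)).congr fun κ hκ ω => by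
    have hκ0 : (κ : ℂ) ≠ 0 := fun h => by
      rw [Complex.ofReal_eq_zero.1 h, abs_zero] at hκ
      linarith
    rw [zpow_add₀ hκ0]
    ring

end RingBound

/-- The maximal weight on the scale of a ring. -/
def ringWeight (r : Fin (N / 2)) : ℤ :=
  ringSize N r * expT (vertex N r) + ringNum N r * expX (vertex N r)

/-- The leading parts of the Schur minors on the scale of a ring. -/
def edgePoly (k : ℕ) (a : Fin N → ℕ → ℂ) (r : Fin (N / 2)) (J : Cols N (2 * N)) (ω : ℂ) : ℂ :=
  ((2 : ℂ) ^ (∑ i, (J.1 i : ℕ)))⁻¹ *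
    ∑ D ∈ ({vertex N r, vertex N (r + 1)} : Finset (Cols N (2 * N))),
      leadTime a D.1 * (leadMinor D.1 J.1 * fall (expX D - gap J) k) * ω ^ (expX D - gap J - k).toNat

/-- By `weight_lt` every D other than the two vertices of the edge loses at least one power of κ;
the two vertices make up `edgePoly`. -/
theorem ringBound_minorDer_sub (B : ℝ) (k : ℕ) (a : Fin N → ℕ → ℂ) (r : Fin (N / 2))
    (J : Cols N (2 * N)) :
    RingBound B (ringWeight r - ringNum N r * (gap J + k) - 1) fun κ ω =>
      minorDer k a (κ ^ ringSize N r) J ((κ : ℂ) ^ ringNum N r * ω)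
        - (κ : ℂ) ^ (ringWeight r - ringNum N r * (gap J + k)) * edgePoly k a r J ω := by
  classical
  have hp := ringNum_pos r
  have hm : 0 < ringSize N r := by
    rw [ringSize_eq]
    omega
  set S : Finset (Cols N (2 * N)) := {vertex N r, vertex N (r + 1)} with hS
  have h : ∀ D ∈ (univ : Finset (Cols N (2 * N))),
      RingBound B (ringWeight r - ringNum N r * (gap J + k) - 1) fun κ ω =>
        timeMinor a (κ ^ ringSize N r) D * posDer k D J ((κ : ℂ) ^ ringNum N r * ω)
          - if D ∈ S then (κ : ℂ) ^ (ringWeight r - ringNum N r * (gap J + k)) *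
            (leadTime a D.1 * (leadMinor D.1 J.1 * fall (expX D - gap J) k)
              * ω ^ (expX D - gap J - k).toNat) else 0 := by
    intro D _
    have hD := ringBound_time_mul (B := B) (timeLead_timeMinor a D) (hasLead_posDer k D J) hm hp
    rw [← expT] at hD
    by_cases hDS : D ∈ S
    · have hw : (ringSize N r : ℤ) * expT D + ringNum N r * (expX D - gap J - k)
          = ringWeight r - ringNum N r * (gap J + k) := by
        rw [hS, mem_insert, mem_singleton] at hDS
        rw [ringWeight]
        rcases hDS with rfl | rfl
        · ring
        · rw [← weight_vertex_succ]
          ring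
      simp only [if_pos hDS]
      rw [hw] at hD
      exact hD.1
    · simp only [if_neg hDS, sub_zero]
      refine hD.2.mono ?_
      rw [hS, mem_insert, mem_singleton, not_or] at hDS
      have := weight_lt r hDS.1 hDS.2
      rw [ringWeight]
      linarith
  refine ((RingBound.sum h).const_mul ((2 : ℂ) ^ (∑ i, (J.1 i : ℕ)))⁻¹).congr fun κ _ ω => ?_
  rw [Finset.sum_sub_distrib, Finset.sum_ite_mem, univ_inter, minorDer, edgePoly, ← Finset.mul_sum,
    mul_sub]
  ring

theorem ringBound_edgePoly (B : ℝ) (k : ℕ) (a : Fin N → ℕ → ℂ) (r : Fin (N / 2))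
    (J : Cols N (2 * N)) : RingBound B 0 fun _ ω => edgePoly k a r J ω :=
  RingBound.const_mul _ (RingBound.sum fun _ _ => (ringBound_pow _).const_mul _)

theorem ringBound_minorDer (B : ℝ) (k : ℕ) (a : Fin N → ℕ → ℂ) (r : Fin (N / 2))
    (J : Cols N (2 * N)) :
    RingBound B (ringWeight r - ringNum N r * (gap J + k)) fun κ ω =>
      minorDer k a (κ ^ ringSize N r) J ((κ : ℂ) ^ ringNum N r * ω) := by
  have h1 := (ringBound_zpow (B := B) (ringWeight r - ringNum N r * (gap J + k))).mul
    (ringBound_edgePoly B k a r J)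
  rw [add_zero] at h1
  exact (((ringBound_minorDer_sub B k a r J).mono (by omega)).add h1).congr fun κ _ ω => by ring

/-! ### The leading parts -/

/-- The constant on the right-hand side of the equation for the roots of a ring. -/
def ringConst (a : Fin N → ℕ → ℂ) (r : Fin (N / 2)) : ℂ :=
  (-1 : ℂ) ^ N * ringBeta a r * ((ringSize N r)‼ : ℂ) * ((ringSize N r - 2)‼ : ℂ)

/-- The leading coefficient on the scale of a ring. -/
def edgeCoeff (a : Fin N → ℕ → ℂ) (r : Fin (N / 2)) : ℂ :=
  ((2 : ℂ) ^ (∑ i, ((firstCols N).1 i : ℕ)))⁻¹ *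
    (leadTime a (vertex N r).1 * leadMinor (vertex N r).1 (firstCols N).1)

/-- The number of lumps inside a ring. -/
def innerNum (r : Fin (N / 2)) : ℕ := (expX (vertex N (r + 1))).toNat

theorem expX_vertex_succ_eq (r : Fin (N / 2)) : expX (vertex N (r + 1)) = innerNum r := by
  have := expX_vertex_nonneg (N := N) (s := r + 1) r.2
  rw [innerNum, Int.toNat_of_nonneg this]

theorem expX_vertex_eq (r : Fin (N / 2)) : expX (vertex N r) = (innerNum r + ringSize N r : ℕ) := by
  rw [expX_vertex, expX_vertex_succ_eq]
  push_cast
  rfl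

theorem Nondegenerate.edgeCoeff_ne_zero {a : Fin N → ℕ → ℂ} (ha : Nondegenerate a)
    (r : Fin (N / 2)) : edgeCoeff a r ≠ 0 := by
  rw [edgeCoeff, leadTime_mul_leadMinor_vertex]
  exact mul_ne_zero (inv_ne_zero (pow_ne_zero _ two_ne_zero)) (mul_ne_zero (leadTime_vertexCols_ne_zero ha r.2.le)
    (leadMinor_firstCols_ne_zero vertexCols_injective))

/-- The product of the pivot ratio and the Vandermonde ratio. The minus sign, from (-1)^(N-1) =
-(-1)^N, turns the edge polynomial into ω^n (ω^m - q). -/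
theorem Nondegenerate.leadTime_mul_vertex_succ {a : Fin N → ℕ → ℂ} (ha : Nondegenerate a)
    (r : Fin (N / 2)) :
    leadTime a (vertex N (r + 1)).1 * leadMinor (vertex N (r + 1)).1 (firstCols N).1
      = -ringConst a r * (leadTime a (vertex N r).1 * leadMinor (vertex N r).1 (firstCols N).1) := by
  have hN : (-1 : ℂ) ^ N = -(-1) ^ (N - 1) := by
    have := r.2
    obtain ⟨n, rfl⟩ : ∃ n, N = n + 1 := ⟨N - 1, by omega⟩
    rw [Nat.add_sub_cancel, pow_succ]
    ring
  rw [leadTime_mul_leadMinor_vertex, leadTime_mul_leadMinor_vertex, leadTime_vertexCols_succ ha,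
    leadMinor_vertexCols_succ, ringConst, hN]
  ring

theorem vertex_ne_succ (r : Fin (N / 2)) : vertex N r ≠ vertex N (r + 1) := fun h => by
  have h1 := expX_vertex r
  have h2 := ringSize_eq r
  rw [h] at h1
  omega

/-- The derivative of `ω ^ (n + m) - q ω ^ n`. -/
def edgeSlope (a : Fin N → ℕ → ℂ) (r : Fin (N / 2)) (ω : ℂ) : ℂ :=
  edgeCoeff a r * ((innerNum r + ringSize N r : ℕ) * ω ^ (innerNum r + ringSize N r - 1)
    - ringConst a r * (innerNum r * ω ^ (innerNum r - 1)))

theorem Nondegenerate.edgePoly_zero {a : Fin N → ℕ → ℂ} (ha : Nondegenerate a) (r : Fin (N / 2))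
    (ω : ℂ) : edgePoly 0 a r (firstCols N) ω
      = edgeCoeff a r * (ω ^ (innerNum r + ringSize N r) - ringConst a r * ω ^ innerNum r) := by
  rw [edgePoly, Finset.sum_pair (vertex_ne_succ r), gap_firstCols, expX_vertex_eq,
    expX_vertex_succ_eq]
  simp only [fall, range_zero, prod_empty, mul_one, sub_zero, Nat.cast_zero, Int.toNat_natCast]
  rw [ha.leadTime_mul_vertex_succ, edgeCoeff]
  ring

theorem toNat_sub_one (n : ℕ) : ((n : ℤ) - 1).toNat = n - 1 := by omega

theorem Nondegenerate.edgePoly_one {a : Fin N → ℕ → ℂ} (ha : Nondegenerate a) (r : Fin (N / 2))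
    (ω : ℂ) : edgePoly 1 a r (firstCols N) ω = edgeSlope a r ω := by
  rw [edgePoly, Finset.sum_pair (vertex_ne_succ r), gap_firstCols, expX_vertex_eq,
    expX_vertex_succ_eq]
  simp only [fall, range_one, prod_singleton, sub_zero, Nat.cast_zero, Nat.cast_one, toNat_sub_one,
    Int.cast_natCast]
  rw [← mul_assoc, ← mul_assoc, ha.leadTime_mul_vertex_succ, edgeSlope, edgeCoeff]
  ring

theorem leadMinor_nextCols_eq (hN : 0 < N) (D : Cols N (2 * N)) :
    leadMinor D.1 (nextCols N).1 = expX D * leadMinor D.1 (firstCols N).1 := by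
  rw [leadMinor_nextCols hN, expX]
  push_cast
  simp only [firstCols_val]

theorem sum_nextCols (hN : 0 < N) :
    ∑ i, ((nextCols N).1 i : ℕ) = ∑ i, ((firstCols N).1 i : ℕ) + 1 := by
  have := gap_nextCols hN
  rw [gap] at this
  zify
  linarith

/-- Passing to the next columns multiplies each vertex coefficient by its degree, just as
differentiation in ω does. The factor 1/2 is the extra power of 2 for the larger column; its square
is the 1/4 in the model of a lump. -/
theorem Nondegenerate.edgePoly_next {a : Fin N → ℕ → ℂ} (ha : Nondegenerate a) (r : Fin (N / 2))
    (ω : ℂ) : edgePoly 0 a r (nextCols N) ω = edgeSlope a r ω * (1 / 2) := by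
  have hN : 0 < N := by
    have := r.2
    omega
  rw [edgePoly, Finset.sum_pair (vertex_ne_succ r), gap_nextCols hN, leadMinor_nextCols_eq hN,
    leadMinor_nextCols_eq hN, expX_vertex_eq, expX_vertex_succ_eq, sum_nextCols hN]
  simp only [fall, range_zero, prod_empty, mul_one, sub_zero, Nat.cast_zero, toNat_sub_one,
    Int.cast_natCast]
  have h := ha.leadTime_mul_vertex_succ r
  rw [edgeSlope, edgeCoeff, pow_succ, mul_inv]
  linear_combination ((2 : ℂ) ^ (∑ i, ((firstCols N).1 i : ℕ)))⁻¹ * (2 : ℂ)⁻¹ * innerNum r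
    * ω ^ (innerNum r - 1) * h

theorem Nondegenerate.ringConst_ne_zero {a : Fin N → ℕ → ℂ} (ha : Nondegenerate a)
    (r : Fin (N / 2)) : ringConst a r ≠ 0 := by
  have h1 : ((ringSize N r)‼ : ℂ) ≠ 0 := by exact_mod_cast (Nat.doubleFactorial_pos _).ne'
  have h2 : ((ringSize N r - 2)‼ : ℂ) ≠ 0 := by exact_mod_cast (Nat.doubleFactorial_pos _).ne'
  exact mul_ne_zero (mul_ne_zero (mul_ne_zero (pow_ne_zero _ (by norm_num))
    (ha.ringBeta_ne_zero r)) h1) h2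

theorem ringSize_pos (r : Fin (N / 2)) : 0 < ringSize N r := by
  rw [ringSize_eq]
  omega

theorem mem_ringRoots {a : Fin N → ℕ → ℂ} {r : Fin (N / 2)} {z : ℂ} :
    z ∈ ringRoots a r ↔ z ^ ringSize N r = ringConst a r :=
  Polynomial.mem_nthRootsFinset (ringSize_pos r) _

theorem Nondegenerate.ne_zero_of_mem_ringRoots {a : Fin N → ℕ → ℂ} (ha : Nondegenerate a)
    {r : Fin (N / 2)} {z : ℂ} (hz : z ∈ ringRoots a r) : z ≠ 0 := by
  rintro rfl
  rw [mem_ringRoots, zero_pow (ringSize_pos r).ne'] at hz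
  exact ha.ringConst_ne_zero r hz.symm

theorem Nondegenerate.card_ringRoots {a : Fin N → ℕ → ℂ} (ha : Nondegenerate a)
    (r : Fin (N / 2)) : (ringRoots a r).card = ringSize N r := by
  have hm := ringSize_pos r
  obtain ⟨z, hz⟩ := IsAlgClosed.exists_pow_nat_eq (ringConst a r) hm
  have : NeZero (ringSize N r) := ⟨hm.ne'⟩
  have hprim := Complex.isPrimitiveRoot_exp (ringSize N r) hm.ne'
  have h1 := hprim.card_nthRoots (ringConst a r)
  rw [if_pos ⟨z, hz⟩] at h1
  rw [ringRoots, Polynomial.nthRootsFinset, ← ringConst]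
  rw [Multiset.toFinset_card_of_nodup, h1]
  exact hprim.nthRoots_nodup (ha.ringConst_ne_zero r)

/-- The root is simple: at z^m = q, the derivative of ω^(n+m) - q ω^n multiplied by z is m z^(n+m).
-/
theorem Nondegenerate.edgeSlope_ne_zero {a : Fin N → ℕ → ℂ} (ha : Nondegenerate a)
    {r : Fin (N / 2)} {z : ℂ} (hz : z ∈ ringRoots a r) : edgeSlope a r z ≠ 0 := by
  have hz0 := ha.ne_zero_of_mem_ringRoots hz
  rw [mem_ringRoots] at hz
  refine mul_ne_zero (ha.edgeCoeff_ne_zero r) ?_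
  intro h
  have h1 := congrArg (· * z) h
  simp only [zero_mul, sub_mul, mul_assoc] at h1
  rw [← pow_succ, Nat.sub_add_cancel (by have := ringSize_pos r; omega)] at h1
  have h2 : (innerNum r : ℂ) * (z ^ (innerNum r - 1) * z) = innerNum r * z ^ innerNum r := by
    rcases Nat.eq_zero_or_pos (innerNum r) with h0 | h0
    · simp [h0]
    · rw [← pow_succ, Nat.sub_add_cancel h0]
  rw [h2, ← hz, pow_add] at h1
  have h3 : (ringSize N r : ℂ) * (z ^ innerNum r * z ^ ringSize N r) = 0 := by
    push_cast at h1
    linear_combination h1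
  have h4 : (ringSize N r : ℂ) ≠ 0 := by exact_mod_cast (ringSize_pos r).ne'
  exact mul_ne_zero h4 (mul_ne_zero (pow_ne_zero _ hz0) (pow_ne_zero _ hz0)) h3

theorem Nondegenerate.edgePoly_eq_zero_iff {a : Fin N → ℕ → ℂ} (ha : Nondegenerate a)
    {r : Fin (N / 2)} {ω : ℂ} (hω : ω ≠ 0) :
    edgePoly 0 a r (firstCols N) ω = 0 ↔ ω ∈ ringRoots a r := by
  rw [ha.edgePoly_zero, mem_ringRoots, mul_eq_zero, or_iff_right (ha.edgeCoeff_ne_zero r), pow_add,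
    mul_comm (ω ^ innerNum r), ← sub_mul, mul_eq_zero, or_iff_left (pow_ne_zero _ hω), sub_eq_zero]

end KPLump
end

noncomputable section
namespace KPLump
open Finset Filter Asymptotics Topology

variable {N : ℕ}

/-! ### Roots near the simple roots of the leading part -/

/-- A perturbation of the identity with Lipschitz constant 1/2 maps the ball of radius ρ onto the
ball of radius ρ/2 about `G z`. The functions contain conj w, so a real-variable argument is used
instead of Rouché. -/
theorem exists_zero_of_near_id {G : ℂ → ℂ} {z : ℂ} {ρ : ℝ} (hρ : 0 ≤ ρ)
    (hG : ∀ ω ω' : ℂ, ‖ω - z‖ ≤ ρ → ‖ω' - z‖ ≤ ρ → ‖G ω - G ω' - (ω - ω')‖ ≤ 1 / 2 * ‖ω - ω'‖)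
    (h0 : ‖G z‖ ≤ ρ / 2) : ∃ ω, ‖ω - z‖ ≤ ρ ∧ G ω = 0 := by
  have happ : ApproximatesLinearOn G ((ContinuousLinearEquiv.refl ℂ ℂ : ℂ ≃L[ℂ] ℂ) : ℂ →L[ℂ] ℂ)
      (Metric.closedBall z ρ) (1 / 2) := by
    refine fun ω hω ω' hω' => ?_
    rw [mem_closedBall_iff_norm] at hω hω'
    simpa using hG ω ω' hω hω'
  have h := happ.surjOn_closedBall_of_nonlinearRightInverse
    (ContinuousLinearEquiv.refl ℂ ℂ).toNonlinearRightInverse hρ subset_rfl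
  have h1 : ((ContinuousLinearEquiv.refl ℂ ℂ).toNonlinearRightInverse.nnnorm : ℝ) = 1 := by
    simp [ContinuousLinearEquiv.toNonlinearRightInverse]
  rw [h1] at h
  obtain ⟨ω, hω, h2⟩ := h (a := 0) (by
    rw [Metric.mem_closedBall, dist_comm, dist_zero_right]
    norm_num
    linarith)
  exact ⟨ω, mem_closedBall_iff_norm.1 hω, h2⟩

/-- A linearisation at the fixed point z for differences of powers, with an error constant that
shrinks as both points approach z. -/
theorem exists_pow_sub_bound (n : ℕ) (z : ℂ) {B : ℝ} (hB : ‖z‖ ≤ B) :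
    ∃ K : ℝ, 0 ≤ K ∧ ∀ ω ω' : ℂ, ‖ω‖ ≤ B → ‖ω'‖ ≤ B →
      ‖ω ^ n - ω' ^ n - n * z ^ (n - 1) * (ω - ω')‖ ≤ K * (‖ω - z‖ + ‖ω' - z‖) * ‖ω - ω'‖ := by
  have hB0 : 0 ≤ B := (norm_nonneg z).trans hB
  induction n with
  | zero => exact ⟨0, le_rfl, fun ω ω' _ _ => by simp⟩
  | succ n ih =>
    obtain ⟨K, hK, ih⟩ := ih
    obtain ⟨L, hL, hlip⟩ := ringBound_pow (B := B) n
    refine ⟨B * K + n * B ^ (n - 1) + L, by positivity, fun ω ω' hω hω' => ?_⟩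
    have hz1 : (n : ℂ) * z ^ (n - 1) * z = n * z ^ n := by
      rcases n with _ | n
      · simp
      · rw [mul_assoc, ← pow_succ, Nat.add_sub_cancel]
    have h1 : ω ^ (n + 1) - ω' ^ (n + 1) - ((n + 1 : ℕ) : ℂ) * z ^ (n + 1 - 1) * (ω - ω')
        = ω * (ω ^ n - ω' ^ n - n * z ^ (n - 1) * (ω - ω'))
          + n * z ^ (n - 1) * (ω - z) * (ω - ω') + (ω' ^ n - z ^ n) * (ω - ω') := by
      rw [Nat.add_sub_cancel]
      push_cast
      linear_combination (ω - ω') * hz1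
    rw [h1]
    have h2 : ‖ω * (ω ^ n - ω' ^ n - n * z ^ (n - 1) * (ω - ω'))‖
        ≤ B * (K * (‖ω - z‖ + ‖ω' - z‖) * ‖ω - ω'‖) := by
      rw [norm_mul]
      exact mul_le_mul hω (ih ω ω' hω hω') (norm_nonneg _) hB0
    have h3 : ‖n * z ^ (n - 1) * (ω - z) * (ω - ω')‖
        ≤ n * B ^ (n - 1) * (‖ω - z‖ + ‖ω' - z‖) * ‖ω - ω'‖ := by
      rw [norm_mul, norm_mul, norm_mul, norm_pow, Complex.norm_natCast]
      gcongr
      exact le_add_of_nonneg_right (norm_nonneg _)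
    have h4 : ‖(ω' ^ n - z ^ n) * (ω - ω')‖ ≤ L * (‖ω - z‖ + ‖ω' - z‖) * ‖ω - ω'‖ := by
      rw [norm_mul]
      have := (hlip 1 (by simp) ω' z hω' hB).2
      rw [zpow_zero, mul_one] at this
      gcongr
      exact this.trans (by gcongr; exact le_add_of_nonneg_left (norm_nonneg _))
    refine (norm_add_le _ _).trans ((add_le_add ((norm_add_le _ _).trans (add_le_add h2 h3))
      h4).trans (le_of_eq ?_))
    ring

/-- The first minor on the scale of a ring. -/
def ringFun (a : Fin N → ℕ → ℂ) (r : Fin (N / 2)) (κ : ℝ) (ω : ℂ) : ℂ :=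
  minorDer 0 a (κ ^ ringSize N r) (firstCols N) ((κ : ℂ) ^ ringNum N r * ω)

/-- The nonlinearity of the edge polynomial contributes the distances to z, and the lower order
terms of the minor contribute |κ|⁻¹. -/
theorem Nondegenerate.ringFun_sub_bound {a : Fin N → ℕ → ℂ} (ha : Nondegenerate a)
    (r : Fin (N / 2)) (z : ℂ) {B : ℝ} (hB : ‖z‖ ≤ B) :
    ∃ K : ℝ, 0 ≤ K ∧ ∀ κ : ℝ, 1 ≤ |κ| → ∀ ω ω' : ℂ, ‖ω‖ ≤ B → ‖ω'‖ ≤ B →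
      ‖ringFun a r κ ω - ringFun a r κ ω' - (κ : ℂ) ^ ringWeight r * edgeSlope a r z * (ω - ω')‖
        ≤ K * |κ| ^ ringWeight r * (‖ω - z‖ + ‖ω' - z‖ + |κ|⁻¹) * ‖ω - ω'‖ := by
  obtain ⟨K₁, hK₁, h₁⟩ := exists_pow_sub_bound (innerNum r + ringSize N r) z hB
  obtain ⟨K₂, hK₂, h₂⟩ := exists_pow_sub_bound (innerNum r) z hB
  obtain ⟨K₃, hK₃, h₃⟩ := ringBound_minorDer_sub B 0 a r (firstCols N)
  simp only [gap_firstCols, Nat.cast_zero, add_zero, mul_zero, sub_zero] at h₃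
  set c := edgeCoeff a r
  set q := ringConst a r
  refine ⟨‖c‖ * K₁ + ‖c‖ * ‖q‖ * K₂ + K₃, by positivity, fun κ hκ ω ω' hω hω' => ?_⟩
  have hκ0 : |κ| ≠ 0 := by linarith
  have e₁ := h₁ ω ω' hω hω'
  have e₂ := h₂ ω ω' hω hω'
  have e₃ := (h₃ κ hκ ω ω' hω hω').2
  rw [ha.edgePoly_zero, ha.edgePoly_zero] at e₃
  set D₁ := ω ^ (innerNum r + ringSize N r) - ω' ^ (innerNum r + ringSize N r)
    - (innerNum r + ringSize N r : ℕ) * z ^ (innerNum r + ringSize N r - 1) * (ω - ω') with hD₁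
  set D₂ := ω ^ innerNum r - ω' ^ innerNum r - innerNum r * z ^ (innerNum r - 1) * (ω - ω') with hD₂
  set D₃ := minorDer 0 a (κ ^ ringSize N r) (firstCols N) ((κ : ℂ) ^ ringNum N r * ω)
      - (κ : ℂ) ^ ringWeight r * (c * (ω ^ (innerNum r + ringSize N r) - q * ω ^ innerNum r))
    - (minorDer 0 a (κ ^ ringSize N r) (firstCols N) ((κ : ℂ) ^ ringNum N r * ω')
      - (κ : ℂ) ^ ringWeight r * (c * (ω' ^ (innerNum r + ringSize N r) - q * ω' ^ innerNum r)))
    with hD₃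
  have hsum : ringFun a r κ ω - ringFun a r κ ω'
      - (κ : ℂ) ^ ringWeight r * edgeSlope a r z * (ω - ω')
      = (κ : ℂ) ^ ringWeight r * (c * D₁) - (κ : ℂ) ^ ringWeight r * (c * (q * D₂)) + D₃ := by
    rw [hD₁, hD₂, hD₃, ringFun, ringFun, edgeSlope]
    ring
  have hn : ‖(κ : ℂ) ^ ringWeight r‖ = |κ| ^ ringWeight r := by
    rw [norm_zpow, Complex.norm_real, Real.norm_eq_abs]
  rw [hsum]
  refine (norm_add_le _ _).trans ((add_le_add (norm_sub_le _ _) e₃).trans ?_)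
  rw [norm_mul, norm_mul, norm_mul, norm_mul, norm_mul, hn]
  set P := |κ| ^ ringWeight r
  have hP : 0 ≤ P := by positivity
  set s := ‖ω - z‖ + ‖ω' - z‖ with hs
  have hinv : 0 ≤ |κ|⁻¹ := by positivity
  have hs0 : 0 ≤ s := by positivity
  have e₄ : P * (‖c‖ * ‖D₁‖) ≤ P * (‖c‖ * (K₁ * (s + |κ|⁻¹) * ‖ω - ω'‖)) := by
    gcongr
    exact e₁.trans (by gcongr; linarith)
  have e₅ : P * (‖c‖ * (‖q‖ * ‖D₂‖)) ≤ P * (‖c‖ * (‖q‖ * (K₂ * (s + |κ|⁻¹) * ‖ω - ω'‖))) := by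
    gcongr
    exact e₂.trans (by gcongr; linarith)
  have e₆ : K₃ * |κ| ^ (ringWeight r - 1) * ‖ω - ω'‖ ≤ K₃ * (P * (s + |κ|⁻¹)) * ‖ω - ω'‖ := by
    rw [zpow_sub_one₀ hκ0]
    gcongr
    linarith
  refine (add_le_add (add_le_add e₄ e₅) e₆).trans (le_of_eq ?_)
  ring

theorem Nondegenerate.exists_ringFun_root {a : Fin N → ℕ → ℂ} (ha : Nondegenerate a)
    {r : Fin (N / 2)} {z : ℂ} (hz : z ∈ ringRoots a r) :
    ∃ C T : ℝ, 0 ≤ C ∧ 1 ≤ T ∧ ∀ κ : ℝ, T ≤ |κ| → ∃ ω : ℂ, ‖ω - z‖ ≤ C * |κ|⁻¹ ∧ ringFun a r κ ω = 0 := by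
  set d := edgeSlope a r z with hd
  have hd0 : d ≠ 0 := ha.edgeSlope_ne_zero hz
  have hdn : 0 < ‖d‖ := norm_pos_iff.2 hd0
  obtain ⟨K, hK, h⟩ := ha.ringFun_sub_bound r z (B := ‖z‖ + 1) (by linarith)
  obtain ⟨L, hL, h'⟩ := ringBound_minorDer_sub (‖z‖ + 1) 0 a r (firstCols N)
  simp only [gap_firstCols, Nat.cast_zero, add_zero, mul_zero, sub_zero] at h'
  -- At z the edge polynomial vanishes, so the normalised minor is at most (L / ‖d‖) |κ|⁻¹ there,
  -- which is half the radius C |κ|⁻¹.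
  set C := 2 * (L / ‖d‖) with hC
  have hC0 : 0 ≤ C := by positivity
  -- The bound C on |κ| keeps the ball inside radius ‖z‖ + 1; the last one makes the relative
  -- linearisation error at most 1/2.
  refine ⟨C, max 1 (max C (2 * (K * (2 * C + 1) / ‖d‖))), hC0, le_max_left _ _, fun κ hκ => ?_⟩
  have hκ1 : 1 ≤ |κ| := (le_max_left _ _).trans hκ
  have hκC : C ≤ |κ| := ((le_max_left _ _).trans (le_max_right _ _)).trans hκ
  have hκK : 2 * (K * (2 * C + 1) / ‖d‖) ≤ |κ| :=
    ((le_max_right _ _).trans (le_max_right _ _)).trans hκ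
  have hκ0 : 0 < |κ| := by linarith
  have hκc : (κ : ℂ) ≠ 0 := by
    rw [Complex.ofReal_ne_zero]
    exact abs_pos.1 hκ0
  set P := (κ : ℂ) ^ ringWeight r with hP
  have hP0 : P ≠ 0 := zpow_ne_zero _ hκc
  have hn : ‖P‖ = |κ| ^ ringWeight r := by
    rw [hP, norm_zpow, Complex.norm_real, Real.norm_eq_abs]
  have hPd : P * d ≠ 0 := mul_ne_zero hP0 hd0
  have hPn : 0 < ‖P‖ := norm_pos_iff.2 hP0
  have hball : ∀ ω : ℂ, ‖ω - z‖ ≤ C * |κ|⁻¹ → ‖ω‖ ≤ ‖z‖ + 1 := fun ω hω => by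
    have h1 : C * |κ|⁻¹ ≤ 1 := by
      rw [← div_eq_mul_inv, div_le_one hκ0]
      exact hκC
    have h2 : ‖ω‖ ≤ ‖z‖ + ‖ω - z‖ := by
      simpa using norm_add_le z (ω - z)
    linarith
  obtain ⟨ω, hω, h0⟩ := exists_zero_of_near_id (G := fun ω => ringFun a r κ ω / (P * d)) (z := z)
    (ρ := C * |κ|⁻¹) (by positivity) (fun ω ω' hω hω' => by
      have h1 := h κ hκ1 ω ω' (hball ω hω) (hball ω' hω')
      have h2 : ringFun a r κ ω / (P * d) - ringFun a r κ ω' / (P * d) - (ω - ω')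
          = (ringFun a r κ ω - ringFun a r κ ω' - P * d * (ω - ω')) / (P * d) := by
        field_simp
      rw [h2, norm_div, norm_mul, div_le_iff₀ (by positivity)]
      refine h1.trans ?_
      rw [← hn]
      have h3 : ‖ω - z‖ + ‖ω' - z‖ + |κ|⁻¹ ≤ (2 * C + 1) * |κ|⁻¹ := by linarith
      have h4 : K * ((2 * C + 1) * |κ|⁻¹) ≤ 1 / 2 * ‖d‖ := by
        rw [mul_div_assoc', div_le_iff₀ hdn] at hκK
        rw [← mul_assoc, ← div_eq_mul_inv, div_le_iff₀ hκ0]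
        linarith
      calc K * ‖P‖ * (‖ω - z‖ + ‖ω' - z‖ + |κ|⁻¹) * ‖ω - ω'‖
          ≤ K * ‖P‖ * ((2 * C + 1) * |κ|⁻¹) * ‖ω - ω'‖ := by gcongr
        _ = (K * ((2 * C + 1) * |κ|⁻¹)) * ‖P‖ * ‖ω - ω'‖ := by ring
        _ ≤ (1 / 2 * ‖d‖) * ‖P‖ * ‖ω - ω'‖ := by gcongr
        _ = _ := by ring) (by
      have h1 := (h' κ hκ1 z z (by linarith) (by linarith)).1
      rw [(ha.edgePoly_eq_zero_iff (ha.ne_zero_of_mem_ringRoots hz)).2 hz, mul_zero, sub_zero,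
        zpow_sub_one₀ hκ0.ne', ← hn] at h1
      rw [norm_div, norm_mul, div_le_iff₀ (by positivity)]
      refine h1.trans (le_of_eq ?_)
      rw [hC]
      field_simp)
  exact ⟨ω, hω, (div_eq_zero_iff.1 h0).resolve_right hPd⟩

theorem minorDer_near_bound (a : Fin N → ℕ → ℂ) (r : Fin (N / 2)) (k : ℕ) (J : Cols N (2 * N))
    (z : ℂ) {B : ℝ} (hB : ‖z‖ ≤ B) :
    ∃ K : ℝ, 0 ≤ K ∧ ∀ κ : ℝ, 1 ≤ |κ| → ∀ ω : ℂ, ‖ω‖ ≤ B →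
      ‖minorDer k a (κ ^ ringSize N r) J ((κ : ℂ) ^ ringNum N r * ω)
        - (κ : ℂ) ^ (ringWeight r - ringNum N r * (gap J + k)) * edgePoly k a r J z‖
        ≤ K * |κ| ^ (ringWeight r - ringNum N r * (gap J + k)) * (‖ω - z‖ + |κ|⁻¹) := by
  obtain ⟨K₁, hK₁, h₁⟩ := ringBound_minorDer_sub B k a r J
  obtain ⟨K₂, hK₂, h₂⟩ := ringBound_edgePoly B k a r J
  refine ⟨K₁ + K₂, by positivity, fun κ hκ ω hω => ?_⟩
  have hκ0 : |κ| ≠ 0 := by linarith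
  have e₁ := (h₁ κ hκ ω ω hω hω).1
  have e₂ := (h₂ κ hκ ω z hω hB).2
  rw [zpow_zero, mul_one] at e₂
  rw [zpow_sub_one₀ hκ0] at e₁
  set e := ringWeight r - ringNum N r * (gap J + k)
  have hn : ‖(κ : ℂ) ^ e‖ = |κ| ^ e := by
    rw [norm_zpow, Complex.norm_real, Real.norm_eq_abs]
  set M := minorDer k a (κ ^ ringSize N r) J ((κ : ℂ) ^ ringNum N r * ω)
  have h3 : M - (κ : ℂ) ^ e * edgePoly k a r J z = (M - (κ : ℂ) ^ e * edgePoly k a r J ω)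
      + (κ : ℂ) ^ e * (edgePoly k a r J ω - edgePoly k a r J z) := by ring
  rw [h3]
  refine (norm_add_le _ _).trans ?_
  rw [norm_mul, hn]
  have hP : 0 ≤ |κ| ^ e := by positivity
  have hi : 0 ≤ |κ|⁻¹ := by positivity
  calc _ ≤ K₁ * (|κ| ^ e * |κ|⁻¹) + |κ| ^ e * (K₂ * ‖ω - z‖) := by gcongr
    _ ≤ K₁ * (|κ| ^ e * (‖ω - z‖ + |κ|⁻¹)) + |κ| ^ e * (K₂ * (‖ω - z‖ + |κ|⁻¹)) := by
      gcongr
      · exact le_add_of_nonneg_left (norm_nonneg _)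
      · exact le_add_of_nonneg_right hi
    _ = _ := by ring

/-! ### The real root of the slow time -/

/-- The real `m`-th root of the slow time on the scale of a ring. -/
def ringScale (r : Fin (N / 2)) (t : ℝ) : ℝ := oddPow (slow t) 1 (ringSize N r)

theorem odd_ringSize (r : Fin (N / 2)) : Odd (ringSize N r) := ⟨ringNum N r, ringSize_eq r⟩

theorem sign_pow_odd (b : ℝ) {m : ℕ} (hm : Odd m) : Real.sign b ^ m = Real.sign b := by
  rcases Real.sign_apply_eq b with h | h | h <;> rw [h]
  · exact hm.neg_one_pow
  · exact zero_pow hm.pos.ne'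
  · exact one_pow m

/-- The ring size is odd, so the sign survives the power and the root is real for both signs of the
time. -/
theorem ringScale_pow_ringSize (r : Fin (N / 2)) (t : ℝ) :
    ringScale r t ^ ringSize N r = slow t := by
  have hm : (ringSize N r : ℝ) ≠ 0 := by exact_mod_cast (ringSize_pos r).ne'
  rw [ringScale, oddPow, mul_pow, pow_one, sign_pow_odd _ (odd_ringSize r), ← Real.rpow_natCast,
    ← Real.rpow_mul (abs_nonneg _), Nat.cast_one, one_div, inv_mul_cancel₀ hm, Real.rpow_one]
  rcases lt_trichotomy (slow t) 0 with h | h | h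
  · rw [Real.sign_of_neg h, abs_of_neg h]
    ring
  · simp [h]
  · rw [Real.sign_of_pos h, abs_of_pos h, one_mul]

theorem ringScale_pow (r : Fin (N / 2)) (t : ℝ) (p : ℕ) :
    ringScale r t ^ p = oddPow (slow t) p (ringSize N r) := by
  rw [ringScale, oddPow, oddPow, mul_pow, pow_one, ← Real.rpow_natCast (|slow t| ^ _),
    ← Real.rpow_mul (abs_nonneg _)]
  congr 2
  push_cast
  ring

theorem abs_ringScale (r : Fin (N / 2)) (t : ℝ) :
    |ringScale r t| = |slow t| ^ (1 / (ringSize N r : ℝ)) := by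
  have h : |ringScale r t| ^ ringSize N r = |slow t| := by
    rw [← abs_pow, ringScale_pow_ringSize]
  rw [← h, one_div, Real.pow_rpow_inv_natCast (abs_nonneg _) (ringSize_pos r).ne']

theorem abs_slow (t : ℝ) : |slow t| = 12 * |t| := by
  rw [slow, abs_mul]
  norm_num

theorem inv_abs_ringScale_le (r : Fin (N / 2)) {t : ℝ} (ht : 0 < |t|) :
    |ringScale r t|⁻¹ ≤ |t| ^ (-(1 / (ringSize N r : ℝ))) := by
  rw [Real.rpow_neg (abs_nonneg _), abs_ringScale, abs_slow]
  gcongr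
  linarith

theorem tendsto_abs_ringScale {α : Type*} {l : Filter α} {t : α → ℝ} (r : Fin (N / 2))
    (ht : Tendsto (fun i => |t i|) l atTop) : Tendsto (fun i => |ringScale r (t i)|) l atTop := by
  have hm : (0 : ℝ) < 1 / (ringSize N r : ℝ) := by
    have : (0 : ℝ) < ringSize N r := by exact_mod_cast ringSize_pos r
    positivity
  simp only [abs_ringScale, abs_slow]
  exact (tendsto_rpow_atTop hm).comp (ht.const_mul_atTop (by norm_num))

end KPLump
end

noncomputable section
namespace KPLump
open Finset Filter Asymptotics Topology

variable {N : ℕ}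

/-! ### The lumps on the rings -/

/-- The complex coordinate on the scale of a ring. -/
def ringPos (r : Fin (N / 2)) (x y t : ℝ) : ℂ :=
  pos x y t / (ringScale r t : ℂ) ^ ringNum N r

theorem ringScale_pow_mul_ringPos {r : Fin (N / 2)} {t : ℝ} (h : ringScale r t ≠ 0) (x y : ℝ) :
    (ringScale r t : ℂ) ^ ringNum N r * ringPos r x y t = pos x y t :=
  mul_div_cancel₀ _ (pow_ne_zero _ (Complex.ofReal_ne_zero.2 h))

theorem jet_eq {r : Fin (N / 2)} {t : ℝ} (h : ringScale r t ≠ 0) (a : Fin N → ℕ → ℂ) (x y : ℝ)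
    (J : Cols N (2 * N)) (k : ℕ) :
    jet a x y t J k = minorDer k a (ringScale r t ^ ringSize N r) J
      ((ringScale r t : ℂ) ^ ringNum N r * ringPos r x y t) := by
  rw [jet, ringScale_pow_mul_ringPos h, ringScale_pow_ringSize]

theorem norm_abs_real (b : ℝ) : ‖|b|‖ = |b| := by rw [Real.norm_eq_abs, abs_abs]

section Filter

variable {α : Type*} {l : Filter α} {x y t : α → ℝ} {r : Fin (N / 2)} {a : Fin N → ℕ → ℂ}

theorem eventually_le_ringScale (r : Fin (N / 2)) (ht : Tendsto (fun i => |t i|) l atTop) (T : ℝ) :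
    ∀ᶠ i in l, T ≤ |ringScale r (t i)| :=
  (tendsto_abs_ringScale r ht).eventually_ge_atTop T

theorem ringScale_ne_zero {t : ℝ} (h : 1 ≤ |ringScale r t|) : ringScale r t ≠ 0 :=
  abs_pos.1 (by linarith)

theorem isBigO_jet (ht : Tendsto (fun i => |t i|) l atTop) {B : ℝ}
    (hB : ∀ᶠ i in l, ‖ringPos r (x i) (y i) (t i)‖ ≤ B) (J : Cols N (2 * N)) (k : ℕ) :
    (fun i => jet a (x i) (y i) (t i) J k) =O[l]
      fun i => |ringScale r (t i)| ^ (ringWeight r - ringNum N r * (gap J + k)) := by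
  obtain ⟨K, hK, h⟩ := ringBound_minorDer B k a r J
  refine IsBigO.of_bound K ?_
  filter_upwards [hB, eventually_le_ringScale r ht 1] with i h1 h2
  rw [jet_eq (ringScale_ne_zero h2), norm_zpow, norm_abs_real]
  exact (h _ h2 _ _ h1 h1).1

theorem isBigO_jet_sub (ht : Tendsto (fun i => |t i|) l atTop) {z : ℂ} {B : ℝ} (hz : ‖z‖ ≤ B)
    (hB : ∀ᶠ i in l, ‖ringPos r (x i) (y i) (t i)‖ ≤ B) (J : Cols N (2 * N)) (k : ℕ) :
    (fun i => jet a (x i) (y i) (t i) J k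
        - (ringScale r (t i) : ℂ) ^ (ringWeight r - ringNum N r * (gap J + k)) * edgePoly k a r J z)
      =O[l] fun i => |ringScale r (t i)| ^ (ringWeight r - ringNum N r * (gap J + k))
        * (‖ringPos r (x i) (y i) (t i) - z‖ + |ringScale r (t i)|⁻¹) := by
  obtain ⟨K, hK, h⟩ := minorDer_near_bound a r k J z hz
  refine IsBigO.of_bound K ?_
  filter_upwards [hB, eventually_le_ringScale r ht 1] with i h1 h2
  rw [jet_eq (ringScale_ne_zero h2), Real.norm_eq_abs, abs_of_nonneg (by positivity), ← mul_assoc]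
  exact h _ h2 _ h1

theorem isBigO_abs_zpow (ht : Tendsto (fun i => |t i|) l atTop) {z z' : ℤ} (h : z ≤ z') :
    (fun i => |ringScale r (t i)| ^ z) =O[l] fun i => |ringScale r (t i)| ^ z' := by
  refine IsBigO.of_bound 1 ?_
  filter_upwards [eventually_le_ringScale r ht 1] with i h2
  rw [norm_zpow, norm_zpow, norm_abs_real, one_mul]
  exact zpow_le_zpow_right₀ h2 h

/-- On the scale of a ring, the solution tends to zero away from the roots. -/
theorem Nondegenerate.tendsto_zero_of_ringPos (ha : Nondegenerate a)
    (ht : Tendsto (fun i => |t i|) l atTop) {ω : ℂ}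
    (hω : Tendsto (fun i => ringPos r (x i) (y i) (t i)) l (𝓝 ω)) (h0 : ω ≠ 0)
    (hroot : ω ∉ ringRoots a r) :
    Tendsto (fun i => higherLump (oddIndex N) a (x i) (y i) (t i)) l (𝓝 0) := by
  have hB : ∀ᶠ i in l, ‖ringPos r (x i) (y i) (t i)‖ ≤ ‖ω‖ + 1 := by
    filter_upwards [hω.norm.eventually (gt_mem_nhds (lt_add_one ‖ω‖))] with i hi using hi.le
  have hf : edgePoly 0 a r (firstCols N) ω ≠ 0 := fun h => hroot ((ha.edgePoly_eq_zero_iff h0).1 h)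
  set f := edgePoly 0 a r (firstCols N) ω
  have hp : (1 : ℤ) ≤ ringNum N r := by
    have := ringNum_pos r
    omega
  have hκ := tendsto_abs_ringScale r ht
  -- The edge polynomial is nonzero at ω, so the first minor has the full order κ^E, while
  -- derivatives lose at least one power of κ.
  refine tendsto_higherLump_zero (μ := fun i => (ringScale r (t i) : ℂ) ^ ringWeight r) ?_ ?_ ?_
  · have h1 := isBigO_jet_sub (a := a) ht (by linarith : ‖ω‖ ≤ ‖ω‖ + 1) hB (firstCols N) 0
    simp only [gap_firstCols, Nat.cast_zero, add_zero, mul_zero, sub_zero] at h1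
    have h2 : Tendsto (fun i => ‖ringPos r (x i) (y i) (t i) - ω‖ + |ringScale r (t i)|⁻¹) l
        (𝓝 0) := by
      have := (tendsto_iff_norm_sub_tendsto_zero.1 hω).add hκ.inv_tendsto_atTop
      simpa using this
    have h3 : (fun i => jet a (x i) (y i) (t i) (firstCols N) 0
        - (ringScale r (t i) : ℂ) ^ ringWeight r * f) =o[l]
        fun i => (ringScale r (t i) : ℂ) ^ ringWeight r * f := by
      refine h1.trans_isLittleO ?_
      have h4 := (isBigO_refl (fun i => |ringScale r (t i)| ^ ringWeight r) l).mul_isLittleO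
        ((isLittleO_one_iff ℝ).2 h2)
      refine h4.trans_isBigO (IsBigO.of_bound ‖f‖⁻¹ (Eventually.of_forall fun i => ?_))
      rw [norm_mul, norm_mul, norm_one, mul_one, norm_zpow, norm_zpow, norm_abs_real, Complex.norm_real,
        mul_comm _ ‖f‖, inv_mul_cancel_left₀ (norm_ne_zero_iff.2 hf), Real.norm_eq_abs]
    have h5 := h3.right_isBigO_add
    simp only [sub_add_cancel] at h5
    refine IsBigO.trans (IsBigO.of_bound ‖f‖⁻¹ (Eventually.of_forall fun i => ?_)) h5
    rw [norm_mul, mul_comm _ ‖f‖, inv_mul_cancel_left₀ (norm_ne_zero_iff.2 hf)]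
  · filter_upwards [eventually_le_ringScale r ht 1] with i hi
    exact zpow_ne_zero _ (Complex.ofReal_ne_zero.2 (ringScale_ne_zero hi))
  · intro J k hk
    have hk1 : 1 ≤ k := by
      simp only [mem_insert, mem_singleton] at hk
      omega
    have h1 := isBigO_jet (a := a) ht hB J k
    have h2 : ringWeight r - ringNum N r * (gap J + k) ≤ ringWeight r - 1 := by
      have := gap_nonneg J
      have : (1 : ℤ) * 1 ≤ ringNum N r * (gap J + k) := by
        gcongr
        omega
      linarith
    refine (h1.trans (isBigO_abs_zpow ht h2)).trans_isLittleO ?_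
    have h3 : (fun i => |ringScale r (t i)|⁻¹) =o[l] fun _ => (1 : ℝ) :=
      (isLittleO_one_iff ℝ).2 hκ.inv_tendsto_atTop
    have h4 := (isBigO_refl (fun i => |ringScale r (t i)| ^ ringWeight r) l).mul_isLittleO h3
    refine (h4.congr' ?_ EventuallyEq.rfl).trans_isBigO
      (IsBigO.of_bound 1 (Eventually.of_forall fun i => ?_))
    · filter_upwards [eventually_le_ringScale r ht 1] with i hi
      rw [zpow_sub_one₀ (by linarith)]
    · rw [mul_one, norm_zpow, norm_zpow, norm_abs_real, Complex.norm_real, one_mul, Real.norm_eq_abs]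

end Filter

/-- For every root there is a lump. -/
theorem Nondegenerate.exists_ringLump {a : Fin N → ℕ → ℂ} (ha : Nondegenerate a)
    {r : Fin (N / 2)} {z : ℂ} (hz : z ∈ ringRoots a r) :
    ∃ w : ℝ → ℂ,
      (∃ C T : ℝ, ∀ t : ℝ, T ≤ |t| → ∃ δ : ℂ, ‖δ‖ ≤ C * |t| ^ (-(1 / (ringSize N r : ℝ))) ∧
        w t = z * ((oddPow (-12 * t) (ringNum N r) (ringSize N r) : ℝ) : ℂ) * (1 + δ)) ∧
      (∀ l : Filter (ℝ × ℝ × ℝ), Tendsto (fun q => |q.2.2|) l atTop →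
        (fun q => pos q.1 q.2.1 q.2.2 - w q.2.2) =O[l] (fun _ => (1 : ℝ)) →
        (fun q => higherLump (oddIndex N) a q.1 q.2.1 q.2.2
          - fundLump (q.1 - (w q.2.2).re) (q.2.1 - (w q.2.2).im / 2) q.2.2)
          =O[l] fun q => |q.2.2| ^ (-(1 / (ringSize N r : ℝ)))) ∧
      (∀ l : Filter (ℝ × ℝ × ℝ), Tendsto (fun q => |q.2.2|) l atTop →
        Tendsto (fun q => ringPos r q.1 q.2.1 q.2.2) l (𝓝 z) →
        Tendsto (fun q => ‖pos q.1 q.2.1 q.2.2 - w q.2.2‖) l atTop →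
        Tendsto (fun q => higherLump (oddIndex N) a q.1 q.2.1 q.2.2) l (𝓝 0)) := by
  have hN : 0 < N := by
    have := r.2
    omega
  have hz0 : z ≠ 0 := ha.ne_zero_of_mem_ringRoots hz
  obtain ⟨C, T, hC, hT, hroot⟩ := ha.exists_ringFun_root hz
  have hroot' : ∀ κ : ℝ, ∃ ω : ℂ, T ≤ |κ| → ‖ω - z‖ ≤ C * |κ|⁻¹ ∧ ringFun a r κ ω = 0 := fun κ => by
    by_cases h : T ≤ |κ|
    · obtain ⟨ω, hω⟩ := hroot κ h
      exact ⟨ω, fun _ => hω⟩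
    · exact ⟨0, fun h' => absurd h' h⟩
  choose ω₀ hω₀ using hroot'
  obtain ⟨K, hK, hquad⟩ := ha.ringFun_sub_bound r z (B := ‖z‖ + 1) (by linarith)
  set d := edgeSlope a r z with hd
  have hd0 : d ≠ 0 := ha.edgeSlope_ne_zero hz
  have hp : (1 : ℤ) ≤ ringNum N r := by
    have := ringNum_pos r
    omega
  set E : ℤ := ringWeight r with hE
  set p : ℕ := ringNum N r with hpdef
  set κ : ℝ → ℝ := ringScale r with hκdef
  -- The lump is placed at the exact zero of the first minor, so that the linear model has no
  -- constant term.
  refine ⟨fun t => (κ t : ℂ) ^ p * ω₀ (κ t), ?_, ?_, ?_⟩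
  · have h1 := (tendsto_abs_ringScale (t := id) (l := comap (fun t : ℝ => |t|) atTop) r
      tendsto_comap).eventually_ge_atTop T
    obtain ⟨T', hT'⟩ := (eventually_comap.1 h1).exists_forall_of_atTop
    refine ⟨C / ‖z‖, max 1 T', fun t ht => ⟨ω₀ (κ t) / z - 1, ?_, ?_⟩⟩
    · have h2 : T ≤ |κ t| := hT' |t| ((le_max_right _ _).trans ht) t rfl
      have ht1 : 1 ≤ |t| := (le_max_left _ _).trans ht
      rw [div_sub_one hz0, norm_div, div_mul_eq_mul_div]
      gcongr
      exact (hω₀ _ h2).1.trans (by gcongr; exact inv_abs_ringScale_le r (by linarith))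
    · rw [← slow, ← ringScale_pow, Complex.ofReal_pow]
      field_simp
      ring
  all_goals intro l ht
  all_goals
    have hκ := tendsto_abs_ringScale r ht
    have hκ1 := eventually_le_ringScale r ht 1
    have hκT := eventually_le_ringScale r ht T
    have hω₀z : (fun q : ℝ × ℝ × ℝ => ω₀ (κ q.2.2) - z) =O[l] fun q => |κ q.2.2|⁻¹ := by
      refine IsBigO.of_bound C ?_
      filter_upwards [hκT] with q hq
      rw [norm_inv, norm_abs_real]
      exact (hω₀ _ hq).1
    have hinv0 : Tendsto (fun q : ℝ × ℝ × ℝ => |κ q.2.2|⁻¹) l (𝓝 0) := hκ.inv_tendsto_atTop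
    have hball₀ : ∀ᶠ q in l, ‖ω₀ (κ q.2.2)‖ ≤ ‖z‖ + 1 := by
      have h1 : Tendsto (fun q : ℝ × ℝ × ℝ => ω₀ (κ q.2.2)) l (𝓝 z) :=
        tendsto_sub_nhds_zero_iff.1 (hω₀z.trans_tendsto hinv0)
      filter_upwards [h1.norm.eventually (gt_mem_nhds (lt_add_one ‖z‖))] with q hq using hq.le
    have hdiff : ∀ᶠ q : ℝ × ℝ × ℝ in l, ringPos r q.1 q.2.1 q.2.2 - ω₀ (κ q.2.2)
        = (κ q.2.2 : ℂ) ^ (-(p : ℤ)) * (pos q.1 q.2.1 q.2.2 - (κ q.2.2 : ℂ) ^ p * ω₀ (κ q.2.2)) := by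
      filter_upwards [hκ1] with q hq
      have h2 : (κ q.2.2 : ℂ) ^ p ≠ 0 :=
        pow_ne_zero _ (Complex.ofReal_ne_zero.2 (ringScale_ne_zero hq))
      rw [ringPos, zpow_neg, zpow_natCast, mul_sub, inv_mul_cancel_left₀ h2, div_eq_inv_mul]
    -- The linearisation about the exact zero has an error proportional to the distance from it. It
    -- holds on the whole ball of radius ‖z‖ + 1 on the scale of the ring, and so serves both
    -- bounded and unbounded distances from the lump.
    have hfirst : ∀ᶠ q : ℝ × ℝ × ℝ in l, ‖ringPos r q.1 q.2.1 q.2.2‖ ≤ ‖z‖ + 1 →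
        ‖jet a q.1 q.2.1 q.2.2 (firstCols N) 0 - (κ q.2.2 : ℂ) ^ (E - p) * d
          * (pos q.1 q.2.1 q.2.2 - (κ q.2.2 : ℂ) ^ p * ω₀ (κ q.2.2))‖
        ≤ K * |κ q.2.2| ^ (E - p) * (‖ringPos r q.1 q.2.1 q.2.2 - z‖ + ‖ω₀ (κ q.2.2) - z‖
          + |κ q.2.2|⁻¹) * ‖pos q.1 q.2.1 q.2.2 - (κ q.2.2 : ℂ) ^ p * ω₀ (κ q.2.2)‖ := by
      filter_upwards [hκ1, hκT, hball₀, hdiff] with q h1 h2 h3 h4 h5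
      have h6 := hquad _ h1 _ _ h5 h3
      have h7 : (κ q.2.2 : ℂ) ≠ 0 := Complex.ofReal_ne_zero.2 (ringScale_ne_zero h1)
      have h8 : |κ q.2.2| ≠ 0 := abs_ne_zero.2 (ringScale_ne_zero h1)
      rw [(hω₀ _ h2).2, sub_zero, ringFun, ← jet_eq (ringScale_ne_zero h1), h4, norm_mul,
        norm_zpow, Complex.norm_real, Real.norm_eq_abs] at h6
      rw [sub_eq_add_neg E, zpow_add₀ h7, zpow_add₀ h8]
      convert h6 using 1
      · congr 1
        ring
      · ring
  · intro hζ
    set ζ : ℝ × ℝ × ℝ → ℂ := fun q => pos q.1 q.2.1 q.2.2 - (κ q.2.2 : ℂ) ^ p * ω₀ (κ q.2.2)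
      with hζdef
    have hω : (fun q : ℝ × ℝ × ℝ => ringPos r q.1 q.2.1 q.2.2 - z) =O[l] fun q => |κ q.2.2|⁻¹ := by
      have h1 : (fun q : ℝ × ℝ × ℝ => ringPos r q.1 q.2.1 q.2.2 - ω₀ (κ q.2.2))
          =O[l] fun q => |κ q.2.2|⁻¹ := by
        have h2 : (fun q : ℝ × ℝ × ℝ => (κ q.2.2 : ℂ) ^ (-(p : ℤ))) =O[l]
            fun q => |κ q.2.2|⁻¹ := by
          refine IsBigO.of_bound 1 ?_
          filter_upwards [hκ1] with q hq
          rw [norm_zpow, Complex.norm_real, Real.norm_eq_abs, norm_inv, norm_abs_real, one_mul,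
            ← zpow_neg_one]
          exact zpow_le_zpow_right₀ hq (by omega)
        have h3 := h2.mul hζ
        simp only [mul_one] at h3
        refine h3.congr' ?_ EventuallyEq.rfl
        filter_upwards [hdiff] with q hq
        rw [hq]
      exact (h1.add hω₀z).congr_left fun q => by ring
    have hball : ∀ᶠ q : ℝ × ℝ × ℝ in l, ‖ringPos r q.1 q.2.1 q.2.2‖ ≤ ‖z‖ + 1 := by
      have h1 : Tendsto (fun q : ℝ × ℝ × ℝ => ringPos r q.1 q.2.1 q.2.2) l (𝓝 z) :=
        tendsto_sub_nhds_zero_iff.1 (hω.trans_tendsto hinv0)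
      filter_upwards [h1.norm.eventually (gt_mem_nhds (lt_add_one ‖z‖))] with q hq using hq.le
    have hA : (fun q : ℝ × ℝ × ℝ => |κ q.2.2| ^ (E - p) * |κ q.2.2|⁻¹) =O[l]
        fun q => |κ q.2.2|⁻¹ * ‖(κ q.2.2 : ℂ) ^ (E - p) * d‖ := by
      refine IsBigO.of_bound ‖d‖⁻¹ (Eventually.of_forall fun q => ?_)
      simp only [norm_mul, norm_zpow, norm_inv, Complex.norm_real, Real.norm_eq_abs, abs_abs,
        abs_norm]
      have : ‖d‖ ≠ 0 := norm_ne_zero_iff.2 hd0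
      apply le_of_eq
      field_simp
    have hnear : ∀ (J : Cols N (2 * N)) (k : ℕ), gap J + k = 1 →
        (fun q : ℝ × ℝ × ℝ => jet a q.1 q.2.1 q.2.2 J k
          - (κ q.2.2 : ℂ) ^ (E - p) * edgePoly k a r J z)
          =O[l] fun q => |κ q.2.2| ^ (E - p) * |κ q.2.2|⁻¹ := by
      intro J k hJ
      have h1 := isBigO_jet_sub (a := a) ht (by linarith : ‖z‖ ≤ ‖z‖ + 1) hball J k
      rw [hJ, mul_one] at h1
      refine h1.trans ((isBigO_refl _ l).mul (hω.norm_left.add (isBigO_refl _ l)))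
    have hmain := isBigO_higherLump_sub_fundLump hN (a := a) (l := l) (x := fun q => q.1)
      (y := fun q => q.2.1) (t := fun q => q.2.2) (g := fun q => |κ q.2.2|⁻¹)
      (w := fun q => (κ q.2.2 : ℂ) ^ p * ω₀ (κ q.2.2))
      (A := fun q => (κ q.2.2 : ℂ) ^ (E - p) * d) hinv0 ?_ hζ ?_ ?_ ?_ ?_
    · refine hmain.trans (IsBigO.of_bound 1 ?_)
      filter_upwards [ht.eventually_gt_atTop 0] with q hq
      rw [one_mul, norm_inv, norm_abs_real, Real.norm_of_nonneg (Real.rpow_nonneg (abs_nonneg _) _)]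
      exact inv_abs_ringScale_le r hq
    · filter_upwards [hκ1] with q hq
      exact mul_ne_zero (zpow_ne_zero _ (Complex.ofReal_ne_zero.2 (ringScale_ne_zero hq))) hd0
    · refine IsBigO.trans ?_ hA
      have h1 : (fun q : ℝ × ℝ × ℝ => jet a q.1 q.2.1 q.2.2 (firstCols N) 0
          - (κ q.2.2 : ℂ) ^ (E - p) * d * ζ q) =O[l] fun q =>
          |κ q.2.2| ^ (E - p) * (‖ringPos r q.1 q.2.1 q.2.2 - z‖ + ‖ω₀ (κ q.2.2) - z‖
          + |κ q.2.2|⁻¹) * ‖ζ q‖ := by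
        refine IsBigO.of_bound K ?_
        filter_upwards [hfirst, hball] with q h1 h2
        rw [Real.norm_eq_abs, abs_of_nonneg (by positivity), ← mul_assoc, ← mul_assoc]
        exact h1 h2
      refine h1.trans ?_
      have h2 := (((isBigO_refl (fun q : ℝ × ℝ × ℝ => |κ q.2.2| ^ (E - p)) l).mul
        ((hω.norm_left.add hω₀z.norm_left).add (isBigO_refl _ l)))).mul hζ.norm_left
      simpa only [mul_one] using h2
    · have h1 := hnear (firstCols N) 1 (by rw [gap_firstCols]; norm_num)
      rw [ha.edgePoly_one] at h1
      exact h1.trans hA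
    · have h1 := hnear (nextCols N) 0 (by rw [gap_nextCols hN]; norm_num)
      rw [ha.edgePoly_next, ← hd] at h1
      simp only [← mul_assoc] at h1
      exact h1.trans hA
    · intro J k _ hk
      refine ((isBigO_jet ht hball J k).trans (isBigO_abs_zpow ht (z' := E - p - 1) ?_)).trans
        (IsBigO.trans ?_ hA)
      · have : (ringNum N r : ℤ) * 2 ≤ ringNum N r * (gap J + k) := by gcongr
        linarith
      · refine IsBigO.of_bound 1 ?_
        filter_upwards [hκ1] with q hq
        rw [one_mul, zpow_sub_one₀ (by linarith)]
  -- Here the point approaches z on the scale of the ring but leaves the lump. The first minor is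
  -- comparable to κ^(E-p) ζ with |ζ| → ∞, whereas all derivatives are O(κ^(E-p)).
  · intro hω hζ
    set ζ : ℝ × ℝ × ℝ → ℂ := fun q => pos q.1 q.2.1 q.2.2 - (κ q.2.2 : ℂ) ^ p * ω₀ (κ q.2.2)
      with hζdef
    have hball : ∀ᶠ q : ℝ × ℝ × ℝ in l, ‖ringPos r q.1 q.2.1 q.2.2‖ ≤ ‖z‖ + 1 := by
      filter_upwards [hω.norm.eventually (gt_mem_nhds (lt_add_one ‖z‖))] with q hq using hq.le
    refine tendsto_higherLump_zero (μ := fun q => (κ q.2.2 : ℂ) ^ (E - p) * d * ζ q) ?_ ?_ ?_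
    · have h1 : (fun q : ℝ × ℝ × ℝ => jet a q.1 q.2.1 q.2.2 (firstCols N) 0
          - (κ q.2.2 : ℂ) ^ (E - p) * d * ζ q) =O[l] fun q =>
          |κ q.2.2| ^ (E - p) * (‖ringPos r q.1 q.2.1 q.2.2 - z‖ + ‖ω₀ (κ q.2.2) - z‖
          + |κ q.2.2|⁻¹) * ‖ζ q‖ := by
        refine IsBigO.of_bound K ?_
        filter_upwards [hfirst, hball] with q h1 h2
        rw [Real.norm_eq_abs, abs_of_nonneg (by positivity), ← mul_assoc, ← mul_assoc]
        exact h1 h2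
      have h2 : Tendsto (fun q : ℝ × ℝ × ℝ => ‖ringPos r q.1 q.2.1 q.2.2 - z‖ + ‖ω₀ (κ q.2.2) - z‖
          + |κ q.2.2|⁻¹) l (𝓝 0) := by
        have := ((tendsto_iff_norm_sub_tendsto_zero.1 hω).add
          (hω₀z.norm_left.trans_tendsto hinv0)).add hinv0
        simpa using this
      have h3 := ((isBigO_refl (fun q : ℝ × ℝ × ℝ => |κ q.2.2| ^ (E - p)) l).mul_isLittleO
        ((isLittleO_one_iff ℝ).2 h2)).mul_isBigO (isBigO_refl (fun q => ‖ζ q‖) l)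
      have h4 : (fun q : ℝ × ℝ × ℝ => |κ q.2.2| ^ (E - p) * 1 * ‖ζ q‖) =O[l]
          fun q => (κ q.2.2 : ℂ) ^ (E - p) * d * ζ q := by
        refine IsBigO.of_bound ‖d‖⁻¹ (Eventually.of_forall fun q => ?_)
        have : ‖d‖ ≠ 0 := norm_ne_zero_iff.2 hd0
        simp only [norm_mul, norm_zpow, Complex.norm_real, mul_one, Real.norm_eq_abs, abs_abs, abs_norm]
        apply le_of_eq
        field_simp
      have h5 := (h1.trans_isLittleO (h3.trans_isBigO h4)).right_isBigO_add
      simpa only [sub_add_cancel] using h5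
    · filter_upwards [hκ1, hζ.eventually_gt_atTop 0] with q h1 h2
      exact mul_ne_zero (mul_ne_zero (zpow_ne_zero _
        (Complex.ofReal_ne_zero.2 (ringScale_ne_zero h1))) hd0) (norm_pos_iff.1 h2)
    · intro J k hk
      have hk1 : 1 ≤ k := by
        simp only [mem_insert, mem_singleton] at hk
        omega
      have h1 : (fun q : ℝ × ℝ × ℝ => jet a q.1 q.2.1 q.2.2 J k) =O[l]
          fun q => |κ q.2.2| ^ (E - p) := by
        refine (isBigO_jet ht hball J k).trans (isBigO_abs_zpow ht ?_)
        have := gap_nonneg J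
        have : (ringNum N r : ℤ) * 1 ≤ ringNum N r * (gap J + k) := by
          gcongr
          omega
        linarith
      have h2 : (fun _ : ℝ × ℝ × ℝ => (1 : ℝ)) =o[l] ζ :=
        (isLittleO_const_left.2 (Or.inr hζ))
      have h3 : (fun q : ℝ × ℝ × ℝ => |κ q.2.2| ^ (E - p)) =O[l]
          fun q => (κ q.2.2 : ℂ) ^ (E - p) * d := by
        refine IsBigO.of_bound ‖d‖⁻¹ (Eventually.of_forall fun q => ?_)
        have : ‖d‖ ≠ 0 := norm_ne_zero_iff.2 hd0
        simp only [norm_mul, norm_zpow, Complex.norm_real, Real.norm_eq_abs, abs_abs]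
        apply le_of_eq
        field_simp
      have h4 := (h1.trans h3).norm_left.mul_isLittleO h2.norm_left
      simp only [norm_one, mul_one] at h4
      exact isLittleO_norm_left.1 h4

end KPLump
end

noncomputable section
namespace KPLump
open Finset Filter Asymptotics Topology

variable {N : ℕ}

/-! ### The regions between the rings -/

theorem exists_bound_of_mem_degLT {z : ℤ} {f : ℂ → ℂ} (hf : f ∈ degLT z) :
    ∃ K : ℝ, 0 ≤ K ∧ ∀ w, ‖f w‖ ≤ K * ∑ n ∈ range z.toNat, ‖w‖ ^ n := by
  unfold degLT at hf
  induction hf using Submodule.span_induction with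
  | zero => exact ⟨0, le_rfl, fun w => by simp⟩
  | add f g _ _ hf hg =>
    obtain ⟨K, hK, hf⟩ := hf
    obtain ⟨L, hL, hg⟩ := hg
    refine ⟨K + L, by positivity, fun w => ?_⟩
    rw [add_mul]
    exact (norm_add_le _ _).trans (add_le_add (hf w) (hg w))
  | smul c f _ hf =>
    obtain ⟨K, hK, hf⟩ := hf
    refine ⟨‖c‖ * K, by positivity, fun w => ?_⟩
    rw [Pi.smul_apply, norm_smul, mul_assoc]
    gcongr
    exact hf w
  | mem f hf =>
    obtain ⟨b, c, hbc, rfl⟩ := hf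
    refine ⟨1, zero_le_one, fun w => ?_⟩
    rw [norm_mul, norm_pow, norm_pow, Complex.norm_conj, ← pow_add, one_mul]
    exact Finset.single_le_sum (f := fun n => ‖w‖ ^ n) (fun _ _ => by positivity)
      (mem_range.2 (by omega))

theorem expT_vertex_zero (N : ℕ) : expT (vertex N 0) = 0 := by
  obtain ⟨π, hπ⟩ := vertex_spec N 0
  have h : ∑ j, (((vertex N 0).1 j / 2 : ℕ) : ℤ) = ∑ j : Fin N, ((j : ℕ) : ℤ) := by
    rw [← Equiv.sum_comp π]
    refine Finset.sum_congr rfl fun j _ => ?_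
    have h1 := vertexCols_val N 0 j
    rw [hπ, Function.comp_apply, if_pos (by omega)] at h1
    omega
  rw [expT, h, sub_self]

theorem expT_vertex_nonneg {s : ℕ} (hs : s ≤ N / 2) : 0 ≤ expT (vertex N s) := by
  induction s with
  | zero => exact (expT_vertex_zero N).ge
  | succ s ih =>
    have h1 := expT_vertex (N := N) ⟨s, hs⟩
    have h2 := ih (by omega)
    simp only at h1
    omega

section Filter

variable {α : Type*} {l : Filter α} {x y t : α → ℝ} {a : Fin N → ℕ → ℂ}

theorem tendsto_abs_slow (ht : Tendsto (fun i => |t i|) l atTop) :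
    Tendsto (fun i => |slow (t i)|) l atTop := by
  simp only [abs_slow]
  exact ht.const_mul_atTop (by norm_num)

theorem isLittleO_abs_slow_zpow (ht : Tendsto (fun i => |t i|) l atTop) {z z' : ℤ} (h : z < z') :
    (fun i => |slow (t i)| ^ z) =o[l] fun i => |slow (t i)| ^ z' := by
  have hτ := tendsto_abs_slow ht
  have h1 : (fun i => |slow (t i)|⁻¹) =o[l] fun _ => (1 : ℝ) :=
    (isLittleO_one_iff ℝ).2 hτ.inv_tendsto_atTop
  have h2 := (isBigO_refl (fun i => |slow (t i)| ^ z') l).mul_isLittleO h1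
  simp only [mul_one] at h2
  refine IsBigO.trans_isLittleO (IsBigO.of_bound 1 ?_) h2
  filter_upwards [hτ.eventually_ge_atTop 1] with i hi
  rw [one_mul, ← zpow_sub_one₀ (by linarith), norm_zpow, norm_zpow, norm_abs_real]
  exact zpow_le_zpow_right₀ hi (by omega)

theorem isBigO_timeMinor (ht : Tendsto (fun i => |t i|) l atTop) (a : Fin N → ℕ → ℂ)
    (D : Cols N (2 * N)) :
    (fun i => timeMinor a (slow (t i)) D) =O[l] fun i => |slow (t i)| ^ expT D := by
  obtain ⟨K, -, h⟩ := (timeLead_timeMinor a D).bound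
  refine IsBigO.of_bound K ?_
  filter_upwards [(tendsto_abs_slow ht).eventually_ge_atTop 1] with i hi
  rw [norm_zpow, norm_abs_real]
  exact h _ hi

theorem isBigO_timeMinor_sub (ht : Tendsto (fun i => |t i|) l atTop) (a : Fin N → ℕ → ℂ)
    (D : Cols N (2 * N)) :
    (fun i => timeMinor a (slow (t i)) D - leadTime a D.1 * (slow (t i) : ℂ) ^ expT D) =O[l]
      fun i => |slow (t i)| ^ (expT D - 1) := by
  obtain ⟨K, h⟩ := timeLead_timeMinor a D
  refine IsBigO.of_bound K ?_
  filter_upwards [(tendsto_abs_slow ht).eventually_ge_atTop 1] with i hi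
  rw [norm_zpow, norm_abs_real]
  exact h _ hi

theorem timeMinor_of_expT_neg (a : Fin N → ℕ → ℂ) {D : Cols N (2 * N)} (h : expT D < 0) (τ : ℝ) :
    timeMinor a τ D = 0 :=
  timeMinor_eq_zero a D τ (by rw [expT] at h; linarith)

theorem isLittleO_time_mul {T : α → ℂ} {τ : α → ℝ} {e : ℤ} (hT : T =O[l] fun i => |τ i| ^ e)
    {z : ℤ} {f : ℂ → ℂ} (hf : f ∈ degLT z) {w : α → ℂ} {μ : α → ℝ}
    (h : ∀ n : ℕ, (n : ℤ) < z → (fun i => |τ i| ^ e * ‖w i‖ ^ n) =o[l] μ) :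
    (fun i => T i * f (w i)) =o[l] μ := by
  obtain ⟨K, hK, hb⟩ := exists_bound_of_mem_degLT hf
  have h1 : (fun i => f (w i)) =O[l] fun i => ∑ n ∈ range z.toNat, ‖w i‖ ^ n := by
    refine IsBigO.of_bound K (Eventually.of_forall fun i => ?_)
    rw [Real.norm_of_nonneg (Finset.sum_nonneg fun _ _ => by positivity)]
    exact hb (w i)
  refine (hT.mul h1).trans_isLittleO ?_
  simp only [Finset.mul_sum]
  refine IsLittleO.fun_sum fun n hn => h n ?_
  rw [mem_range] at hn
  omega

theorem abs_slow_zpow_mul {r : Fin (N / 2)} {t : ℝ} (h : 1 ≤ |ringScale r t|) (x y : ℝ) (e : ℤ)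
    (n : ℕ) : |slow t| ^ e * ‖pos x y t‖ ^ n
      = |ringScale r t| ^ (ringSize N r * e + ringNum N r * n) * ‖ringPos r x y t‖ ^ n := by
  rw [← ringScale_pow_mul_ringPos (ringScale_ne_zero h), ← ringScale_pow_ringSize r t, abs_pow,
    norm_mul, norm_pow, Complex.norm_real, Real.norm_eq_abs, mul_pow, zpow_add₀ (by linarith),
    ← zpow_natCast |ringScale r t|, ← zpow_mul, ← pow_mul, ← Nat.cast_mul, zpow_natCast]
  ring

/-- Conditions for the coordinate to lie between two consecutive rings. -/
structure Between (s : ℕ) (l : Filter α) (x y t : α → ℝ) : Prop where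
  outside : ∀ r : Fin (N / 2), (r : ℕ) = s →
    Tendsto (fun i => ‖ringPos r (x i) (y i) (t i)‖) l atTop
  inside : ∀ r : Fin (N / 2), (r : ℕ) + 1 = s →
    Tendsto (fun i => ‖ringPos r (x i) (y i) (t i)‖) l (𝓝 0)
  center : s = N / 2 → N % 2 = 1 → Tendsto (fun i => ‖pos (x i) (y i) (t i)‖) l atTop

/-- Between two rings a single monomial dominates. -/
theorem Between.isLittleO (hN : 1 < N) {s : ℕ} (hs : s ≤ N / 2) (hb : Between (N := N) s l x y t)
    (ht : Tendsto (fun i => |t i|) l atTop) {D : Cols N (2 * N)} (hD : 0 ≤ expT D) {n : ℕ}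
    (hn : (n : ℤ) ≤ expX D) (hne : D = vertex N s → (n : ℤ) ≠ expX (vertex N s)) :
    (fun i => |slow (t i)| ^ expT D * ‖pos (x i) (y i) (t i)‖ ^ n) =o[l]
      fun i => |slow (t i)| ^ expT (vertex N s)
        * ‖pos (x i) (y i) (t i)‖ ^ (expX (vertex N s)).toNat := by
  obtain ⟨ns, hns⟩ := Int.eq_ofNat_of_zero_le (expX_vertex_nonneg hs)
  rw [hns, Int.toNat_natCast]
  rw [hns] at hne
  -- On the inner edge the weight drops strictly except at the other end, which has the same weight
  -- but a smaller power of the slow time.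
  have hedge : ∀ r : Fin (N / 2), (r : ℕ) + 1 = s → D ≠ vertex N s →
      ringSize N r * expT D + ringNum N r * expX D + 1
        ≤ ringSize N r * expT (vertex N s) + ringNum N r * expX (vertex N s) ∨
      expT D < expT (vertex N s) := by
    intro r hr hDs
    by_cases h1 : D = vertex N r
    · right
      have h2 := expT_vertex r
      have h3 := ringNum_pos r
      rw [hr] at h2
      rw [h1, h2]
      omega
    · left
      have h2 := weight_lt r h1 (by rw [hr]; exact hDs)
      rwa [← weight_vertex_succ, hr] at h2
  -- A smaller power of w loses since w is large on the scale of the ring inside (or of the centre),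
  -- an equal one by its power of τ, and a larger one since w is small on the scale of the ring
  -- outside.
  rcases lt_trichotomy n ns with h | h | h
  · rcases hs.lt_or_eq with hs' | rfl
    · set r : Fin (N / 2) := ⟨s, hs'⟩ with hr
      have h1 := hb.outside r rfl
      have h2 : (fun i => ‖ringPos r (x i) (y i) (t i)‖ ^ n) =o[l]
          fun i => ‖ringPos r (x i) (y i) (t i)‖ ^ ns :=
        (isLittleO_pow_pow_atTop_of_lt h).comp_tendsto h1
      have h3 : ringSize N r * expT D + ringNum N r * (n : ℤ)
          ≤ ringSize N r * expT (vertex N s) + ringNum N r * ns := by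
        have := weight_le r D
        rw [show vertex N (r : ℕ) = vertex N s from rfl, hns] at this
        have h4 : (ringNum N r : ℤ) * n ≤ ringNum N r * expX D := by gcongr
        linarith
      refine ((isBigO_abs_zpow (r := r) ht h3).mul_isLittleO h2).congr' ?_ ?_ <;>
      · filter_upwards [eventually_le_ringScale r ht 1] with i hi
        rw [abs_slow_zpow_mul hi]
    · have h1 := expX_vertex_half N
      have hodd : N % 2 = 1 := by omega
      have hns1 : ns = 1 := by omega
      have hn0 : n = 0 := by omega
      subst hns1 hn0
      have hw := hb.center rfl hodd
      have hle : expT D ≤ expT (vertex N (N / 2)) := by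
        by_cases hDs : D = vertex N (N / 2)
        · rw [hDs]
        · have hr : (⟨N / 2 - 1, by omega⟩ : Fin (N / 2)).val + 1 = N / 2 := by
            simp only
            omega
          rcases hedge _ hr hDs with h2 | h2
          · rw [hns] at h2
            by_contra! h3
            have h4 := ringSize_eq (⟨N / 2 - 1, by omega⟩ : Fin (N / 2))
            set p := ringNum N (⟨N / 2 - 1, by omega⟩ : Fin (N / 2))
            rw [h4] at h2
            push_cast at h2 hn
            nlinarith [mul_nonneg (Int.natCast_nonneg p) hn]
          · exact h2.le
      have h2 : (fun i => |slow (t i)| ^ expT D) =O[l]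
          fun i => |slow (t i)| ^ expT (vertex N (N / 2)) := by
        rcases hle.lt_or_eq with h3 | h3
        · exact (isLittleO_abs_slow_zpow ht h3).isBigO
        · rw [h3]
      have h3 : (fun _ : α => (1 : ℝ)) =o[l] fun i => ‖pos (x i) (y i) (t i)‖ :=
        isLittleO_const_left.2 (Or.inr (by simpa only [Function.comp_def, norm_norm] using hw))
      simpa only [pow_zero, pow_one] using h2.mul_isLittleO h3
  · subst h
    have hDs : D ≠ vertex N s := fun h => hne h rfl
    have hlt : expT D < expT (vertex N s) := by
      rcases Nat.eq_zero_or_pos s with rfl | hs0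
      · have := expX_lt_of_expT_nonneg hD hDs
        rw [hns] at this
        omega
      · have hr : (⟨s - 1, by omega⟩ : Fin (N / 2)).val + 1 = s := by
          simp only
          omega
        rcases hedge _ hr hDs with h2 | h2
        · rw [hns] at h2
          have h3 := ringSize_pos (⟨s - 1, by omega⟩ : Fin (N / 2))
          by_contra! h4
          have h5 : (ringNum N (⟨s - 1, by omega⟩ : Fin (N / 2)) : ℤ) * n
            ≤ ringNum N (⟨s - 1, by omega⟩ : Fin (N / 2)) * expX D := by gcongr
          have h6 : (ringSize N (⟨s - 1, by omega⟩ : Fin (N / 2)) : ℤ) * expT (vertex N s)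
            ≤ ringSize N (⟨s - 1, by omega⟩ : Fin (N / 2)) * expT D := by gcongr
          linarith
        · exact h2
    exact (isLittleO_abs_slow_zpow ht hlt).mul_isBigO (isBigO_refl _ l)
  · have hs0 : 0 < s := by
      by_contra! h0
      obtain rfl : s = 0 := by omega
      by_cases hDs : D = vertex N 0
      · rw [hDs, hns] at hn
        omega
      · have := expX_lt_of_expT_nonneg hD hDs
        rw [hns] at this
        omega
    set r : Fin (N / 2) := ⟨s - 1, by omega⟩ with hr
    have hrs : (r : ℕ) + 1 = s := Nat.sub_add_cancel hs0
    have h1 := hb.inside r hrs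
    obtain ⟨j, rfl⟩ : ∃ j, n = ns + (j + 1) := ⟨n - ns - 1, by omega⟩
    have h2 : (fun i => ‖ringPos r (x i) (y i) (t i)‖ ^ (ns + (j + 1))) =o[l]
        fun i => ‖ringPos r (x i) (y i) (t i)‖ ^ ns := by
      have h3 : (fun i => ‖ringPos r (x i) (y i) (t i)‖ ^ (j + 1)) =o[l] fun _ => (1 : ℝ) :=
        (isLittleO_one_iff ℝ).2 (by simpa using h1.pow (j + 1))
      have h4 := (isBigO_refl (fun i => ‖ringPos r (x i) (y i) (t i)‖ ^ ns) l).mul_isLittleO h3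
      simpa only [← pow_add, mul_one] using h4
    have h3 : ringSize N r * expT D + ringNum N r * ((ns + (j + 1) : ℕ) : ℤ)
        ≤ ringSize N r * expT (vertex N s) + ringNum N r * ns := by
      have := weight_le r D
      rw [← weight_vertex_succ, hrs, hns] at this
      have h4 : (ringNum N r : ℤ) * (ns + (j + 1) : ℕ) ≤ ringNum N r * expX D := by gcongr
      linarith
    refine ((isBigO_abs_zpow (r := r) ht h3).mul_isLittleO h2).congr' ?_ ?_ <;>
    · filter_upwards [eventually_le_ringScale r ht 1] with i hi
      rw [abs_slow_zpow_mul hi]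

/-- The leading coefficient between two rings. -/
def vertexCoeff (a : Fin N → ℕ → ℂ) (s : ℕ) : ℂ :=
  leadTime a (vertex N s).1 * leadMinor (vertex N s).1 (firstCols N).1

theorem Nondegenerate.vertexCoeff_ne_zero (ha : Nondegenerate a) {s : ℕ} (hs : s ≤ N / 2) :
    vertexCoeff a s ≠ 0 := by
  rw [vertexCoeff, leadTime_mul_leadMinor_vertex]
  exact mul_ne_zero (leadTime_vertexCols_ne_zero ha hs)
    (leadMinor_firstCols_ne_zero vertexCols_injective)

/-- The monomial of the vertex dominates all other monomials of the first minor. In a derivative it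
is absent, its degree being lowered, so derivatives are of smaller order. -/
theorem Nondegenerate.tendsto_zero_of_between (ha : Nondegenerate a) (hN : 1 < N) {s : ℕ}
    (hs : s ≤ N / 2) (hb : Between (N := N) s l x y t) (ht : Tendsto (fun i => |t i|) l atTop) :
    Tendsto (fun i => higherLump (oddIndex N) a (x i) (y i) (t i)) l (𝓝 0) := by
  classical
  obtain ⟨ns, hns⟩ := Int.eq_ofNat_of_zero_le (expX_vertex_nonneg hs)
  set e := expT (vertex N s) with he
  set μ : α → ℂ := fun i => (slow (t i) : ℂ) ^ e * pos (x i) (y i) (t i) ^ ns with hμ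
  have hμn : ∀ i, ‖μ i‖ = |slow (t i)| ^ e * ‖pos (x i) (y i) (t i)‖ ^ ns := fun i => by
    rw [hμ]
    simp only [norm_mul, norm_zpow, norm_pow, Complex.norm_real, Real.norm_eq_abs]
  have hdom : ∀ (D : Cols N (2 * N)) (n : ℕ), 0 ≤ expT D → (n : ℤ) ≤ expX D →
      (D = vertex N s → n ≠ ns) →
      (fun i => |slow (t i)| ^ expT D * ‖pos (x i) (y i) (t i)‖ ^ n) =o[l] fun i => ‖μ i‖ := by
    intro D n hD hn hne
    have := hb.isLittleO hN hs ht hD hn fun h1 h2 => hne h1 (by rw [hns] at h2; exact_mod_cast h2)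
    simp only [hμn]
    simpa only [hns, Int.toNat_natCast] using this
  -- Sets with negative `expT` drop out identically, which is essential because w is not bounded by
  -- any power of the time.
  have hterm : ∀ (D J : Cols N (2 * N)) (k : ℕ), (D = vertex N s → 1 ≤ gap J + k) →
      (fun i => timeMinor a (slow (t i)) D * posDer k D J (pos (x i) (y i) (t i))) =o[l]
        fun i => ‖μ i‖ := by
    intro D J k hDk
    rcases lt_or_ge (expT D) 0 with hD | hD
    · simp only [timeMinor_of_expT_neg a hD, zero_mul]
      exact isLittleO_zero _ _
    · refine isLittleO_time_mul (isBigO_timeMinor ht a D) (hasLead_posDer k D J).mem_degLT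
        fun n hn => hdom D n hD ?_ fun h => ?_
      · have := gap_nonneg J
        omega
      · have h1 := hDk h
        rw [h, hns] at hn
        omega
  have hL := ha.vertexCoeff_ne_zero hs
  set c : ℂ := ((2 : ℂ) ^ (∑ i, ((firstCols N).1 i : ℕ)))⁻¹ with hc
  have hc0 : c ≠ 0 := inv_ne_zero (pow_ne_zero _ two_ne_zero)
  have hcL : ‖c * vertexCoeff a s‖ ≠ 0 := norm_ne_zero_iff.2 (mul_ne_zero hc0 hL)
  refine tendsto_higherLump_zero (μ := μ) ?_ ?_ ?_
  · have h1 : (fun i => timeMinor a (slow (t i)) (vertex N s)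
        * posDer 0 (vertex N s) (firstCols N) (pos (x i) (y i) (t i)) - vertexCoeff a s * μ i)
        =o[l] fun i => ‖μ i‖ := by
      have hlead := hasLead_posDer 0 (vertex N s) (firstCols N)
      rw [gap_firstCols, hns] at hlead
      simp only [fall, range_zero, prod_empty, mul_one, sub_zero, Nat.cast_zero] at hlead
      have h2 := isLittleO_time_mul (isBigO_timeMinor ht a (vertex N s)) hlead.2
        (w := fun i => pos (x i) (y i) (t i)) (μ := fun i => ‖μ i‖) fun n hn => by
          exact hdom _ n (expT_vertex_nonneg hs) (by rw [hns]; omega) fun _ => by omega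
      have h3 := (((isBigO_timeMinor_sub ht a (vertex N s)).trans_isLittleO
        (isLittleO_abs_slow_zpow ht (sub_one_lt e))).mul_isBigO
          (isBigO_refl (fun i => pos (x i) (y i) (t i) ^ ns) l).norm_right).const_mul_left
            (leadMinor (vertex N s).1 (firstCols N).1)
      refine (h2.add (h3.congr_right fun i => by rw [hμn, norm_pow])).congr_left fun i => ?_
      simp only [Int.toNat_natCast, vertexCoeff, hμ, ← he]
      ring
    have h2 : (fun i => jet a (x i) (y i) (t i) (firstCols N) 0 - c * vertexCoeff a s * μ i) =o[l]
        fun i => c * vertexCoeff a s * μ i := by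
      have h3 : (fun i => jet a (x i) (y i) (t i) (firstCols N) 0 - c * vertexCoeff a s * μ i)
          =o[l] fun i => ‖μ i‖ := by
        have h4 : (fun i => ∑ D ∈ univ.erase (vertex N s), timeMinor a (slow (t i)) D
            * posDer 0 D (firstCols N) (pos (x i) (y i) (t i))) =o[l] fun i => ‖μ i‖ :=
          IsLittleO.fun_sum fun D hD => hterm D _ 0 fun h => absurd h (Finset.ne_of_mem_erase hD)
        refine ((h4.add h1).const_mul_left c).congr_left fun i => ?_
        rw [jet, minorDer, ← Finset.sum_erase_add _ _ (mem_univ (vertex N s))]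
        ring
      refine h3.trans_isBigO (IsBigO.of_bound ‖c * vertexCoeff a s‖⁻¹ (Eventually.of_forall
        fun i => ?_))
      rw [norm_norm, norm_mul _ (μ i), inv_mul_cancel_left₀ hcL]
    have h3 := h2.right_isBigO_add
    simp only [sub_add_cancel] at h3
    refine IsBigO.trans (IsBigO.of_bound ‖c * vertexCoeff a s‖⁻¹ (Eventually.of_forall
      fun i => ?_)) h3
    rw [norm_mul _ (μ i), inv_mul_cancel_left₀ hcL]
  · have hpos : ∀ᶠ i in l, ns ≠ 0 → pos (x i) (y i) (t i) ≠ 0 := by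
      rcases hs.lt_or_eq with hs' | rfl
      · filter_upwards [(hb.outside ⟨s, hs'⟩ rfl).eventually_gt_atTop 0] with i hi _ h0
        rw [ringPos, h0, zero_div, norm_zero] at hi
        exact lt_irrefl _ hi
      · rcases Nat.mod_two_eq_zero_or_one N with h2 | h2
        · have h1 := expX_vertex_half N
          exact Eventually.of_forall fun i h => absurd (by omega) h
        · filter_upwards [(hb.center rfl h2).eventually_gt_atTop 0] with i hi _
          exact norm_pos_iff.1 hi
    filter_upwards [hpos, (tendsto_abs_slow ht).eventually_ge_atTop 1] with i h1 h2
    refine mul_ne_zero (zpow_ne_zero _ ?_) ?_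
    · rw [Complex.ofReal_ne_zero]
      exact abs_pos.1 (by linarith)
    · by_cases h : ns = 0
      · rw [h, pow_zero]
        exact one_ne_zero
      · exact pow_ne_zero _ (h1 h)
  · intro J k hk
    have hk1 : 1 ≤ k := by
      simp only [mem_insert, mem_singleton] at hk
      omega
    have hgap := gap_nonneg J
    have h1 : (fun i => ∑ D, timeMinor a (slow (t i)) D * posDer k D J (pos (x i) (y i) (t i)))
        =o[l] fun i => ‖μ i‖ := IsLittleO.fun_sum fun D _ => hterm D J k fun _ => by omega
    exact (isLittleO_norm_right.1 h1).const_mul_left _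

end Filter

end KPLump
end

noncomputable section
namespace KPLump
open Finset Filter Asymptotics Topology

variable {N : ℕ}

/-! ### The central lump -/

theorem exists_const_of_mem_degLT_one {f : ℂ → ℂ} (hf : f ∈ degLT 1) : ∃ c, ∀ w, f w = c := by
  unfold degLT at hf
  induction hf using Submodule.span_induction with
  | zero => exact ⟨0, fun _ => rfl⟩
  | add f g _ _ hf hg =>
    obtain ⟨b, hf⟩ := hf
    obtain ⟨c, hg⟩ := hg
    exact ⟨b + c, fun w => by rw [Pi.add_apply, hf, hg]⟩
  | smul b f _ hf =>
    obtain ⟨c, hf⟩ := hf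
    exact ⟨b * c, fun w => by rw [Pi.smul_apply, hf, smul_eq_mul]⟩
  | mem f hf =>
    obtain ⟨b, c, hbc, rfl⟩ := hf
    obtain ⟨rfl, rfl⟩ : b = 0 ∧ c = 0 := by omega
    exact ⟨1, fun w => by simp⟩

theorem exists_last_ring (hN : 1 < N) : ∃ r : Fin (N / 2), (r : ℕ) + 1 = N / 2 :=
  ⟨⟨N / 2 - 1, by omega⟩, Nat.sub_add_cancel (by omega)⟩

/-- By the last edge, a power of τ above that of the last vertex forces negative degree in w, so
such terms are absent. -/
theorem expX_neg_of_expT_gt (hN : 1 < N) (hodd : N % 2 = 1) {D : Cols N (2 * N)}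
    (h : expT (vertex N (N / 2)) < expT D) : expX D < 0 := by
  obtain ⟨r, hr⟩ := exists_last_ring hN
  have h1 := weight_le r D
  rw [← weight_vertex_succ, hr, expX_vertex_half, hodd, ringSize_eq] at h1
  by_contra! h2
  have h3 : (0 : ℤ) ≤ ringNum N r * expX D := by positivity
  have h4 : ((2 * ringNum N r + 1 : ℕ) : ℤ) * (expT (vertex N (N / 2)) + 1)
      ≤ (2 * ringNum N r + 1 : ℕ) * expT D := by
    gcongr
    exact h
  push_cast at h1 h4
  linarith

/-- Other sets with the same power of τ add at most constants in w, so the top coefficient of the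
first minor is linear in w. -/
theorem expX_nonpos_of_expT_eq (hN : 1 < N) (hodd : N % 2 = 1) {D : Cols N (2 * N)}
    (h : expT D = expT (vertex N (N / 2))) (hD : D ≠ vertex N (N / 2)) : expX D ≤ 0 := by
  obtain ⟨r, hr⟩ := exists_last_ring hN
  have hp := ringNum_pos r
  have h0 : D ≠ vertex N r := by
    rintro rfl
    have := expT_vertex r
    rw [hr] at this
    omega
  have h1 := weight_lt r h0 (by rwa [hr])
  rw [← weight_vertex_succ, hr, expX_vertex_half, hodd, h] at h1
  by_contra! h2
  have h3 : (ringNum N r : ℤ) * 1 ≤ ringNum N r * expX D := by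
    gcongr
    exact h2
  push_cast at h1
  linarith

/-- The coefficient of the top power of the slow time in a minor at the centre. -/
def centerPoly (k : ℕ) (a : Fin N → ℕ → ℂ) (J : Cols N (2 * N)) (w : ℂ) : ℂ :=
  ∑ D : Cols N (2 * N) with expT D = expT (vertex N (N / 2)), leadTime a D.1 * posDer k D J w

theorem hasLead_centerPoly (hN : 1 < N) (hodd : N % 2 = 1) (k : ℕ) (a : Fin N → ℕ → ℂ)
    (J : Cols N (2 * N)) :
    HasLead (1 - gap J - k) (leadTime a (vertex N (N / 2)).1 *
      (leadMinor (vertex N (N / 2)).1 J.1 * fall (1 - gap J) k)) (centerPoly k a J) := by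
  classical
  have h1 : ∀ D ∈ univ.filter fun D : Cols N (2 * N) => expT D = expT (vertex N (N / 2)),
      HasLead (1 - gap J - k) (if D = vertex N (N / 2) then leadTime a (vertex N (N / 2)).1 *
        (leadMinor (vertex N (N / 2)).1 J.1 * fall (1 - gap J) k) else 0)
        fun w => leadTime a D.1 * posDer k D J w := by
    intro D hD
    have hX : expX (vertex N (N / 2)) = 1 := by
      rw [expX_vertex_half, hodd]
      rfl
    have h := hasLead_posDer k D J
    split_ifs with hDv
    · rw [hDv] at h ⊢
      rw [hX] at h
      exact h.const_mul _
    · have h2 := expX_nonpos_of_expT_eq hN hodd (mem_filter.1 hD).2 hDv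
      exact hasLead_of_mem ((degLT _).smul_mem _ (degLT_mono (by omega) h.mem_degLT))
  have h2 := HasLead.sum h1
  rw [Finset.sum_ite_eq', if_pos (by simp)] at h2
  exact h2

section Filter

variable {α : Type*} {l : Filter α} {x y t : α → ℝ}

theorem isBigO_one_of_mem_degLT {z : ℤ} {f : ℂ → ℂ} (hf : f ∈ degLT z) {w : α → ℂ}
    (hw : w =O[l] fun _ => (1 : ℝ)) : (fun i => f (w i)) =O[l] fun _ => (1 : ℝ) := by
  obtain ⟨K, hK, hb⟩ := exists_bound_of_mem_degLT hf
  have h1 : (fun i => f (w i)) =O[l] fun i => ∑ n ∈ range z.toNat, ‖w i‖ ^ n := by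
    refine IsBigO.of_bound K (Eventually.of_forall fun i => ?_)
    rw [Real.norm_of_nonneg (Finset.sum_nonneg fun _ _ => by positivity)]
    exact hb (w i)
  refine h1.trans (IsBigO.fun_sum fun n _ => ?_)
  simpa using hw.norm_left.pow n

theorem isBigO_jet_sub_centerPoly (hN : 1 < N) (hodd : N % 2 = 1) (a : Fin N → ℕ → ℂ)
    (ht : Tendsto (fun i => |t i|) l atTop)
    (hw : (fun i => pos (x i) (y i) (t i)) =O[l] fun _ => (1 : ℝ)) (J : Cols N (2 * N)) (k : ℕ) :
    (fun i => jet a (x i) (y i) (t i) J k - ((2 : ℂ) ^ (∑ i, (J.1 i : ℕ)))⁻¹ *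
        ((slow (t i) : ℂ) ^ expT (vertex N (N / 2)) * centerPoly k a J (pos (x i) (y i) (t i))))
      =O[l] fun i => |slow (t i)| ^ (expT (vertex N (N / 2)) - 1) := by
  classical
  set e := expT (vertex N (N / 2)) with he
  have hterm : ∀ D ∈ (univ : Finset (Cols N (2 * N))),
      (fun i => timeMinor a (slow (t i)) D * posDer k D J (pos (x i) (y i) (t i))
        - if expT D = e then (slow (t i) : ℂ) ^ e *
          (leadTime a D.1 * posDer k D J (pos (x i) (y i) (t i))) else 0)
        =O[l] fun i => |slow (t i)| ^ (e - 1) := by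
    intro D _
    have hmem := (hasLead_posDer k D J).mem_degLT
    have hb := isBigO_one_of_mem_degLT hmem hw
    split_ifs with hD
    · have h1 := (isBigO_timeMinor_sub ht a D).mul hb
      simp only [mul_one, hD] at h1
      exact h1.congr_left fun i => by ring
    · simp only [sub_zero]
      rcases lt_or_gt_of_ne hD with h | h
      · have h1 := (isBigO_timeMinor ht a D).mul hb
        simp only [mul_one] at h1
        refine h1.trans ?_
        rcases (Int.le_sub_one_of_lt h).lt_or_eq with h2 | h2
        · exact (isLittleO_abs_slow_zpow ht h2).isBigO
        · rw [h2]
          exact isBigO_refl _ _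
      · have h1 := expX_neg_of_expT_gt hN hodd h
        have h2 := gap_nonneg J
        rw [(hasLead_posDer k D J).eq_zero (by omega)]
        simpa using isBigO_zero _ _
  refine ((IsBigO.fun_sum hterm).const_mul_left ((2 : ℂ) ^ (∑ i, (J.1 i : ℕ)))⁻¹).congr_left
    fun i => ?_
  rw [Finset.sum_sub_distrib, ← Finset.sum_filter, ← Finset.mul_sum, mul_sub]
  rfl

end Filter

/-- For odd `N` there is a lump near the centre. -/
theorem Nondegenerate.exists_centerLump {a : Fin N → ℕ → ℂ} (ha : Nondegenerate a) (hN : 1 < N)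
    (hodd : N % 2 = 1) :
    ∃ w : ℂ, ∀ l : Filter (ℝ × ℝ × ℝ), Tendsto (fun q => |q.2.2|) l atTop →
      (fun q => pos q.1 q.2.1 q.2.2 - w) =O[l] (fun _ => (1 : ℝ)) →
      Tendsto (fun q => higherLump (oddIndex N) a q.1 q.2.1 q.2.2
        - fundLump (q.1 - w.re) (q.2.1 - w.im / 2) q.2.2) l (𝓝 0) := by
  have hN0 : 0 < N := by omega
  set e := expT (vertex N (N / 2)) with he
  have hL := ha.vertexCoeff_ne_zero le_rfl
  set L := vertexCoeff a (N / 2) with hLdef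
  set c : ℂ := ((2 : ℂ) ^ (∑ i, ((firstCols N).1 i : ℕ)))⁻¹ with hc
  have hc0 : c ≠ 0 := inv_ne_zero (pow_ne_zero _ two_ne_zero)
  have hX : expX (vertex N (N / 2)) = 1 := by
    rw [expX_vertex_half, hodd]
    rfl
  have hzero : ∀ (J : Cols N (2 * N)) (k : ℕ) (w : ℂ), gap J + k = 1 → centerPoly k a J w
      = leadTime a (vertex N (N / 2)).1 * (leadMinor (vertex N (N / 2)).1 J.1 * fall (1 - gap J) k) := by
    intro J k w h
    have h1 := (hasLead_centerPoly hN hodd k a J).2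
    rw [show 1 - gap J - (k : ℤ) = 0 by omega] at h1
    have h2 := congrFun (eq_zero_of_mem_degLT le_rfl h1) w
    simpa [sub_eq_zero] using h2
  obtain ⟨b, hb⟩ : ∃ b, ∀ w, centerPoly 0 a (firstCols N) w = L * w + b := by
    have h1 := (hasLead_centerPoly hN hodd 0 a (firstCols N)).2
    simp only [gap_firstCols, sub_zero, Nat.cast_zero, fall, range_zero, prod_empty, mul_one] at h1
    obtain ⟨b, hb⟩ := exists_const_of_mem_degLT_one h1
    refine ⟨b, fun w => ?_⟩
    have := hb w
    simp only [Int.toNat_one, pow_one] at this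
    rw [← this, hLdef, vertexCoeff]
    ring
  -- The zero of the linear function L w + b; it does not depend on the time.
  refine ⟨-b / L, fun l ht hζ => ?_⟩
  have hτ := tendsto_abs_slow (t := fun q : ℝ × ℝ × ℝ => q.2.2) ht
  have hw : (fun q : ℝ × ℝ × ℝ => pos q.1 q.2.1 q.2.2) =O[l] fun _ => (1 : ℝ) :=
    (hζ.add (isBigO_const_const (-b / L) one_ne_zero l)).congr_left fun q => by ring
  have hjet := fun J k => isBigO_jet_sub_centerPoly (x := fun q : ℝ × ℝ × ℝ => q.1)
    (y := fun q => q.2.1) (t := fun q => q.2.2) hN hodd a ht hw J k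
  have hg : Tendsto (fun q : ℝ × ℝ × ℝ => |slow q.2.2|⁻¹) l (𝓝 0) := hτ.inv_tendsto_atTop
  have hA : (fun q : ℝ × ℝ × ℝ => |slow q.2.2| ^ (e - 1)) =O[l]
      fun q => |slow q.2.2|⁻¹ * ‖c * L * (slow q.2.2 : ℂ) ^ e‖ := by
    refine IsBigO.of_bound ‖c * L‖⁻¹ ?_
    filter_upwards [hτ.eventually_ge_atTop 1] with q hq
    have h1 : ‖c * L‖ ≠ 0 := norm_ne_zero_iff.2 (mul_ne_zero hc0 hL)
    have h2 : |slow q.2.2| ≠ 0 := by linarith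
    rw [norm_mul (|slow q.2.2|⁻¹), norm_norm, norm_mul (c * L), norm_zpow, norm_zpow, norm_inv,
      norm_abs_real, Complex.norm_real, Real.norm_eq_abs, zpow_sub_one₀ h2]
    apply le_of_eq
    field_simp
  refine (isBigO_higherLump_sub_fundLump hN0 (a := a) (l := l) (x := fun q => q.1)
    (y := fun q => q.2.1) (t := fun q => q.2.2) (g := fun q => |slow q.2.2|⁻¹)
    (w := fun _ => -b / L) (A := fun q => c * L * (slow q.2.2 : ℂ) ^ e) hg ?_ hζ ?_ ?_ ?_
    ?_).trans_tendsto hg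
  · filter_upwards [hτ.eventually_ge_atTop 1] with q hq
    refine mul_ne_zero (mul_ne_zero hc0 hL) (zpow_ne_zero _ ?_)
    rw [Complex.ofReal_ne_zero]
    exact abs_pos.1 (by linarith)
  · refine ((hjet (firstCols N) 0).trans hA).congr_left fun q => ?_
    have h1 : L * (-b / L) = -b := mul_div_cancel₀ _ hL
    rw [hb]
    linear_combination (-c) * (slow q.2.2 : ℂ) ^ e * h1
  · refine ((hjet (firstCols N) 1).trans hA).congr_left fun q => ?_
    rw [hzero _ _ _ (by rw [gap_firstCols]; rfl), gap_firstCols, hLdef, vertexCoeff]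
    simp only [fall, range_one, prod_singleton]
    push_cast
    ring
  · refine ((hjet (nextCols N) 0).trans hA).congr_left fun q => ?_
    rw [hzero _ _ _ (by rw [gap_nextCols hN0]; rfl), leadMinor_nextCols_eq hN0, hX, sum_nextCols hN0,
      hLdef, vertexCoeff, pow_succ, mul_inv, ← hc]
    simp only [fall, range_zero, prod_empty]
    push_cast
    ring
  · intro J k _ hk
    refine ((hjet J k).trans hA).congr_left fun q => ?_
    rw [(hasLead_centerPoly hN hodd k a J).eq_zero (by omega)]
    simp

end KPLump
end

noncomputable section
namespace KPLump
open Finset Filter Asymptotics Topology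

variable {N : ℕ}

/-! ### Separation of the lumps -/

theorem abs_ringScale_pow (r : Fin (N / 2)) (t : ℝ) :
    |ringScale r t| ^ ringNum N r = |slow t| ^ ((ringNum N r : ℝ) / ringSize N r) := by
  rw [abs_ringScale, ← Real.rpow_natCast, ← Real.rpow_mul (abs_nonneg _)]
  congr 1
  ring

section Filter

variable {α : Type*} {l : Filter α} {t : α → ℝ}

theorem tendsto_abs_ringScale_pow (r : Fin (N / 2)) (ht : Tendsto (fun i => |t i|) l atTop) :
    Tendsto (fun i => ‖(ringScale r (t i) : ℂ) ^ ringNum N r‖) l atTop := by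
  simp only [norm_pow, Complex.norm_real, Real.norm_eq_abs]
  exact (tendsto_pow_atTop (ringNum_pos r).ne').comp (tendsto_abs_ringScale r ht)

/-- The exponents p / (2p + 1) increase with p, and p decreases with r, so the rings separate, the
first being the outermost. -/
theorem tendsto_ringScale_div {r r' : Fin (N / 2)} (h : r < r')
    (ht : Tendsto (fun i => |t i|) l atTop) :
    Tendsto (fun i => (ringScale r' (t i) : ℂ) ^ ringNum N r' / (ringScale r (t i) : ℂ) ^ ringNum N r)
      l (𝓝 0) := by
  have hlt : (ringNum N r' : ℝ) / ringSize N r' < (ringNum N r : ℝ) / ringSize N r := by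
    have h1 : ringNum N r' < ringNum N r := by
      have := r'.2
      have : (r : ℕ) < r' := h
      unfold ringNum
      omega
    have h2 : (ringNum N r' : ℝ) < ringNum N r := by exact_mod_cast h1
    rw [ringSize_eq, ringSize_eq]
    push_cast
    rw [div_lt_div_iff₀ (by positivity) (by positivity)]
    nlinarith
  rw [tendsto_zero_iff_norm_tendsto_zero]
  have hτ := tendsto_abs_slow ht
  have h1 := (tendsto_rpow_neg_atTop (sub_pos.2 hlt)).comp hτ
  refine h1.congr' ?_
  filter_upwards [hτ.eventually_gt_atTop 0] with i hi
  rw [norm_div, norm_pow, norm_pow, Complex.norm_real, Complex.norm_real, Real.norm_eq_abs,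
    Real.norm_eq_abs, abs_ringScale_pow, abs_ringScale_pow, Function.comp_apply, neg_sub,
    Real.rpow_sub hi]

theorem tendsto_norm_atTop_of_div {f b : α → ℂ} {c : ℂ} (hc : c ≠ 0)
    (hb : Tendsto (fun i => ‖b i‖) l atTop) (h : Tendsto (fun i => f i / b i) l (𝓝 c)) :
    Tendsto (fun i => ‖f i‖) l atTop := by
  refine (hb.atTop_mul_pos (norm_pos_iff.2 hc) h.norm).congr' ?_
  filter_upwards [hb.eventually_gt_atTop 0] with i hi
  rw [norm_div, mul_div_cancel₀ _ hi.ne']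

theorem tendsto_norm_sub_atTop {b f g : α → ℂ} {z z' : ℂ} (hz : z ≠ z')
    (hb : Tendsto (fun i => ‖b i‖) l atTop) (hf : Tendsto (fun i => f i / b i) l (𝓝 z))
    (hg : Tendsto (fun i => g i / b i) l (𝓝 z')) :
    Tendsto (fun i => ‖f i - g i‖) l atTop :=
  tendsto_norm_atTop_of_div (sub_ne_zero.2 hz) hb (by simpa only [sub_div] using hf.sub hg)

end Filter

/-- A fundamental lump decays quadratically, hence the other lumps of the sum do not matter near a
given one. -/
theorem abs_fundLump_le (x y t : ℝ) (w : ℂ) :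
    |fundLump (x - w.re) (y - w.im / 2) t| ≤ 16 / (1 + 4 * ‖pos x y t - w‖ ^ 2) := by
  have h0 : ‖pos x y t - w‖ ^ 2 = (x - w.re - 12 * t) ^ 2 + (2 * (y - w.im / 2)) ^ 2 := by
    rw [← Complex.normSq_eq_norm_sq, Complex.normSq_apply]
    simp [pos]
    ring
  rw [h0, fundLump]
  set X := x - w.re - 12 * t
  set Y := y - w.im / 2
  have hd : 0 < 1 + 4 * X ^ 2 + 16 * Y ^ 2 := by positivity
  have he : 1 + 4 * (X ^ 2 + (2 * Y) ^ 2) = 1 + 4 * X ^ 2 + 16 * Y ^ 2 := by ring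
  rw [he, abs_div, abs_of_pos (pow_pos hd 2), div_le_div_iff₀ (pow_pos hd 2) hd, abs_mul,
    abs_of_pos (by norm_num : (0 : ℝ) < 16), pow_two (1 + 4 * X ^ 2 + 16 * Y ^ 2), ← mul_assoc]
  gcongr
  rw [abs_le]
  constructor <;> nlinarith [sq_nonneg X, sq_nonneg Y]

theorem tendsto_fundLump_zero {α : Type*} {l : Filter α} {x y t : α → ℝ} {w : α → ℂ}
    (h : Tendsto (fun i => ‖pos (x i) (y i) (t i) - w i‖) l atTop) :
    Tendsto (fun i => fundLump (x i - (w i).re) (y i - (w i).im / 2) (t i)) l (𝓝 0) := by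
  refine squeeze_zero_norm (fun i => abs_fundLump_le (x i) (y i) (t i) (w i)) ?_
  refine Tendsto.div_atTop tendsto_const_nhds ?_
  exact tendsto_atTop_add_const_left _ _
    (((tendsto_pow_atTop two_ne_zero).comp h).const_mul_atTop (by norm_num))

theorem tendsto_sum_fundLump_zero {α ι : Type*} {l : Filter α} {x y t : α → ℝ} {w : ι → α → ℂ}
    (s : Finset ι)
    (h : ∀ j ∈ s, Tendsto (fun i => ‖pos (x i) (y i) (t i) - w j i‖) l atTop) :
    Tendsto (fun i => ∑ j ∈ s, fundLump (x i - (w j i).re) (y i - (w j i).im / 2) (t i)) l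
      (𝓝 0) := by
  have h1 := tendsto_finsetSum s fun j hj => tendsto_fundLump_zero (h j hj)
  rwa [Finset.sum_const_zero] at h1

/-- Along an ultrafilter there is no oscillation, so a function either escapes to infinity or is
bounded. This replaces passing to subsequences. -/
theorem tendsto_norm_or_eventually_le {α : Type*} (u : Ultrafilter α) (f : α → ℂ) :
    Tendsto (fun i => ‖f i‖) u atTop ∨ ∃ R : ℝ, ∀ᶠ i in u, ‖f i‖ ≤ R := by
  by_contra! h
  exact h.1 (tendsto_atTop.2 fun R =>
    (h.2 R).mono fun i hi => le_of_lt hi)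

/-- Far from all lumps, the solution tends to zero. -/
theorem Nondegenerate.tendsto_zero_of_far {a : Fin N → ℕ → ℂ} (ha : Nondegenerate a) (hN : 1 < N)
    (u : Ultrafilter (ℝ × ℝ × ℝ)) (ht : Tendsto (fun q : ℝ × ℝ × ℝ => |q.2.2|) u atTop)
    (hring : ∀ r : Fin (N / 2), ∀ z ∈ ringRoots a r,
      Tendsto (fun q : ℝ × ℝ × ℝ => ringPos r q.1 q.2.1 q.2.2) u (𝓝 z) →
        Tendsto (fun q : ℝ × ℝ × ℝ => higherLump (oddIndex N) a q.1 q.2.1 q.2.2) u (𝓝 0))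
    (hcenter : N % 2 = 1 → Tendsto (fun q : ℝ × ℝ × ℝ => ‖pos q.1 q.2.1 q.2.2‖) u atTop) :
    Tendsto (fun q : ℝ × ℝ × ℝ => higherLump (oddIndex N) a q.1 q.2.1 q.2.2) u (𝓝 0) := by
  classical
  -- If some ring sees a finite nonzero limit, the behaviour on that ring decides.
  by_cases hω : ∃ (r : Fin (N / 2)) (ω : ℂ), ω ≠ 0 ∧
      Tendsto (fun q : ℝ × ℝ × ℝ => ringPos r q.1 q.2.1 q.2.2) u (𝓝 ω)
  · obtain ⟨r, ω, h0, hω⟩ := hω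
    by_cases hr : ω ∈ ringRoots a r
    · exact hring r ω hr hω
    · exact ha.tendsto_zero_of_ringPos ht hω h0 hr
  push Not at hω
  have hdich : ∀ r : Fin (N / 2), Tendsto (fun q : ℝ × ℝ × ℝ => ‖ringPos r q.1 q.2.1 q.2.2‖) u atTop ∨
      Tendsto (fun q : ℝ × ℝ × ℝ => ‖ringPos r q.1 q.2.1 q.2.2‖) u (𝓝 0) := by
    intro r
    refine (tendsto_norm_or_eventually_le u
      fun q : ℝ × ℝ × ℝ => ringPos r q.1 q.2.1 q.2.2).imp_right ?_
    -- A bounded position has a limit by compactness, and nonzero limits are excluded at this point.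
    rintro ⟨R, hR⟩
    obtain ⟨ω, -, h⟩ := (isCompact_closedBall (0 : ℂ) R).ultrafilter_le_nhds
      (u.map fun q : ℝ × ℝ × ℝ => ringPos r q.1 q.2.1 q.2.2) (by
        rw [le_principal_iff]
        refine hR.mono fun q hq => ?_
        simpa using hq)
    have h' : Tendsto (fun q : ℝ × ℝ × ℝ => ringPos r q.1 q.2.1 q.2.2) u (𝓝 ω) := h
    by_cases h0 : ω = 0
    · simpa [h0] using h'.norm
    · exact absurd h' (hω r ω h0)
  -- The first ring on whose scale the position escapes; all rings before it see the limit 0, so the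
  -- point lies between two consecutive rings. The value [N/2] stands for the absence of such a
  -- ring.
  have hex : ∃ s, s = N / 2 ∨ ∃ h : s < N / 2,
      Tendsto (fun q : ℝ × ℝ × ℝ => ‖ringPos ⟨s, h⟩ q.1 q.2.1 q.2.2‖) u atTop := ⟨N / 2, Or.inl rfl⟩
  have hs : Nat.find hex ≤ N / 2 := Nat.find_min' hex (Or.inl rfl)
  refine ha.tendsto_zero_of_between hN hs (l := u) (x := fun q : ℝ × ℝ × ℝ => q.1) (y := fun q : ℝ × ℝ × ℝ => q.2.1)
    (t := fun q : ℝ × ℝ × ℝ => q.2.2) ⟨?_, ?_, fun _ => hcenter⟩ ht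
  · intro r hr
    rcases Nat.find_spec hex with h | ⟨h1, h2⟩
    · have := r.2
      omega
    · have : r = ⟨_, h1⟩ := Fin.ext hr
      rw [this]
      exact h2
  · intro r hr
    refine (hdich r).resolve_left fun h => ?_
    exact Nat.find_min hex (m := r) (by omega) (Or.inr ⟨r.2, h⟩)

theorem sum_ringSize (N : ℕ) : ∑ r : Fin (N / 2), ringSize N r + N % 2 = N * (N + 1) / 2 := by
  -- The subtracted part of the arithmetic progression is kept on the left as 2 j² to stay within
  -- natural numbers.
  have h : ∀ j ≤ N / 2, ∑ r ∈ range j, (2 * N - 1 - 4 * r) + 2 * (j * j) = j * (2 * N + 1) := by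
    intro j hj
    induction j with
    | zero => simp
    | succ j ih =>
      have h1 := ih (by omega)
      rw [Finset.sum_range_succ]
      obtain ⟨d, hd⟩ : ∃ d, N = 2 * (j + 1) + d := ⟨N - 2 * (j + 1), by omega⟩
      have h2 : 2 * N - 1 - 4 * j = 2 * d + 3 := by omega
      rw [h2]
      subst hd
      nlinarith
  have h1 := h (N / 2) le_rfl
  simp only [ringSize]
  rw [Fin.sum_univ_eq_sum_range (fun r => 2 * N - 1 - 4 * r) (N / 2)]
  generalize ∑ r ∈ range (N / 2), (2 * N - 1 - 4 * r) = S at h1 ⊢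
  symm
  rcases Nat.even_or_odd' N with ⟨j, hj | hj⟩
  · have h2 : N / 2 = j := by omega
    have h3 : N % 2 = 0 := by omega
    rw [h2] at h1
    rw [h3]
    refine Nat.div_eq_of_eq_mul_right two_pos ?_
    subst hj
    nlinarith
  · have h2 : N / 2 = j := by omega
    have h3 : N % 2 = 1 := by omega
    rw [h2] at h1
    rw [h3]
    refine Nat.div_eq_of_eq_mul_right two_pos ?_
    subst hj
    nlinarith

/-- Everything about the lumps in terms of their complex positions. -/
theorem Nondegenerate.exists_lumps {a : Fin N → ℕ → ℂ} (ha : Nondegenerate a) (hN : 1 < N) :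
    ∃ W : LumpIndex a → ℝ → ℂ,
      (∀ (r : Fin (N / 2)) (z : {z : ℂ // z ∈ ringRoots a r}), ∃ C T : ℝ, ∀ t : ℝ, T ≤ |t| →
        ∃ δ : ℂ, ‖δ‖ ≤ C * |t| ^ (-(1 / (ringSize N r : ℝ))) ∧
          W (Sum.inl ⟨r, z⟩) t
            = z * ((oddPow (-12 * t) (ringNum N r) (ringSize N r) : ℝ) : ℂ) * (1 + δ)) ∧
      (∀ c : Fin (N % 2), ∃ w, ∀ t, W (Sum.inr c) t = w) ∧
      (∀ k l : LumpIndex a, k ≠ l →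
        Tendsto (fun t => ‖W k t - W l t‖) (comap (fun t : ℝ => |t|) atTop) atTop) ∧
      (∀ (r : Fin (N / 2)) (z : {z : ℂ // z ∈ ringRoots a r}) (l : Filter (ℝ × ℝ × ℝ)),
        Tendsto (fun q => |q.2.2|) l atTop →
        (fun q => pos q.1 q.2.1 q.2.2 - W (Sum.inl ⟨r, z⟩) q.2.2) =O[l] (fun _ => (1 : ℝ)) →
        (fun q => higherLump (oddIndex N) a q.1 q.2.1 q.2.2
          - fundLump (q.1 - (W (Sum.inl ⟨r, z⟩) q.2.2).re)
            (q.2.1 - (W (Sum.inl ⟨r, z⟩) q.2.2).im / 2) q.2.2)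
          =O[l] fun q => |q.2.2| ^ (-(1 / (ringSize N r : ℝ)))) ∧
      Tendsto (fun q : ℝ × ℝ × ℝ => higherLump (oddIndex N) a q.1 q.2.1 q.2.2
          - ∑ k, fundLump (q.1 - (W k q.2.2).re) (q.2.1 - (W k q.2.2).im / 2) q.2.2)
        (comap (fun q => |q.2.2|) atTop) (𝓝 0) := by
  classical
  choose wr hpos hloc hfar using fun (r : Fin (N / 2)) (z : {z : ℂ // z ∈ ringRoots a r}) =>
    ha.exists_ringLump z.2
  choose wc hcen using fun c : Fin (N % 2) => ha.exists_centerLump hN (by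
    have := c.2
    omega)
  set W : LumpIndex a → ℝ → ℂ :=
    Sum.elim (fun k => wr k.1 k.2) (fun c _ => wc c) with hW
  -- positions on the scales of the rings
  have hlim : ∀ (r : Fin (N / 2)) (z : {z : ℂ // z ∈ ringRoots a r}),
      Tendsto (fun t => wr r z t / (ringScale r t : ℂ) ^ ringNum N r)
        (comap (fun t : ℝ => |t|) atTop) (𝓝 (z : ℂ)) := by
    intro r z
    obtain ⟨C, T, h⟩ := hpos r z
    have ht : Tendsto (fun t : ℝ => |t|) (comap (fun t : ℝ => |t|) atTop) atTop := tendsto_comap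
    have hm : (0 : ℝ) < 1 / (ringSize N r : ℝ) := by
      have : (0 : ℝ) < ringSize N r := by exact_mod_cast ringSize_pos r
      positivity
    have h1 : Tendsto (fun t : ℝ => ‖(z : ℂ)‖ * (C * |t| ^ (-(1 / (ringSize N r : ℝ)))))
        (comap (fun t : ℝ => |t|) atTop) (𝓝 0) := by
      simpa using (((tendsto_rpow_neg_atTop hm).comp ht).const_mul C).const_mul ‖(z : ℂ)‖
    rw [← tendsto_sub_nhds_zero_iff]
    refine squeeze_zero_norm' ?_ h1
    filter_upwards [ht.eventually_ge_atTop T, eventually_le_ringScale (t := id) r ht 1] with t h2 h3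
    obtain ⟨δ, h4, h5⟩ := h t h2
    have h6 : (ringScale r t : ℂ) ^ ringNum N r ≠ 0 :=
      pow_ne_zero _ (Complex.ofReal_ne_zero.2 (ringScale_ne_zero h3))
    have h7 : wr r z t / (ringScale r t : ℂ) ^ ringNum N r - z = z * δ := by
      rw [h5, ← slow, ← ringScale_pow, Complex.ofReal_pow]
      field_simp
      ring
    rw [h7, norm_mul]
    gcongr
  have ht0 : Tendsto (fun t : ℝ => |t|) (comap (fun t : ℝ => |t|) atTop) atTop := tendsto_comap
  have hsep1 : ∀ (r : Fin (N / 2)) (z z' : {z : ℂ // z ∈ ringRoots a r}), z ≠ z' →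
      Tendsto (fun t => ‖wr r z t - wr r z' t‖) (comap (fun t : ℝ => |t|) atTop) atTop :=
    fun r z z' h => tendsto_norm_sub_atTop (fun h' => h (Subtype.ext h'))
      (tendsto_abs_ringScale_pow r ht0) (hlim r z) (hlim r z')
  -- On the scale of the outer ring the lumps of an inner ring tend to 0, while those of the outer
  -- ring tend to nonzero roots.
  have hsep2 : ∀ (r r' : Fin (N / 2)) (z : {z : ℂ // z ∈ ringRoots a r})
      (z' : {z : ℂ // z ∈ ringRoots a r'}), r < r' →
      Tendsto (fun t => ‖wr r z t - wr r' z' t‖) (comap (fun t : ℝ => |t|) atTop) atTop := by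
    intro r r' z z' h
    refine tendsto_norm_sub_atTop (ha.ne_zero_of_mem_ringRoots z.2)
      (tendsto_abs_ringScale_pow r ht0) (hlim r z) (g := wr r' z') ?_
    have h1 := (hlim r' z').mul (tendsto_ringScale_div h ht0)
    rw [mul_zero] at h1
    refine h1.congr' ?_
    filter_upwards [eventually_le_ringScale (t := id) r' ht0 1] with t h3
    have h6 : (ringScale r' t : ℂ) ^ ringNum N r' ≠ 0 :=
      pow_ne_zero _ (Complex.ofReal_ne_zero.2 (ringScale_ne_zero h3))
    rw [← mul_div_assoc, div_mul_cancel₀ _ h6]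
  have hsep3 : ∀ (r : Fin (N / 2)) (z : {z : ℂ // z ∈ ringRoots a r}) (c : Fin (N % 2)),
      Tendsto (fun t => ‖wr r z t - wc c‖) (comap (fun t : ℝ => |t|) atTop) atTop := by
    intro r z c
    refine tendsto_norm_sub_atTop (ha.ne_zero_of_mem_ringRoots z.2)
      (tendsto_abs_ringScale_pow r ht0) (hlim r z) (g := fun _ => wc c) ?_
    rw [tendsto_zero_iff_norm_tendsto_zero]
    simp only [norm_div]
    exact tendsto_const_nhds.div_atTop (tendsto_abs_ringScale_pow r ht0)
  have hsep : ∀ k l : LumpIndex a, k ≠ l →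
      Tendsto (fun t => ‖W k t - W l t‖) (comap (fun t : ℝ => |t|) atTop) atTop := by
    rintro (⟨r, z⟩ | c) (⟨r', z'⟩ | c') hkl
    · rcases lt_trichotomy r r' with h | h | h
      · exact hsep2 r r' z z' h
      · subst h
        exact hsep1 r z z' fun h => hkl (by rw [h])
      · exact (hsep2 r' r z' z h).congr fun t => norm_sub_rev _ _
    · exact hsep3 r z c'
    · exact (hsep3 r' z' c).congr fun t => norm_sub_rev _ _
    · have h1 := c.2
      have h2 := c'.2
      exact absurd (congrArg Sum.inr (Fin.ext (by omega))) hkl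
  have hlocal : ∀ (k : LumpIndex a) (l : Filter (ℝ × ℝ × ℝ)),
      Tendsto (fun q => |q.2.2|) l atTop →
      (fun q => pos q.1 q.2.1 q.2.2 - W k q.2.2) =O[l] (fun _ => (1 : ℝ)) →
      Tendsto (fun q => higherLump (oddIndex N) a q.1 q.2.1 q.2.2
        - fundLump (q.1 - (W k q.2.2).re) (q.2.1 - (W k q.2.2).im / 2) q.2.2) l (𝓝 0) := by
    rintro (⟨r, z⟩ | c) l ht hk
    · refine (hloc r z l ht hk).trans_tendsto ?_
      have hm : (0 : ℝ) < 1 / (ringSize N r : ℝ) := by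
        have : (0 : ℝ) < ringSize N r := by exact_mod_cast ringSize_pos r
        positivity
      exact (tendsto_rpow_neg_atTop hm).comp ht
    · exact hcen c l ht hk
  refine ⟨W, hpos, fun c => ⟨wc c, fun _ => rfl⟩, hsep, hloc, ?_⟩
  -- Convergence along the filter |t| → ∞ with x, y free is uniform convergence on the plane, and
  -- ultrafilters allow a case distinction on the position of the point.
  rw [tendsto_iff_ultrafilter]
  intro u hu
  have ht : Tendsto (fun q : ℝ × ℝ × ℝ => |q.2.2|) u atTop := tendsto_comap.mono_left hu
  have htime : Tendsto (fun q : ℝ × ℝ × ℝ => q.2.2) u (comap (fun t : ℝ => |t|) atTop) :=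
    tendsto_comap_iff.2 ht
  -- Either the point stays at bounded distance from one lump, and the others disappear by
  -- separation, or it leaves all lumps, and both the solution and the sum tend to zero.
  by_cases hnear : ∃ (k : LumpIndex a) (R : ℝ), ∀ᶠ q : ℝ × ℝ × ℝ in u, ‖pos q.1 q.2.1 q.2.2 - W k q.2.2‖ ≤ R
  · obtain ⟨k, R, hR⟩ := hnear
    have hO : (fun q : ℝ × ℝ × ℝ => pos q.1 q.2.1 q.2.2 - W k q.2.2) =O[u] (fun _ => (1 : ℝ)) := by
      refine IsBigO.of_bound R ?_
      simpa using hR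
    have h1 := hlocal k u ht hO
    have h2 : Tendsto (fun q : ℝ × ℝ × ℝ => ∑ j ∈ univ.erase k,
        fundLump (q.1 - (W j q.2.2).re) (q.2.1 - (W j q.2.2).im / 2) q.2.2) u (𝓝 0) := by
      refine tendsto_sum_fundLump_zero _ fun j hj => ?_
      have h3 := (hsep k j (Finset.ne_of_mem_erase hj).symm).comp htime
      refine tendsto_atTop_mono' _ ?_ (tendsto_atTop_add_const_right _ (-R) h3)
      filter_upwards [hR] with q hq
      have h4 := norm_sub_norm_le (W k q.2.2 - W j q.2.2) (W k q.2.2 - pos q.1 q.2.1 q.2.2)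
      rw [norm_sub_rev (W k q.2.2) (pos q.1 q.2.1 q.2.2), sub_sub_sub_cancel_left] at h4
      simp only [Function.comp_apply]
      linarith
    have h3 := h1.sub h2
    rw [sub_zero] at h3
    refine h3.congr fun q => ?_
    rw [← Finset.add_sum_erase _ _ (mem_univ k)]
    ring
  · have hfar' : ∀ k : LumpIndex a,
        Tendsto (fun q : ℝ × ℝ × ℝ => ‖pos q.1 q.2.1 q.2.2 - W k q.2.2‖) u atTop := fun k =>
      (tendsto_norm_or_eventually_le u _).resolve_right fun ⟨R, hR⟩ => hnear ⟨k, R, hR⟩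
    have h1 : Tendsto (fun q : ℝ × ℝ × ℝ => higherLump (oddIndex N) a q.1 q.2.1 q.2.2) u (𝓝 0) := by
      refine ha.tendsto_zero_of_far hN u ht (fun r z hz h => ?_) fun hodd => ?_
      · exact hfar r ⟨z, hz⟩ u ht h (hfar' (Sum.inl ⟨r, ⟨z, hz⟩⟩))
      · have h2 := hfar' (Sum.inr ⟨0, by omega⟩)
        refine tendsto_atTop_mono' _ ?_
          (tendsto_atTop_add_const_right _ (-‖wc ⟨0, by omega⟩‖) h2)
        filter_upwards with q
        have := norm_sub_le (pos q.1 q.2.1 q.2.2) (wc ⟨0, by omega⟩)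
        simp only [hW, Sum.elim_inr]
        linarith
    have h2 : Tendsto (fun q : ℝ × ℝ × ℝ => ∑ j,
        fundLump (q.1 - (W j q.2.2).re) (q.2.1 - (W j q.2.2).im / 2) q.2.2) u (𝓝 0) :=
      tendsto_sum_fundLump_zero _ fun j _ => hfar' j
    simpa using h1.sub h2

theorem exists_forall_of_eventually_abs {p : ℝ → Prop}
    (h : ∀ᶠ t in comap (fun t : ℝ => |t|) atTop, p t) : ∃ T : ℝ, ∀ t : ℝ, T ≤ |t| → p t := by
  obtain ⟨T, hT⟩ := (eventually_comap.1 h).exists_forall_of_atTop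
  exact ⟨T, fun t ht => hT |t| ht t rfl⟩

theorem exists_forall_of_eventually_abs_time {p : ℝ × ℝ × ℝ → Prop}
    (h : ∀ᶠ q in comap (fun q : ℝ × ℝ × ℝ => |q.2.2|) atTop, p q) :
    ∃ T : ℝ, ∀ t : ℝ, T ≤ |t| → ∀ x y : ℝ, p (x, y, t) := by
  obtain ⟨T, hT⟩ := (eventually_comap.1 h).exists_forall_of_atTop
  exact ⟨T, fun t ht x y => hT |t| ht (x, y, t) rfl⟩

end KPLump
end

/-! ### Translation from complex positions and filters to real positions and explicit bounds. -/

theorem theorem1 (N : ℕ) (hN : 1 < N) (a : Fin N → ℕ → ℂ) (ha : KPLump.Nondegenerate a) :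
    -- the `r`-th ring carries `2N - 1 - 4(r - 1)` lumps, and there are `N(N+1)/2` lumps altogether
    (∀ r : Fin (N / 2),
      (KPLump.ringRoots a r).card = KPLump.ringSize N r ∧ ∀ z ∈ KPLump.ringRoots a r, z ≠ 0) ∧
    Fintype.card (KPLump.LumpIndex a) = N * (N + 1) / 2 ∧
    -- positions `(X, Y)` of the lumps relative to `(12t, 0)`, as functions of `t`
    ∃ X Y : KPLump.LumpIndex a → ℝ → ℝ,
      -- asymptotic positions of the lumps on the rings
      (∀ (r : Fin (N / 2)) (z : {z : ℂ // z ∈ KPLump.ringRoots a r}), ∃ C T : ℝ,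
        ∀ t : ℝ, T ≤ |t| →
          ∃ δ : ℂ, ‖δ‖ ≤ C * |t| ^ (-(1 / (KPLump.ringSize N r : ℝ))) ∧
            (X (Sum.inl ⟨r, z⟩) t : ℂ) + 2 * Complex.I * (Y (Sum.inl ⟨r, z⟩) t : ℂ)
              = (z : ℂ)
                * ((KPLump.oddPow (-12 * t) (KPLump.ringNum N r) (KPLump.ringSize N r) : ℝ) : ℂ)
                * (1 + δ)) ∧
      -- the central lump, present for odd `N`, stays within bounded distance of the centre
      (∀ c : Fin (N % 2), ∃ C T : ℝ, ∀ t : ℝ, T ≤ |t| →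
        |X (Sum.inr c) t| ≤ C ∧ |Y (Sum.inr c) t| ≤ C) ∧
      -- the lumps separate from each other
      (∀ k l : KPLump.LumpIndex a, k ≠ l → ∀ R : ℝ, ∃ T : ℝ, ∀ t : ℝ, T ≤ |t| →
        R ≤ |X k t - X l t| + |Y k t - Y l t|) ∧
      -- near each lump of the rings, the solution is a fundamental lump with the stated error
      (∀ (r : Fin (N / 2)) (z : {z : ℂ // z ∈ KPLump.ringRoots a r}) (R : ℝ), ∃ C T : ℝ,
        ∀ t : ℝ, T ≤ |t| → ∀ x y : ℝ,
          |x - 12 * t - X (Sum.inl ⟨r, z⟩) t| ≤ R → |y - Y (Sum.inl ⟨r, z⟩) t| ≤ R →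
          |KPLump.higherLump (KPLump.oddIndex N) a x y t
              - KPLump.fundLump (x - X (Sum.inl ⟨r, z⟩) t) (y - Y (Sum.inl ⟨r, z⟩) t) t|
            ≤ C * |t| ^ (-(1 / (KPLump.ringSize N r : ℝ)))) ∧
      -- on the whole plane, the solution splits into these fundamental lumps
      (∀ ε : ℝ, 0 < ε → ∃ T : ℝ, ∀ t : ℝ, T ≤ |t| → ∀ x y : ℝ,
        |KPLump.higherLump (KPLump.oddIndex N) a x y t
            - ∑ k : KPLump.LumpIndex a, KPLump.fundLump (x - X k t) (y - Y k t) t| ≤ ε) := by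
  classical
  obtain ⟨W, hpos, hcenter, hsep, hloc, hall⟩ := ha.exists_lumps hN
  refine ⟨fun r => ⟨ha.card_ringRoots r, fun z hz => ha.ne_zero_of_mem_ringRoots hz⟩, ?_,
    fun k t => (W k t).re, fun k t => (W k t).im / 2, ?_, ?_, ?_, ?_, ?_⟩
  · rw [← KPLump.sum_ringSize N, Fintype.card_sum, Fintype.card_sigma, Fintype.card_fin]
    congr 1
    exact Finset.sum_congr rfl fun r _ => (Fintype.card_coe _).trans (ha.card_ringRoots r)
  · intro r z
    obtain ⟨C, T, h⟩ := hpos r z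
    refine ⟨C, T, fun t ht => ?_⟩
    obtain ⟨δ, h1, h2⟩ := h t ht
    refine ⟨δ, h1, ?_⟩
    rw [← h2]
    refine Complex.ext (by simp) ?_
    simp
    ring
  · intro c
    obtain ⟨w, hw⟩ := hcenter c
    refine ⟨max |w.re| |w.im / 2|, 0, fun t _ => ?_⟩
    simp only [hw]
    exact ⟨le_max_left _ _, le_max_right _ _⟩
  · intro k l hkl R
    -- The threshold is 2R because the second coordinate is half the imaginary part.
    obtain ⟨T, hT⟩ := KPLump.exists_forall_of_eventually_abs
      ((hsep k l hkl).eventually_ge_atTop (2 * R))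
    refine ⟨T, fun t ht => ?_⟩
    have h1 := hT t ht
    have h2 := Complex.norm_le_abs_re_add_abs_im (W k t - W l t)
    rw [Complex.sub_re, Complex.sub_im] at h2
    have h3 : |(W k t).im / 2 - (W l t).im / 2| = |(W k t).im - (W l t).im| / 2 := by
      rw [← sub_div, abs_div, abs_two]
    rw [h3]
    have h4 := abs_nonneg ((W k t).re - (W l t).re)
    linarith
  · intro r z R
    set k : KPLump.LumpIndex a := Sum.inl ⟨r, z⟩ with hk
    -- Restricting the filter to this window about the lump makes the local estimate uniform over
    -- the window.
    set S : Set (ℝ × ℝ × ℝ) := {q | |q.1 - 12 * q.2.2 - (W k q.2.2).re| ≤ R ∧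
      |q.2.1 - (W k q.2.2).im / 2| ≤ R} with hS
    have hO : (fun q : ℝ × ℝ × ℝ => KPLump.pos q.1 q.2.1 q.2.2 - W k q.2.2)
        =O[Filter.comap (fun q : ℝ × ℝ × ℝ => |q.2.2|) Filter.atTop ⊓ Filter.principal S]
          (fun _ => (1 : ℝ)) := by
      -- The real part is at most R and the imaginary part at most 2R.
      refine Asymptotics.IsBigO.of_bound (3 * R) (Filter.eventually_inf_principal.2
        (Filter.Eventually.of_forall fun q hq => ?_))
      have h1 := Complex.norm_le_abs_re_add_abs_im (KPLump.pos q.1 q.2.1 q.2.2 - W k q.2.2)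
      have h2 : (KPLump.pos q.1 q.2.1 q.2.2 - W k q.2.2).re
          = q.1 - 12 * q.2.2 - (W k q.2.2).re := by simp [KPLump.pos]
      have h3 : (KPLump.pos q.1 q.2.1 q.2.2 - W k q.2.2).im
          = 2 * (q.2.1 - (W k q.2.2).im / 2) := by
        simp [KPLump.pos]
        ring
      rw [h2, h3, abs_mul, abs_two] at h1
      rw [norm_one, mul_one]
      linarith [hq.1, hq.2]
    obtain ⟨C, hC⟩ := (hloc r z _ (Filter.tendsto_comap.mono_left inf_le_left) hO).bound
    obtain ⟨T, hT⟩ := KPLump.exists_forall_of_eventually_abs_time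
      (Filter.eventually_inf_principal.1 hC)
    refine ⟨C, T, fun t ht x y hx hy => ?_⟩
    have h1 := hT t ht x y ⟨hx, hy⟩
    rwa [Real.norm_eq_abs, Real.norm_of_nonneg (Real.rpow_nonneg (abs_nonneg _) _)] at h1
  · intro ε hε
    obtain ⟨T, hT⟩ := KPLump.exists_forall_of_eventually_abs_time
      (hall.eventually (Metric.closedBall_mem_nhds 0 hε))
    refine ⟨T, fun t ht x y => ?_⟩
    have h1 := hT t ht x y
    rwa [dist_zero_right, Real.norm_eq_abs] at h1
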